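/- Let $N\ge 3$ be an integer and $\gamma>0$. For a nonnegative Borel function $b$ on $[-1,1]$ with $\|b\|_{L^\infty}:=\sup_{t\in[-1,1]}b(t)<\infty$, put $B(z,\sigma)=|z|^{\gamma}\,b\big(\tfrac{z}{|z|}\cdot\sigma\big)$ for $z\in\mathbb R^N$, $\sigma\in\mathbb S^{N-1}$, and $$Q^+(f,g)(v)=\iint_{\mathbb R^N\times\mathbb S^{N-1}}B(v-v_*,\sigma)\,f(v')\,g(v'_*)\,d\sigma\,dv_*,\qquad v'=\tfrac{v+v_*}{2}+\tfrac{|v-v_*|}{2}\sigma,\quad v'_*=\tfrac{v+v_*}{2}-\tfrac{|v-v_*|}{2}\sigma .$$ Write $\langle v\rangle=\sqrt{1+|v|^2}$, $x^+=\max\{x,0\}$, and let $L^p_s(\mathbb R^N)$ be the space of measurable $f:\mathbb R^N\to\mathbb R$ with $\|f\|_{L^p_s}:=\|\langle\cdot\rangle^s f\|_{L^p}<\infty$ ($1\le p\le\infty$, $s\ge0$). In each estimate below, $f,g,h$ are arbitrary functions lying in all the spaces whose norms of them occur on the right-hand side; the assertion includes that the integrals defining $Q^+(g,h)$ and $Q^+(f,Q^+(g,h))$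 converge absolutely almost everywhere and that $Q^+(f,Q^+(g,h))$ lies in the space on the left-hand side. All constants depend only on $N$, $\gamma$ and on the exponent indicated by the subscript; they do not depend on $b,s,f,g,h$. Let $s\ge 0$. (i) Suppose $0<\gamma<N-2$. Let $N_\gamma=\left[\frac{N-1}{\gamma}\right]$ (integer part) and $p_n=\frac{N-1}{N-1-n\gamma}\in(1,\infty]$ for $n=1,\dots,N_\gamma$ (with $p_n=\infty$ if $n\gamma=N-1$). Then: (a) $$\|Q^+(f,Q^+(g,h))\|_{L^{p_1}_s}\le C_{p_1}\|b\|_{L^\infty}^2\|f\|_{L^1_s}\|g\|_{L^1_{s+\gamma}}\|h\|_{L^1_{s+\gamma}}.$$ (b) For $1\le n\le N_\gamma-1$, $$\|Q^+(f,Q^+(g,h))\|_{L^{p_{n+1}}_s}\le C_{p_{n+1}}\|b\|_{L^\infty}^2\|f\|_{L^{p_n}_{s+1}}\|g\|_{L^1_{s+\gamma_1}}\|h\|_{L^1_{s+\gamma_1}}^{1-\theta_n}\|h\|_{L^{p_n}_{s+\gamma_1}}^{\theta_n},$$ where $\gamma_1=\max\{\gamma,1\}$ and $\theta_n=\frac1N\left(1-\frac{N-2}{n}\right)^+$.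 (c) $$\|Q^+(f,Q^+(g,h))\|_{L^\infty_s}\le C_\infty\|b\|_{L^\infty}^2\|f\|_{L^1_s}^{1-\alpha_1}\|f\|_{L^{p_{N_\gamma}}_s}^{\alpha_1}\|g\|_{L^1_{s+\gamma_*}}\|h\|_{L^1_{s+\gamma_*}}^{1-\alpha_2}\|h\|_{L^{p_{N_\gamma}}_s}^{\alpha_2},$$ where $\gamma_*=(\gamma-1)^+$, $\alpha_1=\frac{N-1}{\gamma N_\gamma}\cdot\frac{N-1-\gamma}{N}$, $\alpha_2=\frac{N-1}{\gamma N_\gamma}\cdot\frac{(1-\gamma)^+}{N}$, and $0<\alpha_1<1$, $0\le\alpha_2<1$. (ii) Suppose $\gamma\ge N-2$. Let $1<p<N$ and $\frac1p+\frac1q=1$. Then $$\|Q^+(f,Q^+(g,h))\|_{L^p_s}\le C_p\|b\|_{L^\infty}^2\|f\|_{L^1_{s+2\gamma-N/q}}\|g\|_{L^1_{s+2\gamma-N/q}}\|h\|_{L^1_{s+2\gamma-N/q}}.$$ If moreover $\frac{N}{N-1}<p<N$, then $$\|Q^+(f,Q^+(g,h))\|_{L^\infty_s}\le C_p\|b\|_{L^\infty}^2\|f\|_{L^1_{s+\gamma+2-N}}^{1-q/N}\|f\|_{L^p_{s+\gamma+2-N}}^{q/N}\|g\|_{L^1_{s+2\gamma+1-N}}\|h\|_{L^1_{s+2\gamma+1-N}}.$$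 -/

import Mathlib

open MeasureTheory Set
open scoped ENNReal NNReal

noncomputable section

/-- The velocity space `ℝ^N` with its Euclidean norm. -/
abbrev Vel (N : ℕ) : Type := EuclideanSpace ℝ (Fin N)

/-- The unit sphere `𝕊^{N-1}`. -/
abbrev USphere (N : ℕ) : Type := Metric.sphere (0 : Vel N) 1

/-- The (unnormalized) surface measure `dσ` on the unit sphere. -/
def sphereMeasure (N : ℕ) : Measure (USphere N) := (volume : Measure (Vel N)).toSphere

/-- `⟨v⟩ = √(1 + |v|²)`. -/
def bracket {N : ℕ} (v : Vel N) : ℝ := Real.sqrt (1 + ‖v‖ ^ 2)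

/-- The norm of the weighted space `L^p_s(ℝ^N)`, i.e. the `L^p` norm of `⟨v⟩^s f(v)`
(with the essential supremum if `p = ∞`), as an extended nonnegative number. -/
def wNorm {N : ℕ} (p : ℝ≥0∞) (s : ℝ) (f : Vel N → ℝ) : ℝ≥0∞ :=
  eLpNorm (fun v => bracket v ^ s * f v) p volume

/-- Membership in the weighted space `L^p_s(ℝ^N)`. -/
def MemW {N : ℕ} (p : ℝ≥0∞) (s : ℝ) (f : Vel N → ℝ) : Prop :=
  MemLp (fun v => bracket v ^ s * f v) p volume

/-- The collision kernel `B(z,σ) = |z|^γ b(z/|z| · σ)`. -/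
def collisionKernel {N : ℕ} (γ : ℝ) (b : ℝ → ℝ) (z : Vel N) (σ : USphere N) : ℝ :=
  ‖z‖ ^ γ * b (inner ℝ (‖z‖⁻¹ • z) (σ : Vel N))

/-- `‖b‖_{L^∞} = sup_{t ∈ [-1,1]} b(t)`, for a nonnegative bounded `b`. -/
def supNorm (b : ℝ → ℝ) : ℝ := sSup (b '' Icc (-1) 1)

/-- `v' = (v + v_*)/2 + (|v - v_*|/2) σ`. -/
def velPrime {N : ℕ} (v vs : Vel N) (σ : USphere N) : Vel N :=
  (1 / 2 : ℝ) • (v + vs) + (‖v - vs‖ / 2) • (σ : Vel N)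

/-- `v_*' = (v + v_*)/2 - (|v - v_*|/2) σ`. -/
def velStarPrime {N : ℕ} (v vs : Vel N) (σ : USphere N) : Vel N :=
  (1 / 2 : ℝ) • (v + vs) - (‖v - vs‖ / 2) • (σ : Vel N)

/-- The integrand `(v_*, σ) ↦ B(v - v_*, σ) f(v') g(v_*')` of the gain term at `v`. -/
def gainIntegrand {N : ℕ} (γ : ℝ) (b : ℝ → ℝ) (f g : Vel N → ℝ) (v : Vel N) :
    Vel N × USphere N → ℝ :=
  fun x => collisionKernel γ b (v - x.1) x.2 * f (velPrime v x.1 x.2) *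
    g (velStarPrime v x.1 x.2)

/-- The gain term `Q⁺(f,g)(v) = ∬ B(v - v_*, σ) f(v') g(v_*') dσ dv_*`. -/
def gain {N : ℕ} (γ : ℝ) (b : ℝ → ℝ) (f g : Vel N → ℝ) (v : Vel N) : ℝ :=
  ∫ x, gainIntegrand γ b f g v x ∂((volume : Measure (Vel N)).prod (sphereMeasure N))

/-- The integral defining `Q⁺(f,g)(v)` converges absolutely for almost every `v`. -/
def GainConverges {N : ℕ} (γ : ℝ) (b : ℝ → ℝ) (f g : Vel N → ℝ) : Prop :=
  ∀ᵐ v : Vel N, Integrable (gainIntegrand γ b f g v)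
    ((volume : Measure (Vel N)).prod (sphereMeasure N))

/-- `Q⁺(f, Q⁺(g,h))` is well defined almost everywhere (both gain integrals converge absolutely),
it belongs to `L^p_s`, and its norm there is at most `R`. -/
def IteratedGainEstimate {N : ℕ} (γ : ℝ) (b : ℝ → ℝ) (p : ℝ≥0∞) (s : ℝ)
    (f g h : Vel N → ℝ) (R : ℝ≥0∞) : Prop :=
  GainConverges γ b g h ∧ GainConverges γ b f (gain γ b g h) ∧
    MemW p s (gain γ b f (gain γ b g h)) ∧
    wNorm p s (gain γ b f (gain γ b g h)) ≤ R

/-- The angular functions allowed: nonnegative Borel functions, bounded above on `[-1,1]`.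
Only the values on `[-1,1]` matter (a Borel function on `[-1,1]` extends by `0`). -/
def IsBoundedAngular (b : ℝ → ℝ) : Prop :=
  Measurable b ∧ (∀ t ∈ Icc (-1 : ℝ) 1, 0 ≤ b t) ∧ BddAbove (b '' Icc (-1) 1)

/-- `N_γ = [(N-1)/γ]` if `0 < γ < N - 2`, and `N_γ = 1` if `γ ≥ N - 2`. -/
def numSteps (N : ℕ) (γ : ℝ) : ℕ :=
  if γ < (N : ℝ) - 2 then ⌊((N : ℝ) - 1) / γ⌋₊ else 1

/-- `p_n = (N-1)/(N-1-nγ) ∈ (1,∞]`, for `nγ ≤ N - 1`; the value is `∞` if `nγ = N - 1`. -/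
def stepExponent (N : ℕ) (γ : ℝ) (n : ℕ) : ℝ≥0∞ :=
  ENNReal.ofReal ((N : ℝ) - 1) / ENNReal.ofReal ((N : ℝ) - 1 - n * γ)

/-- `θ_n = (1/N) (1 - (N-2)/n)⁺`. -/
def stepTheta (N n : ℕ) : ℝ := 1 / (N : ℝ) * max (1 - ((N : ℝ) - 2) / n) 0

/-- `α₁ = ((N-1)/(γ N_γ)) ((N-1-γ)/N)`. -/
def alphaOne (N : ℕ) (γ : ℝ) : ℝ :=
  ((N : ℝ) - 1) / (γ * numSteps N γ) * (((N : ℝ) - 1 - γ) / N)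

/-- `α₂ = ((N-1)/(γ N_γ)) ((1-γ)⁺/N)`. -/
def alphaTwo (N : ℕ) (γ : ℝ) : ℝ :=
  ((N : ℝ) - 1) / (γ * numSteps N γ) * (max (1 - γ) 0 / N)

end

/-! Pair `Q⁺(f, Q⁺(g,h))` with a test function φ and use twice that collisions preserve measure.
What remains is a kernel in (w, w_*, v₁): φ averaged over two successive collision spheres. The pair
(w, w_*) produces u = c + rσ with c = (w+w_*)/2, r = |w-w_*|/2, and then (v₁, u) produces the
argument of φ.

The smoothing sits in this double average. Let e be the direction of u - v₁ and write the second
angle as ω = 2(e·n)n - e; the argument of φ becomes v₁ + (n·(u-v₁))n, at the price of the Jacobian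
(e·n)^(N-2) (`lintegral_sphere_le_doubleAngle`). For fixed n the coefficient is n·(c-v₁) + r n·σ,
and for N ≥ 3 the law of n·σ has bounded density (`exists_lintegral_sphere_inner_le`). Averaging
over σ thus costs 1/r and leaves a variable t in an interval of length 2r. Now (n, t) are polar
coordinates around v₁, so with R = |v₁-c| + r and any 0 ≤ a ≤ min(γ, N-2) the double average is at
most a constant times r⁻¹ R^(γ-a) ∫ |v-v₁|^(a-(N-1)) φ(v) dv over a slab
(`exists_lintegral_two_collisions_le`).

If γ < N-2, take a = γ, so that R disappears. The slab has mass O(r) for |v-v₁|^(-(N-1)). Hölder on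
the slab gives p₁; a three-factor Hölder inequality of Young type gains γ/(N-1) in 1/p at each step
(`exists_lintegral_mul_slabIntegral_le`); a Riesz potential bound gives L^∞ at the end. The leftover
power of |w-w_*| goes into weights when it is nonnegative, and is a Riesz potential of h when it is
negative; this is the origin of θ_n and α₂. If γ ≥ N-2, take a = N-2: the kernel is |v-v₁|⁻¹ and the
surplus R^(γ-N+2) goes into weights.

All of this is done for [0,∞]-valued functions, with b replaced by its supremum and s = 0. The
weight ⟨v⟩^s passes through because ⟨v⟩ ≤ ⟨v'⟩⟨v'_*⟩. Convergence of `Q⁺(g,h)` cannot be read off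
from f, which may vanish; it follows by running the same estimate with a strictly positive function
in place of f. -/

/-! ### Polar coordinates and a determinant -/

theorem lintegral_eq_lintegral_sphere {N : ℕ} (hN : 0 < N) {F : Vel N → ℝ≥0∞} (hF : Measurable F) :
    ∫⁻ x, F x = ∫⁻ σ : USphere N, (∫⁻ ρ in Ioi (0 : ℝ),
      ENNReal.ofReal (ρ ^ (N - 1)) * F (ρ • (σ : Vel N))) ∂(sphereMeasure N) := by
  have : Nonempty (Fin N) := ⟨⟨0, hN⟩⟩
  have hmp := (volume : Measure (Vel N)).measurePreserving_homeomorphUnitSphereProd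
  have h1 : ∫⁻ x, F x = ∫⁻ x : ({(0 : Vel N)}ᶜ : Set (Vel N)), F x
      ∂((volume : Measure (Vel N)).comap (↑)) := by
    rw [lintegral_subtype_comap (measurableSet_singleton _).compl, restrict_compl_singleton]
  have hg : Measurable (fun p : USphere N × Ioi (0 : ℝ) => F ((p.2 : ℝ) • (p.1 : Vel N))) := by
    fun_prop
  have h2 := hmp.lintegral_comp hg
  have h3 : ∀ x : ({(0 : Vel N)}ᶜ : Set (Vel N)),
      F (((homeomorphUnitSphereProd (Vel N) x).2 : ℝ) •
        ((homeomorphUnitSphereProd (Vel N) x).1 : Vel N)) = F x := by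
    intro x
    congr 1
    exact congrArg Subtype.val ((homeomorphUnitSphereProd (Vel N)).symm_apply_apply x)
  simp only [h3] at h2
  rw [h1, h2, lintegral_prod _ hg.aemeasurable]
  refine lintegral_congr fun σ => ?_
  simp only [finrank_euclideanSpace, Fintype.card_fin]
  rw [Measure.volumeIoiPow, lintegral_withDensity_eq_lintegral_mul _ (by fun_prop) (by fun_prop)]
  exact lintegral_subtype_comap measurableSet_Ioi
    (fun ρ : ℝ => ENNReal.ofReal (ρ ^ (N - 1)) * F (ρ • (σ : Vel N)))

/-- By Sylvester's identity det(1 + AB) = det(1 + BA), a rank-two perturbation needs only a 2 × 2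
determinant. -/
theorem det_smul_id_add_rank_two {N : ℕ} (a : ℝ) (ha : a ≠ 0) (u v u' v' : Vel N) :
    LinearMap.det (a • (LinearMap.id : Vel N →ₗ[ℝ] Vel N) +
      ((innerₛₗ ℝ u).smulRight u' + (innerₛₗ ℝ v).smulRight v')) =
    a ^ N * ((1 + a⁻¹ * inner ℝ u u') * (1 + a⁻¹ * inner ℝ v v') -
      a⁻¹ ^ 2 * (inner ℝ u v' * inner ℝ v u')) := by
  let b := (EuclideanSpace.basisFun (Fin N) ℝ).toBasis
  let A : Matrix (Fin N) (Fin 2) ℝ := Matrix.of fun i j => ![u' i, v' i] j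
  let B : Matrix (Fin 2) (Fin N) ℝ := Matrix.of fun j i => ![u i, v i] j
  rw [← LinearMap.det_toMatrix b]
  have hM : LinearMap.toMatrix b b (a • (LinearMap.id : Vel N →ₗ[ℝ] Vel N) +
      ((innerₛₗ ℝ u).smulRight u' + (innerₛₗ ℝ v).smulRight v')) =
      a • (1 + (a⁻¹ • A) * B) := by
    ext i j
    simp [LinearMap.toMatrix_apply, b, A, B, Matrix.mul_apply, Fin.sum_univ_two, Matrix.one_apply,
      EuclideanSpace.inner_single_right]
    field_simp
    simp
  rw [hM, Matrix.det_smul, Matrix.det_one_add_mul_comm, Matrix.det_fin_two]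
  have hi : ∀ p q : Vel N, inner ℝ p q = ∑ i, p i * q i := fun p q => by
    simp [PiLp.inner_apply, mul_comm]
  have hs : ∀ p q : Vel N, ∑ i, p i * (a⁻¹ * q i) = a⁻¹ * inner ℝ p q := fun p q => by
    rw [hi, Finset.mul_sum]; exact Finset.sum_congr rfl fun i _ => by ring
  simp [A, B, Matrix.mul_apply, hs]
  left
  ring

theorem lintegral_Ioi_pow_indicator (k : ℕ) {r : ℝ} (hr : 0 ≤ r) (c : ℝ≥0∞) :
    ∫⁻ ρ in Ioi (0 : ℝ), ENNReal.ofReal (ρ ^ k) * (Iio r).indicator (fun _ => c) ρ =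
      ENNReal.ofReal (r ^ (k + 1) / (k + 1)) * c := by
  have h1 : ∀ ρ : ℝ, ENNReal.ofReal (ρ ^ k) * (Iio r).indicator (fun _ => c) ρ =
      (Iio r).indicator (fun ρ => ENNReal.ofReal (ρ ^ k) * c) ρ := fun ρ => by
    by_cases h : ρ ∈ Iio r <;> simp [h]
  simp_rw [h1]
  rw [setLIntegral_indicator measurableSet_Iio, Iio_inter_Ioi,
    lintegral_mul_const _ (by fun_prop), Measure.restrict_congr_set Ioo_ae_eq_Ioc,
    ← ofReal_integral_eq_lintegral_ofReal (intervalIntegral.intervalIntegrable_pow _).1,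
    ← intervalIntegral.integral_of_le hr]
  · simp
  · filter_upwards [ae_restrict_mem measurableSet_Ioc] with y hy
    exact pow_nonneg hy.1.le _

/-! ### Angle doubling as a change of variables on the sphere -/

/-- The quadratic map `x ↦ 2 ⟨e, x⟩ x - |x|² e`, which doubles the angle to the unit vector `e`. -/
noncomputable def doubleAngle {N : ℕ} (e x : Vel N) : Vel N :=
  (2 * inner ℝ e x) • x - (‖x‖ ^ 2) • e

theorem hasFDerivAt_doubleAngle {N : ℕ} (e x : Vel N) :
    HasFDerivAt (doubleAngle e)
      ((2 * inner ℝ e x) • ContinuousLinearMap.id ℝ (Vel N) +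
        ((innerSL ℝ e).smulRight ((2 : ℝ) • x) + (innerSL ℝ x).smulRight ((-2 : ℝ) • e))) x := by
  have h1 : HasFDerivAt (fun y : Vel N => 2 * inner ℝ e y) ((2 : ℝ) • innerSL ℝ e) x :=
    ((innerSL ℝ e).hasFDerivAt (x := x)).const_mul 2
  have h2 := (hasStrictFDerivAt_norm_sq x).hasFDerivAt
  have h3 := (h1.smul (hasFDerivAt_id x)).sub (h2.smul_const e)
  refine h3.congr_fderiv ?_
  ext1 y
  simp [smul_smul]
  module

theorem det_fderiv_doubleAngle {N : ℕ} (hN : 2 ≤ N) {e x : Vel N} (he : ‖e‖ = 1)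
    (hx : inner ℝ e x ≠ 0) :
    ((2 * inner ℝ e x) • ContinuousLinearMap.id ℝ (Vel N) +
      ((innerSL ℝ e).smulRight ((2 : ℝ) • x) + (innerSL ℝ x).smulRight ((-2 : ℝ) • e))).det =
      2 ^ N * ‖x‖ ^ 2 * inner ℝ e x ^ (N - 2) := by
  have ha : (2 * inner ℝ e x : ℝ) ≠ 0 := mul_ne_zero two_ne_zero hx
  have h := det_smul_id_add_rank_two (2 * inner ℝ e x) ha e x ((2 : ℝ) • x) ((-2 : ℝ) • e)
  refine Eq.trans ?_ (h.trans ?_)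
  · rfl
  · obtain ⟨k, rfl⟩ := Nat.exists_eq_add_of_le hN
    simp only [inner_smul_right, real_inner_self_eq_norm_sq, he, real_inner_comm e x,
      Nat.add_sub_cancel_left]
    field_simp
    ring

theorem norm_doubleAngle {N : ℕ} {e : Vel N} (he : ‖e‖ = 1) (x : Vel N) :
    ‖doubleAngle e x‖ = ‖x‖ ^ 2 := by
  have h : ‖doubleAngle e x‖ ^ 2 = (‖x‖ ^ 2) ^ 2 := by
    rw [doubleAngle, norm_sub_sq_real, norm_smul, norm_smul, inner_smul_left, inner_smul_right,
      he, mul_pow, real_inner_comm e x]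
    simp only [Real.norm_eq_abs, abs_of_nonneg (sq_nonneg ‖x‖), mul_pow, sq_abs, conj_trivial]
    ring
  exact (pow_left_inj₀ (norm_nonneg _) (sq_nonneg _) two_ne_zero).1 h

theorem inner_doubleAngle {N : ℕ} {e : Vel N} (he : ‖e‖ = 1) (x : Vel N) :
    inner ℝ e (doubleAngle e x) = 2 * inner ℝ e x ^ 2 - ‖x‖ ^ 2 := by
  rw [doubleAngle, inner_sub_right, inner_smul_right, inner_smul_right,
    real_inner_self_eq_norm_sq, he]
  ring

/-- The norm of the image gives ‖x‖ and its e-component then gives ⟨e, x⟩², hence ⟨e, x⟩ on the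
half-space; x is then recovered by a nonzero scalar. -/
theorem injOn_doubleAngle {N : ℕ} {e : Vel N} (he : ‖e‖ = 1) :
    InjOn (doubleAngle e) {x | 0 < inner ℝ e x} := by
  intro x hx y hy hxy
  have h1 : ‖x‖ ^ 2 = ‖y‖ ^ 2 := by rw [← norm_doubleAngle he, hxy, norm_doubleAngle he]
  have h2 : inner ℝ e x = inner ℝ e y := by
    have h := congrArg (inner ℝ e) hxy
    rw [inner_doubleAngle he, inner_doubleAngle he, h1] at h
    exact (pow_left_inj₀ (le_of_lt hx) (le_of_lt hy) two_ne_zero).1 (by linarith)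
  have h3 : (2 * inner ℝ e y) • x = (2 * inner ℝ e y) • y := by
    have h := hxy
    rw [doubleAngle, doubleAngle, h1, h2] at h
    exact sub_left_injective h
  exact smul_right_injective _ (mul_pos two_pos hy).ne' h3

theorem mem_image_doubleAngle {N : ℕ} {e y : Vel N} (he : ‖e‖ = 1)
    (hy : y ∉ Submodule.span ℝ {e}) : y ∈ doubleAngle e '' {x | 0 < inner ℝ e x} := by
  have hlt : 0 < ‖y‖ + inner ℝ e y := by
    have h1 : |inner ℝ e y| < ‖y‖ := by
      have h := abs_real_inner_le_norm e y
      rw [he, one_mul] at h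
      refine lt_of_le_of_ne h fun h' => hy ?_
      have h4 : ‖(inner ℝ e y) • e - y‖ ^ 2 = 0 := by
        rw [norm_sub_sq_real, norm_smul, inner_smul_left, he]
        simp only [Real.norm_eq_abs, conj_trivial, mul_one]
        rw [h', ← h', sq_abs]; ring
      have h5 := sub_eq_zero.1 (norm_eq_zero.1 (pow_eq_zero_iff two_ne_zero |>.1 h4))
      exact h5 ▸ Submodule.smul_mem _ _ (Submodule.mem_span_singleton_self e)
    linarith [neg_abs_le (inner ℝ e y : ℝ)]
  -- The preimage lies on the bisector y + ‖y‖e, whose squared norm is ‖y‖ d; dividing by √d makes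
  -- the squared norm equal to ‖y‖, as it must be.
  set d : ℝ := 2 * (‖y‖ + inner ℝ e y)
  have hd : 0 < d := by positivity
  have hsq : √d ^ 2 = d := Real.sq_sqrt hd.le
  have hs : 0 < √d := Real.sqrt_pos.2 hd
  have hi : inner ℝ e ((√d)⁻¹ • (y + ‖y‖ • e)) = √d / 2 := by
    rw [inner_smul_right, inner_add_right, inner_smul_right, real_inner_self_eq_norm_sq, he]
    field_simp
    rw [hsq]; ring
  have hn : ‖(√d)⁻¹ • (y + ‖y‖ • e)‖ ^ 2 = ‖y‖ := by
    rw [norm_smul, mul_pow, norm_add_sq_real, norm_smul, inner_smul_right, he, norm_inv,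
      Real.norm_of_nonneg hs.le, norm_norm, inv_pow, hsq, real_inner_comm e y]
    field_simp
    ring
  refine ⟨(√d)⁻¹ • (y + ‖y‖ • e), ?_, ?_⟩
  · show 0 < inner ℝ e _
    rw [hi]; positivity
  · rw [doubleAngle, hi, hn, smul_smul]
    have : 2 * (√d / 2) * (√d)⁻¹ = 1 := by field_simp
    rw [this]
    simp

/-- The spherical Jacobian is obtained from the one on ℝ^N: extend G radially, cut off to the unit
ball, change variables there, and integrate out the radius on both sides. -/
theorem lintegral_sphere_le_doubleAngle {N : ℕ} (hN : 3 ≤ N) {e : Vel N} (he : ‖e‖ = 1)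
    {G : Vel N → ℝ≥0∞} (hG : Measurable G) :
    ∫⁻ σ : USphere N, G σ ∂(sphereMeasure N) ≤
      2 ^ N * ∫⁻ n : USphere N, ENNReal.ofReal (max (inner ℝ e (n : Vel N)) 0 ^ (N - 2)) *
        G (doubleAngle e n) ∂(sphereMeasure N) := by
  have hN0 : 0 < N := by omega
  have hNr : (0 : ℝ) < N := by exact_mod_cast hN0
  -- Since `doubleAngle` squares norms, it respects the unit ball, so the cutoff survives the
  -- substitution.
  let F : Vel N → ℝ≥0∞ := fun x => (Iio (1 : ℝ)).indicator (fun _ => G (‖x‖⁻¹ • x)) ‖x‖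
  let H : Set (Vel N) := {x | 0 < inner ℝ e x}
  have hF : Measurable F := by
    have : F = {x : Vel N | ‖x‖ < 1}.indicator (fun x => G (‖x‖⁻¹ • x)) := by
      ext x; simp only [F, indicator, mem_Iio, mem_ofPred_eq]
    rw [this]
    exact Measurable.indicator (by fun_prop) (measurableSet_lt (by fun_prop) (by fun_prop))
  have hH : MeasurableSet H := measurableSet_lt (by fun_prop) (by fun_prop)
  have hS : ∀ σ : USphere N, ‖(σ : Vel N)‖ = 1 := fun σ => by simp
  have hleft : ∫⁻ x, F x =
      ENNReal.ofReal (1 / N) * ∫⁻ σ : USphere N, G σ ∂(sphereMeasure N) := by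
    rw [lintegral_eq_lintegral_sphere hN0 hF,
      ← lintegral_const_mul _ (by fun_prop)]
    refine lintegral_congr fun σ => ?_
    have := lintegral_Ioi_pow_indicator (N - 1) zero_le_one (G σ)
    rw [one_pow, Nat.cast_sub (by omega), Nat.cast_one, sub_add_cancel] at this
    rw [← this]
    refine setLIntegral_congr_fun measurableSet_Ioi fun ρ hρ => ?_
    have hρ : (0 : ℝ) < ρ := hρ
    simp [F, norm_smul, hS, abs_of_pos hρ, smul_smul, hρ.ne']
  have hcv : ∫⁻ x in doubleAngle e '' H, F x =
      ∫⁻ x in H, ENNReal.ofReal (2 ^ N * ‖x‖ ^ 2 * inner ℝ e x ^ (N - 2)) *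
        F (doubleAngle e x) := by
    rw [lintegral_image_eq_lintegral_abs_det_fderiv_mul volume hH
      (fun x _ => (hasFDerivAt_doubleAngle e x).hasFDerivWithinAt) (injOn_doubleAngle he)]
    refine setLIntegral_congr_fun hH fun x hx => ?_
    have hx : 0 < inner ℝ e x := hx
    simp only
    rw [det_fderiv_doubleAngle (by omega) he hx.ne', abs_of_nonneg (by positivity)]
  have hcover : ∫⁻ x, F x = ∫⁻ x in doubleAngle e '' H, F x := by
    have hnull : volume ((doubleAngle e '' H)ᶜ) = 0 := by
      refine measure_mono_null (fun y hy => not_not.1 fun h => hy (mem_image_doubleAngle he h))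
        (Measure.addHaar_submodule volume (Submodule.span ℝ {e}) ?_)
      intro h
      have h1 := finrank_span_singleton (K := ℝ) (v := e) (by rintro rfl; simp at he)
      rw [h, finrank_top, finrank_euclideanSpace, Fintype.card_fin] at h1
      omega
    rw [← setLIntegral_univ]
    exact setLIntegral_congr (ae_eq_univ.2 hnull).symm
  have hdA : Measurable (doubleAngle e) := by unfold doubleAngle; fun_prop
  have hright : ∫⁻ x in H, ENNReal.ofReal (2 ^ N * ‖x‖ ^ 2 * inner ℝ e x ^ (N - 2)) *
      F (doubleAngle e x) = ENNReal.ofReal (1 / (2 * N)) * (2 ^ N * ∫⁻ n : USphere N,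
        ENNReal.ofReal (max (inner ℝ e (n : Vel N)) 0 ^ (N - 2)) *
        G (doubleAngle e n) ∂(sphereMeasure N)) := by
    rw [← lintegral_indicator hH, lintegral_eq_lintegral_sphere hN0
      (Measurable.indicator (by fun_prop) hH), ← lintegral_const_mul _ (by fun_prop),
      ← lintegral_const_mul _ (by fun_prop)]
    refine lintegral_congr fun σ => ?_
    rcases le_or_gt (inner ℝ e (σ : Vel N)) 0 with h0 | h0
    · rw [max_eq_right h0, zero_pow (by omega)]
      simp only [ENNReal.ofReal_zero, zero_mul, mul_zero]
      refine (setLIntegral_congr_fun measurableSet_Ioi fun ρ hρ => ?_).trans lintegral_zero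
      have hρ : (0 : ℝ) < ρ := hρ
      rw [indicator_of_notMem, mul_zero]
      simp only [H, mem_ofPred_eq, inner_smul_right, not_lt]
      exact mul_nonpos_of_nonneg_of_nonpos hρ.le h0
    · have := lintegral_Ioi_pow_indicator (2 * N - 1) zero_le_one
        (ENNReal.ofReal (2 ^ N * inner ℝ e (σ : Vel N) ^ (N - 2)) * G (doubleAngle e σ))
      rw [one_pow, Nat.cast_sub (by omega), Nat.cast_one, sub_add_cancel] at this
      rw [max_eq_left h0.le, ← mul_assoc (2 ^ N)]
      have h2 : (2 : ℝ≥0∞) ^ N = ENNReal.ofReal (2 ^ N) := by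
        rw [ENNReal.ofReal_pow (by norm_num)]; simp
      rw [h2, ← ENNReal.ofReal_mul (by positivity)]
      push_cast at this
      rw [← this]
      refine setLIntegral_congr_fun measurableSet_Ioi fun ρ hρ => ?_
      have hρ : (0 : ℝ) < ρ := hρ
      rw [indicator_of_mem (show ρ • (σ : Vel N) ∈ H by
        simp only [H, mem_ofPred_eq, inner_smul_right]; positivity)]
      have hd : doubleAngle e (ρ • (σ : Vel N)) = ρ ^ 2 • doubleAngle e σ := by
        simp only [doubleAngle, inner_smul_right, norm_smul, smul_sub, smul_smul, mul_pow,
          Real.norm_eq_abs, sq_abs]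
        congr 2
        ring
      have hGd : G (‖doubleAngle e (ρ • (σ : Vel N))‖⁻¹ • doubleAngle e (ρ • (σ : Vel N))) =
          G (doubleAngle e σ) := by
        rw [norm_doubleAngle he, hd, norm_smul, hS, smul_smul, mul_one, Real.norm_of_nonneg hρ.le,
          inv_mul_cancel₀ (by positivity), one_smul]
      have hlt : (‖doubleAngle e (ρ • (σ : Vel N))‖ < 1) ↔ ρ < 1 := by
        rw [norm_doubleAngle he, norm_smul, hS, mul_one, Real.norm_of_nonneg hρ.le,
          sq_lt_one_iff₀ hρ.le]
      by_cases h1 : ρ < 1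
      · simp only [F]
        rw [indicator_of_mem (mem_Iio.2 (hlt.2 h1)), indicator_of_mem (mem_Iio.2 h1), hGd, ← mul_assoc,
          ← mul_assoc, ← ENNReal.ofReal_mul (by positivity), ← ENNReal.ofReal_mul (by positivity)]
        congr 2
        rw [norm_smul, hS, inner_smul_right, Real.norm_of_nonneg hρ.le]
        obtain ⟨k, rfl⟩ := Nat.exists_eq_add_of_le (show 2 ≤ N by omega)
        rw [show 2 + k - 2 = k by omega, show 2 + k - 1 = k + 1 by omega,
          show 2 * (2 + k) - 1 = 2 * k + 3 by omega]
        ring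
      · simp only [F]
        rw [indicator_of_notMem (fun h => h1 (hlt.1 (mem_Iio.1 h))), indicator_of_notMem (by simpa using h1)]
        simp
  have key := hleft.symm.trans (hcover.trans (hcv.trans hright))
  -- The radial integrals are 1/N on the left and 1/(2N) on the right, so the exact factor is
  -- 2^(N-1); it is rounded up to 2^N.
  have hle : ENNReal.ofReal (1 / N) * ∫⁻ σ : USphere N, G σ ∂(sphereMeasure N) ≤
      ENNReal.ofReal (1 / N) * (2 ^ N * ∫⁻ n : USphere N,
        ENNReal.ofReal (max (inner ℝ e (n : Vel N)) 0 ^ (N - 2)) *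
        G (doubleAngle e n) ∂(sphereMeasure N)) := by
    rw [key]
    gcongr
    linarith
  exact (ENNReal.mul_le_mul_iff_right (by simpa using hN0.ne') ENNReal.ofReal_ne_top).1 hle

/-! ### The law of one coordinate on the sphere -/

theorem exists_lintegral_eq_lintegral_line {m : ℕ} {n : Vel (m + 1)} (hn : ‖n‖ = 1) :
    ∃ ι : Vel m →ₗᵢ[ℝ] Vel (m + 1), (∀ y, inner ℝ n (ι y) = 0) ∧
      ∀ F : Vel (m + 1) → ℝ≥0∞, Measurable F →
        ∫⁻ x, F x = ∫⁻ y : Vel m, ∫⁻ t : ℝ, F (t • n + ι y) := by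
  have hn0 : n ≠ 0 := by rintro rfl; simp at hn
  have : Fact (Module.finrank ℝ (Vel (m + 1)) = m + 1) := ⟨by simp⟩
  let K : Submodule ℝ (Vel (m + 1)) := Submodule.span ℝ {n}
  let e1 : ℝ ≃ₗᵢ[ℝ] K := LinearIsometryEquiv.toSpanUnitSingleton n hn
  let e2 : Vel m ≃ₗᵢ[ℝ] Kᗮ := (OrthonormalBasis.fromOrthogonalSpanSingleton m hn0).repr.symm
  let φ : WithLp 2 (ℝ × Vel m) ≃ₗᵢ[ℝ] Vel (m + 1) :=
    (LinearIsometryEquiv.withLpProdCongr 2 e1 e2).trans K.orthogonalDecomposition.symm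
  have hφ : ∀ (t : ℝ) (y : Vel m), φ (WithLp.toLp 2 (t, y)) = t • n + (e2 y : Vel (m + 1)) := by
    intro t y
    simp only [φ, e1, LinearIsometryEquiv.trans_apply, LinearIsometryEquiv.withLpProdCongr_apply,
      Submodule.orthogonalDecomposition_symm_apply]
    rfl
  refine ⟨Kᗮ.subtypeₗᵢ.comp e2.toLinearIsometry, fun y => ?_, fun F hF => ?_⟩
  · exact Submodule.inner_right_of_mem_orthogonal (Submodule.mem_span_singleton_self n) (e2 y).2
  · have h := (φ.measurePreserving.comp (WithLp.volume_preserving_toLp ℝ (Vel m))).lintegral_comp hF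
    rw [← h]
    have hm : Measurable fun p : ℝ × Vel m => F (φ (WithLp.toLp 2 p)) :=
      hF.comp (φ.continuous.measurable.comp (WithLp.volume_preserving_toLp ℝ (Vel m)).measurable)
    rw [Measure.volume_eq_prod]
    refine (lintegral_prod_symm _ hm.aemeasurable).trans ?_
    simp only [hφ]
    rfl

/-- Substitution x = t/√(t²+ρ²), an increasing map into [-1, 1] whose derivative is the density on
the left. -/
theorem lintegral_cos_le {ρ : ℝ} (hρ : 0 < ρ) (ψ : ℝ → ℝ≥0∞) :
    ∫⁻ t : ℝ, ENNReal.ofReal (ρ ^ 2 / √(t ^ 2 + ρ ^ 2) ^ 3) * ψ (t / √(t ^ 2 + ρ ^ 2)) ≤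
      ∫⁻ x in Icc (-1 : ℝ) 1, ψ x := by
  have hpos : ∀ t : ℝ, 0 < t ^ 2 + ρ ^ 2 := fun t => by positivity
  have hd : ∀ t : ℝ, HasDerivAt (fun t => t / √(t ^ 2 + ρ ^ 2)) (ρ ^ 2 / √(t ^ 2 + ρ ^ 2) ^ 3) t := by
    intro t
    have h1 : HasDerivAt (fun t : ℝ => t ^ 2 + ρ ^ 2) (2 * t) t := by
      simpa using (hasDerivAt_pow 2 t).add_const (ρ ^ 2)
    have h3 := (hasDerivAt_id t).div (h1.sqrt (hpos t).ne') (Real.sqrt_pos.2 (hpos t)).ne'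
    refine h3.congr_deriv ?_
    have hs := Real.sqrt_pos.2 (hpos t)
    have hsq := Real.sq_sqrt (hpos t).le
    simp only [id]
    field_simp
    rw [hsq]; ring
  have hmono : StrictMono fun t : ℝ => t / √(t ^ 2 + ρ ^ 2) :=
    strictMono_of_deriv_pos fun t => by
      rw [(hd t).deriv]
      have := Real.sqrt_pos.2 (hpos t)
      positivity
  have h := lintegral_image_eq_lintegral_abs_deriv_mul MeasurableSet.univ
    (fun t _ => (hd t).hasDerivWithinAt) hmono.injective.injOn ψ
  rw [setLIntegral_univ] at h
  have habs : ∀ t : ℝ, |ρ ^ 2 / √(t ^ 2 + ρ ^ 2) ^ 3| = ρ ^ 2 / √(t ^ 2 + ρ ^ 2) ^ 3 :=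
    fun t => abs_of_nonneg (by positivity)
  simp only [habs] at h
  rw [← h]
  refine lintegral_mono_set ?_
  rintro _ ⟨t, -, rfl⟩
  have hs := Real.sqrt_pos.2 (hpos t)
  have h1 : |t| ≤ √(t ^ 2 + ρ ^ 2) := Real.abs_le_sqrt (by nlinarith)
  have h2 := abs_le.1 h1
  exact ⟨by rw [le_div_iff₀ hs]; linarith, by rw [div_le_one hs]; exact h2.2⟩

/-- The coordinate n·σ has density proportional to (1-x²)^((N-3)/2), which is bounded exactly
because N ≥ 3. The bound is proved by computing one integral over a cylinder around the axis n in
two ways: in polar coordinates and along lines parallel to n. -/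
theorem exists_lintegral_sphere_inner_le {N : ℕ} (hN : 3 ≤ N) :
    ∃ C : ℝ≥0, ∀ n : Vel N, ‖n‖ = 1 → ∀ ψ : ℝ → ℝ≥0∞, Measurable ψ →
      ∫⁻ σ : USphere N, ψ (inner ℝ n (σ : Vel N)) ∂(sphereMeasure N) ≤
        C * ∫⁻ x in Icc (-1 : ℝ) 1, ψ x := by
  obtain ⟨m, rfl⟩ : ∃ m, N = m + 1 := ⟨N - 1, by omega⟩
  have hm : 2 ≤ m := by omega
  have hmr : (0 : ℝ) < m := by exact_mod_cast (by omega : 0 < m)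
  refine ⟨m * (volume (Metric.ball (0 : Vel m) 1)).toNNReal, fun n hn ψ hψ => ?_⟩
  let d : Vel (m + 1) → ℝ := fun x => √(‖x‖ ^ 2 - inner ℝ n x ^ 2)
  -- Here d is the distance to the axis. The weight has degree -1, and along the ray through σ the
  -- cutoff d < 1 stops at ρ = 1/d(σ), so every ray off the axis contributes the same radial factor
  -- 1/m.
  let F : Vel (m + 1) → ℝ≥0∞ := fun x =>
    (Iio (1 : ℝ)).indicator (fun _ => ENNReal.ofReal (d x ^ m / ‖x‖ ^ (m + 1)) *
      ψ (inner ℝ n x / ‖x‖)) (d x)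
  have hdm : Measurable d := by fun_prop
  have hF : Measurable F := by
    have : F = {x | d x < 1}.indicator (fun x => ENNReal.ofReal (d x ^ m / ‖x‖ ^ (m + 1)) *
      ψ (inner ℝ n x / ‖x‖)) := by
      ext x; simp only [F, indicator, mem_Iio, mem_ofPred_eq]
    rw [this]
    exact Measurable.indicator (by fun_prop) (measurableSet_lt (by fun_prop) (by fun_prop))
  have hS : ∀ σ : USphere (m + 1), ‖(σ : Vel (m + 1))‖ = 1 := fun σ => by simp
  have hd0 : ∀ᵐ σ : USphere (m + 1) ∂(sphereMeasure (m + 1)), d (σ : Vel (m + 1)) ≠ 0 := by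
    have hms : MeasurableSet {σ : USphere (m + 1) | d σ = 0} :=
      measurableSet_eq_fun (by fun_prop) (by fun_prop)
    rw [ae_iff]
    simp only [not_not]
    rw [sphereMeasure, Measure.toSphere_apply' _ hms]
    refine mul_eq_zero_of_right _ (measure_mono_null ?_
      (Measure.addHaar_submodule volume (Submodule.span ℝ {n}) ?_))
    · rintro _ ⟨r, -, _, ⟨σ, hσ, rfl⟩, rfl⟩
      refine Submodule.smul_mem _ _ ?_
      have h1 : ‖(σ : Vel (m + 1))‖ ^ 2 - inner ℝ n (σ : Vel (m + 1)) ^ 2 ≤ 0 :=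
        Real.sqrt_eq_zero'.1 hσ
      have h2 : ‖(inner ℝ n (σ : Vel (m + 1)) : ℝ) • n - σ‖ ^ 2 ≤ 0 := by
        rw [norm_sub_sq_real, norm_smul, inner_smul_left, hn]
        simp only [Real.norm_eq_abs, conj_trivial, mul_one, sq_abs]
        linarith
      have h3 : (inner ℝ n (σ : Vel (m + 1)) : ℝ) • n - σ = 0 := by
        rw [← norm_eq_zero, ← sq_eq_zero_iff]
        exact le_antisymm h2 (sq_nonneg _)
      exact (sub_eq_zero.1 h3) ▸ Submodule.smul_mem _ _ (Submodule.mem_span_singleton_self n)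
    · intro h
      have h1 := finrank_span_singleton (K := ℝ) (v := n) (by rintro rfl; simp at hn)
      rw [h, finrank_top, finrank_euclideanSpace, Fintype.card_fin] at h1
      omega
  have hleft : ∫⁻ x, F x = ENNReal.ofReal (1 / m) *
      ∫⁻ σ : USphere (m + 1), ψ (inner ℝ n (σ : Vel (m + 1))) ∂(sphereMeasure (m + 1)) := by
    rw [lintegral_eq_lintegral_sphere (by omega) hF, ← lintegral_const_mul _ (by fun_prop)]
    refine lintegral_congr_ae (hd0.mono fun σ hσ => ?_)
    have hdσ : 0 < d σ := lt_of_le_of_ne (Real.sqrt_nonneg _) (Ne.symm hσ)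
    have h := lintegral_Ioi_pow_indicator (m - 1) (inv_nonneg.2 hdσ.le)
      (ENNReal.ofReal (d σ ^ m) * ψ (inner ℝ n (σ : Vel (m + 1))))
    have hc : ((d σ)⁻¹ ^ (m - 1 + 1) / ((m - 1 : ℕ) + 1)) * (d σ ^ m) = 1 / (m : ℝ) := by
      rw [Nat.cast_sub (by omega), Nat.cast_one, sub_add_cancel, Nat.sub_add_cancel (by omega)]
      field_simp
      rw [← mul_pow, one_div_mul_cancel hdσ.ne', one_pow]
    rw [← mul_assoc, ← ENNReal.ofReal_mul (by positivity), hc] at h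
    simp only
    rw [← h]
    refine setLIntegral_congr_fun measurableSet_Ioi fun ρ hρ => ?_
    have hρ : (0 : ℝ) < ρ := hρ
    have hdρ : d (ρ • (σ : Vel (m + 1))) = ρ * d σ := by
      simp only [d, norm_smul, inner_smul_right, mul_pow, Real.norm_eq_abs, sq_abs]
      rw [← mul_sub, Real.sqrt_mul (sq_nonneg _), Real.sqrt_sq hρ.le]
    have hlt : d (ρ • (σ : Vel (m + 1))) < 1 ↔ ρ < (d σ)⁻¹ := by
      rw [hdρ, lt_inv_comm₀ hρ hdσ, inv_eq_one_div, lt_div_iff₀ hρ, mul_comm]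
    by_cases h1 : ρ < (d σ)⁻¹
    · simp only [F]
      rw [indicator_of_mem (mem_Iio.2 (hlt.2 h1)), indicator_of_mem (mem_Iio.2 h1), hdρ,
        norm_smul, hS, inner_smul_right, Real.norm_of_nonneg hρ.le, mul_one,
        mul_div_cancel_left₀ _ hρ.ne', ← mul_assoc, ← mul_assoc,
        ← ENNReal.ofReal_mul (by positivity), ← ENNReal.ofReal_mul (by positivity)]
      congr 2
      obtain ⟨k, rfl⟩ := Nat.exists_eq_add_of_le hm
      rw [show 2 + k - 1 = k + 1 by omega, Nat.add_sub_cancel, div_eq_mul_inv]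
      field_simp
      ring
    · simp only [F]
      rw [indicator_of_notMem (fun h => h1 (hlt.1 (mem_Iio.1 h))),
        indicator_of_notMem (fun h => h1 (mem_Iio.1 h))]
      simp
  obtain ⟨ι, hι, hsplit⟩ := exists_lintegral_eq_lintegral_line hn
  have hright : ∫⁻ x, F x ≤
      volume (Metric.ball (0 : Vel m) 1) * ∫⁻ x in Icc (-1 : ℝ) 1, ψ x := by
    rw [hsplit F hF, mul_comm, ← setLIntegral_const, ← lintegral_indicator measurableSet_ball]
    refine lintegral_mono fun y => ?_
    have hnorm : ∀ t : ℝ, ‖t • n + ι y‖ = √(t ^ 2 + ‖y‖ ^ 2) := fun t => by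
      rw [eq_comm, Real.sqrt_eq_iff_eq_sq (by positivity) (norm_nonneg _), norm_add_sq_real,
        inner_smul_left, hι, norm_smul, hn, LinearIsometry.norm_map]
      simp
    have hin : ∀ t : ℝ, inner ℝ n (t • n + ι y) = t := fun t => by
      rw [inner_add_right, hι, inner_smul_right, real_inner_self_eq_norm_sq, hn]; simp
    have hdy : ∀ t : ℝ, d (t • n + ι y) = ‖y‖ := fun t => by
      simp only [d]
      rw [hnorm, hin, Real.sq_sqrt (by positivity), add_sub_cancel_left,
        Real.sqrt_sq (norm_nonneg _)]
    simp only [F, hnorm, hin, hdy]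
    by_cases hy : ‖y‖ < 1
    · rw [indicator_of_mem (by simpa using hy)]
      simp only [indicator_of_mem (mem_Iio.2 hy)]
      rcases eq_or_ne y 0 with rfl | hy0
      · simp [show m ≠ 0 by omega]
      · have hyp : 0 < ‖y‖ := norm_pos_iff.2 hy0
        refine le_trans (lintegral_mono fun t => ?_) (lintegral_cos_le hyp ψ)
        refine mul_le_mul_left (ENNReal.ofReal_le_ofReal ?_) _
        -- Here m ≥ 2, that is N ≥ 3, is decisive: the excess factor (‖y‖/√(t²+‖y‖²))^(m-2) is at
        -- most 1.
        obtain ⟨k, rfl⟩ := Nat.exists_eq_add_of_le hm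
        have hs : ‖y‖ ≤ √(t ^ 2 + ‖y‖ ^ 2) := Real.le_sqrt_of_sq_le (by nlinarith)
        have hs0 : 0 < √(t ^ 2 + ‖y‖ ^ 2) := hyp.trans_le hs
        rw [div_le_div_iff₀ (by positivity) (by positivity)]
        calc ‖y‖ ^ (2 + k) * √(t ^ 2 + ‖y‖ ^ 2) ^ 3
            = ‖y‖ ^ 2 * √(t ^ 2 + ‖y‖ ^ 2) ^ 3 * ‖y‖ ^ k := by ring
          _ ≤ ‖y‖ ^ 2 * √(t ^ 2 + ‖y‖ ^ 2) ^ 3 * √(t ^ 2 + ‖y‖ ^ 2) ^ k := by gcongr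
          _ = ‖y‖ ^ 2 * √(t ^ 2 + ‖y‖ ^ 2) ^ (2 + k + 1) := by ring
    · simp only [indicator_of_notMem (show ‖y‖ ∉ Iio (1 : ℝ) from hy), lintegral_zero]
      exact zero_le
  have key := hleft.symm.le.trans hright
  have hone : (m : ℝ≥0∞) * ENNReal.ofReal (1 / m) = 1 := by
    rw [← ENNReal.ofReal_natCast, ← ENNReal.ofReal_mul hmr.le, mul_one_div_cancel hmr.ne',
      ENNReal.ofReal_one]
  calc _ = (m : ℝ≥0∞) * (ENNReal.ofReal (1 / m) *
        ∫⁻ σ : USphere (m + 1), ψ (inner ℝ n (σ : Vel (m + 1))) ∂(sphereMeasure (m + 1))) := by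
        rw [← mul_assoc, hone, one_mul]
    _ ≤ m * (volume (Metric.ball (0 : Vel m) 1) * ∫⁻ x in Icc (-1 : ℝ) 1, ψ x) := by gcongr
    _ = _ := by
        rw [ENNReal.coe_mul, ENNReal.coe_toNNReal measure_ball_lt_top.ne, mul_assoc]
        simp

/-! ### Collisions preserve measure -/

instance {N : ℕ} : IsFiniteMeasure (sphereMeasure N) :=
  inferInstanceAs (IsFiniteMeasure (volume : Measure (Vel N)).toSphere)

@[fun_prop]
theorem measurable_velPrime {N : ℕ} {α : Type*} [MeasurableSpace α] {f g : α → Vel N}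
    {h : α → USphere N} (hf : Measurable f) (hg : Measurable g) (hh : Measurable h) :
    Measurable fun a => velPrime (f a) (g a) (h a) := by
  unfold velPrime; fun_prop

@[fun_prop]
theorem measurable_velStarPrime {N : ℕ} {α : Type*} [MeasurableSpace α] {f g : α → Vel N}
    {h : α → USphere N} (hf : Measurable f) (hg : Measurable g) (hh : Measurable h) :
    Measurable fun a => velStarPrime (f a) (g a) (h a) := by
  unfold velStarPrime; fun_prop

theorem velPrime_sub_velStarPrime {N : ℕ} (v vs : Vel N) (σ : USphere N) :
    velPrime v vs σ - velStarPrime v vs σ = ‖v - vs‖ • (σ : Vel N) := by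
  unfold velPrime velStarPrime; module

theorem norm_velPrime_sub_velStarPrime {N : ℕ} (v vs : Vel N) (σ : USphere N) :
    ‖velPrime v vs σ - velStarPrime v vs σ‖ = ‖v - vs‖ := by
  rw [velPrime_sub_velStarPrime, norm_smul, norm_norm]; simp

theorem lintegral_center_relative {N : ℕ} {H : Vel N × Vel N → ℝ≥0∞} (hH : Measurable H) :
    ∫⁻ v, ∫⁻ vs, H (v, vs) =
      ∫⁻ z : Vel N, ∫⁻ c : Vel N, H (c + (1 / 2 : ℝ) • z, c - (1 / 2 : ℝ) • z) := by
  rw [lintegral_lintegral_swap (f := fun v vs => H (v, vs)) hH.aemeasurable]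
  have h1 : ∀ vs : Vel N, ∫⁻ v, H (v, vs) = ∫⁻ z, H (vs + z, vs) := fun vs =>
    (lintegral_add_left_eq_self (fun v => H (v, vs)) vs).symm
  simp_rw [h1]
  rw [lintegral_lintegral_swap (Measurable.aemeasurable (by fun_prop))]
  refine lintegral_congr fun z => ?_
  rw [← lintegral_sub_right_eq_self (fun vs => H (vs + z, vs)) ((1 / 2 : ℝ) • z)]
  refine lintegral_congr fun c => ?_
  congr 2
  module

/-- In the coordinates centre c, relative speed ρ, and directions ω before and σ after, a collision
merely exchanges ω and σ. This form makes that symmetry visible. -/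
theorem lintegral_collision_eq {N : ℕ} (hN : 0 < N)
    {F : Vel N × Vel N × Vel N × Vel N → ℝ≥0∞} (hF : Measurable F) :
    ∫⁻ v, ∫⁻ vs, ∫⁻ σ : USphere N, F (v, vs, velPrime v vs σ, velStarPrime v vs σ)
      ∂(sphereMeasure N) =
    ∫⁻ ω : USphere N, ∫⁻ σ : USphere N, (∫⁻ ρ in Ioi (0 : ℝ), ∫⁻ c : Vel N,
      ENNReal.ofReal (ρ ^ (N - 1)) *
      F (c + (ρ / 2) • (ω : Vel N), c - (ρ / 2) • (ω : Vel N), c + (ρ / 2) • (σ : Vel N),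
        c - (ρ / 2) • (σ : Vel N))) ∂(sphereMeasure N) ∂(sphereMeasure N) := by
  have hm : Measurable fun p : (Vel N × Vel N) × USphere N =>
      F (p.1.1, p.1.2, velPrime p.1.1 p.1.2 p.2, velStarPrime p.1.1 p.1.2 p.2) := by fun_prop
  rw [lintegral_center_relative (H := fun p => ∫⁻ σ : USphere N,
    F (p.1, p.2, velPrime p.1 p.2 σ, velStarPrime p.1 p.2 σ) ∂(sphereMeasure N))
    hm.lintegral_prod_right']
  have h1 : ∀ z : Vel N, ∫⁻ c : Vel N, ∫⁻ σ : USphere N,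
      F (c + (1 / 2 : ℝ) • z, c - (1 / 2 : ℝ) • z,
        velPrime (c + (1 / 2 : ℝ) • z) (c - (1 / 2 : ℝ) • z) σ,
        velStarPrime (c + (1 / 2 : ℝ) • z) (c - (1 / 2 : ℝ) • z) σ) ∂(sphereMeasure N) =
      ∫⁻ σ : USphere N, (∫⁻ c : Vel N,
        F (c + (1 / 2 : ℝ) • z, c - (1 / 2 : ℝ) • z, c + (‖z‖ / 2) • (σ : Vel N),
          c - (‖z‖ / 2) • (σ : Vel N))) ∂(sphereMeasure N) := by
    intro z
    rw [lintegral_lintegral_swap (Measurable.aemeasurable (by fun_prop))]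
    refine lintegral_congr fun σ => lintegral_congr fun c => ?_
    have hz : c + (1 / 2 : ℝ) • z - (c - (1 / 2 : ℝ) • z) = z := by module
    have hc : (1 / 2 : ℝ) • (c + (1 / 2 : ℝ) • z + (c - (1 / 2 : ℝ) • z)) = c := by module
    rw [velPrime, velStarPrime, hz, hc]
  simp_rw [h1]
  have hm2 : Measurable fun p : (Vel N × USphere N) × Vel N =>
      F (p.2 + (1 / 2 : ℝ) • p.1.1, p.2 - (1 / 2 : ℝ) • p.1.1, p.2 + (‖p.1.1‖ / 2) • (p.1.2 : Vel N),
          p.2 - (‖p.1.1‖ / 2) • (p.1.2 : Vel N)) := by fun_prop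
  rw [lintegral_eq_lintegral_sphere hN (Measurable.lintegral_prod_right
    hm2.lintegral_prod_right')]
  refine lintegral_congr fun ω => ?_
  have hm3 : Measurable fun p : (ℝ × USphere N) × Vel N =>
      F (p.2 + (p.1.1 / 2) • (ω : Vel N), p.2 - (p.1.1 / 2) • (ω : Vel N),
        p.2 + (p.1.1 / 2) • (p.1.2 : Vel N), p.2 - (p.1.1 / 2) • (p.1.2 : Vel N)) := by fun_prop
  have hm4 := hm3.lintegral_prod_right' (ν := volume)
  have hm5 : Measurable fun p : ℝ × USphere N => ENNReal.ofReal (p.1 ^ (N - 1)) * ∫⁻ c : Vel N,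
      F (c + (p.1 / 2) • (ω : Vel N), c - (p.1 / 2) • (ω : Vel N),
        c + (p.1 / 2) • (p.2 : Vel N), c - (p.1 / 2) • (p.2 : Vel N)) :=
    Measurable.mul (by fun_prop) hm4
  have h2 : ∀ ρ : ℝ, ρ ∈ Ioi (0 : ℝ) → ENNReal.ofReal (ρ ^ (N - 1)) *
      ∫⁻ σ : USphere N, (∫⁻ c : Vel N,
        F (c + (1 / 2 : ℝ) • (ρ • (ω : Vel N)), c - (1 / 2 : ℝ) • (ρ • (ω : Vel N)),
          c + (‖ρ • (ω : Vel N)‖ / 2) • (σ : Vel N),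
          c - (‖ρ • (ω : Vel N)‖ / 2) • (σ : Vel N))) ∂(sphereMeasure N) =
      ∫⁻ σ : USphere N, ENNReal.ofReal (ρ ^ (N - 1)) * (∫⁻ c : Vel N,
        F (c + (ρ / 2) • (ω : Vel N), c - (ρ / 2) • (ω : Vel N), c + (ρ / 2) • (σ : Vel N),
          c - (ρ / 2) • (σ : Vel N))) ∂(sphereMeasure N) := by
    intro ρ hρ
    have hρ : (0 : ℝ) < ρ := hρ
    have hn : ‖ρ • (ω : Vel N)‖ = ρ := by rw [norm_smul, Real.norm_of_nonneg hρ.le]; simp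
    have hs : (1 / 2 : ℝ) • (ρ • (ω : Vel N)) = (ρ / 2) • (ω : Vel N) := by module
    rw [hn, hs, lintegral_const_mul' _ _ ENNReal.ofReal_ne_top]
  rw [setLIntegral_congr_fun measurableSet_Ioi h2, lintegral_lintegral_swap hm5.aemeasurable]
  refine lintegral_congr fun σ => lintegral_congr fun ρ => ?_
  rw [lintegral_const_mul' _ _ ENNReal.ofReal_ne_top]

/-- The change of variables `(v, v_*) ↔ (v', v_*')` of a collision preserves the measure. -/
theorem lintegral_collision_swap {N : ℕ} (hN : 0 < N)
    {F : Vel N × Vel N × Vel N × Vel N → ℝ≥0∞} (hF : Measurable F) :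
    ∫⁻ v, ∫⁻ vs, ∫⁻ σ : USphere N, F (velPrime v vs σ, velStarPrime v vs σ, v, vs)
      ∂(sphereMeasure N) =
    ∫⁻ v, ∫⁻ vs, ∫⁻ σ : USphere N, F (v, vs, velPrime v vs σ, velStarPrime v vs σ)
      ∂(sphereMeasure N) := by
  rw [lintegral_collision_eq hN hF, lintegral_collision_eq hN
    (F := fun p => F (p.2.2.1, p.2.2.2, p.1, p.2.1)) (by fun_prop)]
  refine lintegral_lintegral_swap (Measurable.aemeasurable ?_)
  have hm : Measurable fun p : ((USphere N × USphere N) × ℝ) × Vel N =>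
      ENNReal.ofReal (p.1.2 ^ (N - 1)) *
      F (p.2 + (p.1.2 / 2) • (p.1.1.2 : Vel N), p.2 - (p.1.2 / 2) • (p.1.1.2 : Vel N),
        p.2 + (p.1.2 / 2) • (p.1.1.1 : Vel N), p.2 - (p.1.2 / 2) • (p.1.1.1 : Vel N)) := by fun_prop
  exact (hm.lintegral_prod_right').lintegral_prod_right'

/-! ### The weak form of the gain term -/

/-- The gain term with the kernel `|z|^γ` for functions with values in `[0, ∞]`. -/
noncomputable def lgain {N : ℕ} (γ : ℝ) (f g : Vel N → ℝ≥0∞) (v : Vel N) : ℝ≥0∞ :=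
  ∫⁻ vs, ∫⁻ σ : USphere N,
    ‖v - vs‖ₑ ^ γ * f (velPrime v vs σ) * g (velStarPrime v vs σ) ∂(sphereMeasure N)

theorem measurable_lgain {N : ℕ} (γ : ℝ) {f g : Vel N → ℝ≥0∞} (hf : Measurable f)
    (hg : Measurable g) : Measurable (lgain γ f g) := by
  have hm : Measurable fun p : (Vel N × Vel N) × USphere N =>
      ‖p.1.1 - p.1.2‖ₑ ^ γ * f (velPrime p.1.1 p.1.2 p.2) * g (velStarPrime p.1.1 p.1.2 p.2) := by fun_prop
  exact (hm.lintegral_prod_right').lintegral_prod_right'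

/-- The collision swap moves the post-collisional arguments from f and g to φ; |v-v_*| is invariant.
-/
theorem lintegral_lgain_mul {N : ℕ} (hN : 0 < N) (γ : ℝ) {f g φ : Vel N → ℝ≥0∞}
    (hf : Measurable f) (hg : Measurable g) (hφ : Measurable φ) :
    ∫⁻ v, lgain γ f g v * φ v = ∫⁻ v, ∫⁻ vs, f v * g vs * (‖v - vs‖ₑ ^ γ *
      ∫⁻ σ : USphere N, φ (velPrime v vs σ) ∂(sphereMeasure N)) := by
  have h := lintegral_collision_swap hN
    (F := fun p => ‖p.1 - p.2.1‖ₑ ^ γ * f p.1 * g p.2.1 * φ p.2.2.1) (by fun_prop)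
  have hnorm : ∀ (v vs : Vel N) (σ : USphere N),
      ‖velPrime v vs σ - velStarPrime v vs σ‖ₑ = ‖v - vs‖ₑ := fun v vs σ => by
    rw [enorm_eq_iff_norm_eq, norm_velPrime_sub_velStarPrime]
  simp only [hnorm] at h
  refine Eq.trans ?_ (h.trans ?_)
  · refine lintegral_congr fun v => ?_
    rw [lgain, ← lintegral_mul_const _ (Measurable.lintegral_prod_right'
      (f := fun q : Vel N × USphere N => ‖v - q.1‖ₑ ^ γ * f (velPrime v q.1 q.2) *
        g (velStarPrime v q.1 q.2)) (by fun_prop))]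
    refine lintegral_congr fun vs => ?_
    rw [← lintegral_mul_const _ (by fun_prop)]
  · refine lintegral_congr fun v => lintegral_congr fun vs => ?_
    rw [lintegral_const_mul _ (by fun_prop)]
    ring

/-! ### Two successive collisions and the slab kernel -/

/-- The velocities `v` such that the hyperplane through `v` orthogonal to `v - v₁` meets the closed
ball of centre `c` and radius `r`. -/
def slab {N : ℕ} (v₁ c : Vel N) (r : ℝ) : Set (Vel N) :=
  {v | |‖v - v₁‖ - inner ℝ (‖v - v₁‖⁻¹ • (v - v₁)) (c - v₁)| ≤ r}

theorem measurableSet_slab {N : ℕ} (v₁ c : Vel N) (r : ℝ) : MeasurableSet (slab v₁ c r) :=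
  measurableSet_le (by fun_prop) (by fun_prop)

theorem add_smul_mem_slab {N : ℕ} {v₁ c : Vel N} {r t : ℝ} (ht : 0 < t) (n : USphere N) :
    v₁ + t • (n : Vel N) ∈ slab v₁ c r ↔
      t ∈ Icc (inner ℝ (n : Vel N) (c - v₁) - r) (inner ℝ (n : Vel N) (c - v₁) + r) := by
  have hn : ‖t • (n : Vel N)‖ = t := by rw [norm_smul, Real.norm_of_nonneg ht.le]; simp
  rw [slab, mem_ofPred_eq, add_sub_cancel_left, hn, smul_smul, inv_mul_cancel₀ ht.ne', one_smul,
    abs_le, mem_Icc]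
  constructor <;> rintro ⟨h1, h2⟩ <;> constructor <;> linarith

/-- In polar coordinates around v₁ the slab is an interval of radii for each direction, and the
factor t^(N-1) cancels the singular weight down to t^a. -/
theorem lintegral_slab_eq {N : ℕ} (hN : 0 < N) (v₁ c : Vel N) (r a : ℝ) {φ : Vel N → ℝ≥0∞}
    (hφ : Measurable φ) :
    ∫⁻ v in slab v₁ c r, ‖v - v₁‖ₑ ^ (a - (N - 1)) * φ v =
      ∫⁻ n : USphere N, (∫⁻ t in Icc (inner ℝ (n : Vel N) (c - v₁) - r)
        (inner ℝ (n : Vel N) (c - v₁) + r),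
        (Ioi (0 : ℝ)).indicator (fun t => ENNReal.ofReal (t ^ a) * φ (v₁ + t • (n : Vel N))) t)
        ∂(sphereMeasure N) := by
  rw [← lintegral_indicator (measurableSet_slab v₁ c r),
    ← lintegral_add_left_eq_self _ v₁, lintegral_eq_lintegral_sphere hN]
  swap
  · exact (Measurable.indicator (by fun_prop) (measurableSet_slab v₁ c r)).comp (by fun_prop)
  refine lintegral_congr fun n => ?_
  rw [← lintegral_indicator measurableSet_Ioi, ← lintegral_indicator measurableSet_Icc]
  refine lintegral_congr fun t => ?_
  by_cases ht : t ∈ Ioi (0 : ℝ)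
  · have ht' : 0 < t := ht
    rw [indicator_of_mem ht]
    by_cases h : v₁ + t • (n : Vel N) ∈ slab v₁ c r
    · rw [indicator_of_mem h, indicator_of_mem ((add_smul_mem_slab ht' n).1 h),
        indicator_of_mem ht, add_sub_cancel_left, ← mul_assoc]
      congr 1
      have hn : ‖t • (n : Vel N)‖ₑ = ENNReal.ofReal t := by
        rw [← ofReal_norm, norm_smul, Real.norm_of_nonneg ht'.le]; simp
      rw [hn, ENNReal.ofReal_rpow_of_pos ht', ← ENNReal.ofReal_mul (by positivity),
        ← Real.rpow_natCast, ← Real.rpow_add ht', Nat.cast_sub (by omega)]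
      congr 2
      push_cast; ring
    · rw [indicator_of_notMem h, indicator_of_notMem (fun h' => h ((add_smul_mem_slab ht' n).2 h')),
        mul_zero]
  · rw [indicator_of_notMem ht]
    simp only [indicator_apply]
    simp [show ¬ t ∈ Ioi (0 : ℝ) from ht]

theorem lintegral_comp_affine_le (κ : ℝ) {r : ℝ} (hr : 0 < r) (g : ℝ → ℝ≥0∞) :
    ∫⁻ x in Icc (-1 : ℝ) 1, g (κ + r * x) ≤
      (ENNReal.ofReal r)⁻¹ * ∫⁻ t in Icc (κ - r) (κ + r), g t := by
  have hd : ∀ x : ℝ, HasDerivAt (fun x => κ + r * x) r x := fun x => by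
    simpa using ((hasDerivAt_id x).const_mul r).const_add κ
  have hinj : InjOn (fun x : ℝ => κ + r * x) (Icc (-1) 1) := fun x _ y _ h => by
    simpa [hr.ne'] using h
  have h := lintegral_image_eq_lintegral_abs_deriv_mul measurableSet_Icc
    (fun x _ => (hd x).hasDerivWithinAt) hinj g
  rw [abs_of_pos hr, lintegral_const_mul' _ _ ENNReal.ofReal_ne_top] at h
  have hsub : (fun x : ℝ => κ + r * x) '' Icc (-1) 1 ⊆ Icc (κ - r) (κ + r) := by
    rintro _ ⟨x, ⟨h1, h2⟩, rfl⟩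
    constructor <;> nlinarith
  have hr0 : ENNReal.ofReal r ≠ 0 := by simpa using hr
  calc ∫⁻ x in Icc (-1 : ℝ) 1, g (κ + r * x)
      = (ENNReal.ofReal r)⁻¹ * (ENNReal.ofReal r * ∫⁻ x in Icc (-1 : ℝ) 1, g (κ + r * x)) := by
        rw [← mul_assoc, ENNReal.inv_mul_cancel hr0 ENNReal.ofReal_ne_top, one_mul]
    _ ≤ _ := by rw [← h]; gcongr

/-- Angle doubling with e = (u-v₁)/|u-v₁| places the post-collisional velocity at v₁ + (n·(u-v₁))n,
which depends on u only through one inner product; this is what allows u to be averaged afterwards.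
-/
theorem lintegral_velPrime_le {N : ℕ} (hN : 3 ≤ N) {γ a R : ℝ} (hγ : 0 < γ)
    (haN : a ≤ N - 2) (haγ : a ≤ γ) {v₁ u : Vel N} (hR : ‖u - v₁‖ ≤ R) {φ : Vel N → ℝ≥0∞}
    (hφ : Measurable φ) :
    ‖v₁ - u‖ₑ ^ γ * ∫⁻ ω : USphere N, φ (velPrime v₁ u ω) ∂(sphereMeasure N) ≤
      2 ^ N * (ENNReal.ofReal R ^ (γ - a) * ∫⁻ n : USphere N,
        (Ioi (0 : ℝ)).indicator (fun t => ENNReal.ofReal (t ^ a) * φ (v₁ + t • (n : Vel N)))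
          (inner ℝ (n : Vel N) (u - v₁)) ∂(sphereMeasure N)) := by
  rcases eq_or_ne u v₁ with rfl | hne
  · simp [ENNReal.zero_rpow_of_pos hγ]
  set y := u - v₁ with hy
  have hy0 : 0 < ‖y‖ := norm_pos_iff.2 (sub_ne_zero.2 hne)
  set e := ‖y‖⁻¹ • y with hedef
  have he : ‖e‖ = 1 := by rw [norm_smul, norm_inv, norm_norm, inv_mul_cancel₀ hy0.ne']
  have hye : y = ‖y‖ • e := by rw [hedef, smul_smul, mul_inv_cancel₀ hy0.ne', one_smul]
  have hvn : ‖v₁ - u‖ = ‖y‖ := norm_sub_rev _ _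
  have hgm : Measurable fun ω : Vel N => φ ((1 / 2 : ℝ) • (v₁ + u) + (‖v₁ - u‖ / 2) • ω) := by
    fun_prop
  have h1 := lintegral_sphere_le_doubleAngle hN he hgm
  have hRtop : ENNReal.ofReal R ^ (γ - a) ≠ ∞ :=
    ENNReal.rpow_ne_top_of_nonneg (by linarith) ENNReal.ofReal_ne_top
  have hvtop : ‖v₁ - u‖ₑ ^ γ ≠ ∞ := ENNReal.rpow_ne_top_of_nonneg hγ.le enorm_ne_top
  calc _ ≤ ‖v₁ - u‖ₑ ^ γ * (2 ^ N * ∫⁻ n : USphere N,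
        ENNReal.ofReal (max (inner ℝ e (n : Vel N)) 0 ^ (N - 2)) *
        φ ((1 / 2 : ℝ) • (v₁ + u) + (‖v₁ - u‖ / 2) • doubleAngle e n) ∂(sphereMeasure N)) := by
        gcongr; exact h1
    _ = 2 ^ N * ∫⁻ n : USphere N, ‖v₁ - u‖ₑ ^ γ *
        (ENNReal.ofReal (max (inner ℝ e (n : Vel N)) 0 ^ (N - 2)) *
        φ ((1 / 2 : ℝ) • (v₁ + u) + (‖v₁ - u‖ / 2) • doubleAngle e n)) ∂(sphereMeasure N) := by
        rw [lintegral_const_mul' _ _ hvtop]; ring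
    _ ≤ _ := by
        rw [← lintegral_const_mul' _ _ hRtop]
        refine mul_le_mul_right (lintegral_mono fun n => ?_) _
        beta_reduce
        have hn : ‖(n : Vel N)‖ = 1 := by simp
        rcases le_or_gt (inner ℝ e (n : Vel N)) 0 with h0 | h0
        · rw [max_eq_right h0, zero_pow (by omega)]
          simp
        · set x := inner ℝ e (n : Vel N) with hx
          have hx1 : x ≤ 1 := by
            have := real_inner_le_norm e (n : Vel N)
            rwa [he, hn, one_mul] at this
          have hin : inner ℝ (n : Vel N) y = ‖y‖ * x := by
            rw [real_inner_comm, hye, inner_smul_left, ← hye]; simp [hx]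
          have hpt : (1 / 2 : ℝ) • (v₁ + u) + (‖v₁ - u‖ / 2) • doubleAngle e n =
              v₁ + (‖y‖ * x) • (n : Vel N) := by
            have hu : u = v₁ + ‖y‖ • e := by rw [← hye, hy]; abel
            have hdn : doubleAngle e (n : Vel N) = (2 * x) • (n : Vel N) - e := by
              simp [doubleAngle, hn, hx]
            rw [hvn, hdn]
            conv_lhs => rw [hu]
            module
          have hpos : 0 < ‖y‖ * x := by positivity
          rw [hin, indicator_of_mem (mem_Ioi.2 hpos), hpt, ← mul_assoc, ← mul_assoc,
            max_eq_left h0.le, ← ofReal_norm, hvn, ENNReal.ofReal_rpow_of_pos hy0,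
            ENNReal.ofReal_rpow_of_pos (hy0.trans_le hR), ← ENNReal.ofReal_mul (by positivity),
            ← ENNReal.ofReal_mul (Real.rpow_nonneg (hy0.le.trans hR) _)]
          refine mul_le_mul_left (ENNReal.ofReal_le_ofReal ?_) _
          -- The surplus power γ - a ≥ 0 of the speed is given to R, and 0 < x ≤ 1 lets the Jacobian
          -- x^(N-2) be weakened to x^a, so that only t^a with t = ‖y‖x is left.
          have e1 : ‖y‖ ^ γ = ‖y‖ ^ (γ - a) * ‖y‖ ^ a := by rw [← Real.rpow_add hy0]; ring_nf
          have e2 : x ^ (N - 2) ≤ x ^ a := by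
            rw [← Real.rpow_natCast, Nat.cast_sub (by omega)]
            exact Real.rpow_le_rpow_of_exponent_ge h0 hx1 (by push_cast; linarith)
          calc ‖y‖ ^ γ * x ^ (N - 2) ≤ (R ^ (γ - a) * ‖y‖ ^ a) * x ^ a := by
                have hR0 : 0 ≤ R := hy0.le.trans hR
                rw [e1]
                gcongr
            _ = _ := by rw [Real.mul_rpow hy0.le h0.le, mul_assoc]

/-- After Tonelli the inner average over σ sees only n·σ; its bounded density and the scaling x ↦ κ
+ rx produce the factor 1/r and an interval of radii, which is the slab in polar form. -/
theorem exists_lintegral_two_collisions_le {N : ℕ} (hN : 3 ≤ N) :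
    ∃ C : ℝ≥0, ∀ γ a : ℝ, 0 < γ → 0 ≤ a → a ≤ N - 2 → a ≤ γ → ∀ (v₁ c : Vel N) (r : ℝ), 0 < r →
      ∀ φ : Vel N → ℝ≥0∞, Measurable φ →
      ∫⁻ σ : USphere N, ‖v₁ - (c + r • (σ : Vel N))‖ₑ ^ γ *
        ∫⁻ ω : USphere N, φ (velPrime v₁ (c + r • (σ : Vel N)) ω) ∂(sphereMeasure N)
        ∂(sphereMeasure N) ≤
      C * (ENNReal.ofReal (‖v₁ - c‖ + r) ^ (γ - a) * (ENNReal.ofReal r)⁻¹ *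
        ∫⁻ v in slab v₁ c r, ‖v - v₁‖ₑ ^ (a - (N - 1)) * φ v) := by
  obtain ⟨C, hC⟩ := exists_lintegral_sphere_inner_le hN
  refine ⟨2 ^ N * C, fun γ a hγ ha haN haγ v₁ c r hr φ hφ => ?_⟩
  set R := ‖v₁ - c‖ + r
  have hRtop : ENNReal.ofReal R ^ (γ - a) ≠ ∞ :=
    ENNReal.rpow_ne_top_of_nonneg (by linarith) ENNReal.ofReal_ne_top
  let Θ : USphere N → ℝ → ℝ≥0∞ := fun n =>
    (Ioi (0 : ℝ)).indicator (fun t => ENNReal.ofReal (t ^ a) * φ (v₁ + t • (n : Vel N)))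
  have hΘm : Measurable fun p : USphere N × ℝ => Θ p.1 p.2 := by
    have : (fun p : USphere N × ℝ => Θ p.1 p.2) = {p : USphere N × ℝ | 0 < p.2}.indicator
        (fun p => ENNReal.ofReal (p.2 ^ a) * φ (v₁ + p.2 • (p.1 : Vel N))) := by
      ext p; simp only [Θ, indicator, mem_Ioi, mem_ofPred_eq]
    rw [this]
    exact Measurable.indicator (by fun_prop) (measurableSet_lt (by fun_prop) (by fun_prop))
  have hn : ∀ n : USphere N, ‖(n : Vel N)‖ = 1 := fun n => by simp
  calc _ ≤ ∫⁻ σ : USphere N, 2 ^ N * (ENNReal.ofReal R ^ (γ - a) * ∫⁻ n : USphere N,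
        Θ n (inner ℝ (n : Vel N) (c + r • (σ : Vel N) - v₁)) ∂(sphereMeasure N))
        ∂(sphereMeasure N) := by
        refine lintegral_mono fun σ => ?_
        refine lintegral_velPrime_le hN hγ haN haγ ?_ hφ
        calc ‖c + r • (σ : Vel N) - v₁‖ = ‖-(v₁ - c) + r • (σ : Vel N)‖ := by congr 1; abel
          _ ≤ ‖-(v₁ - c)‖ + ‖r • (σ : Vel N)‖ := norm_add_le _ _
          _ = R := by rw [norm_neg, norm_smul, hn, Real.norm_of_nonneg hr.le, mul_one]
    _ = 2 ^ N * (ENNReal.ofReal R ^ (γ - a) * ∫⁻ n : USphere N, ∫⁻ σ : USphere N,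
        Θ n (inner ℝ (n : Vel N) (c - v₁) + r * inner ℝ (n : Vel N) (σ : Vel N))
        ∂(sphereMeasure N) ∂(sphereMeasure N)) := by
        rw [lintegral_const_mul' _ _ (by finiteness), lintegral_const_mul' _ _ hRtop]
        congr 2
        rw [lintegral_lintegral_swap]
        · refine lintegral_congr fun n => lintegral_congr fun σ => ?_
          rw [add_sub_right_comm, inner_add_right, inner_smul_right]
        · exact (hΘm.comp (g := fun p => Θ p.1 p.2) (f := fun p : USphere N × USphere N =>
            (p.2, inner ℝ (p.2 : Vel N) (c + r • (p.1 : Vel N) - v₁)))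
            (by fun_prop)).aemeasurable
    _ ≤ 2 ^ N * (ENNReal.ofReal R ^ (γ - a) * ∫⁻ n : USphere N, C * ((ENNReal.ofReal r)⁻¹ *
        ∫⁻ t in Icc (inner ℝ (n : Vel N) (c - v₁) - r) (inner ℝ (n : Vel N) (c - v₁) + r), Θ n t)
        ∂(sphereMeasure N)) := by
        gcongr with n
        refine (hC n (hn n) (fun x => Θ n (inner ℝ (n : Vel N) (c - v₁) + r * x))
          (hΘm.comp (by fun_prop : Measurable fun x : ℝ =>
            (n, inner ℝ (n : Vel N) (c - v₁) + r * x)))).trans ?_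
        gcongr
        exact lintegral_comp_affine_le _ hr _
    _ = _ := by
        rw [lintegral_slab_eq (by omega) v₁ c r a hφ, lintegral_const_mul' _ _ ENNReal.coe_ne_top,
          lintegral_const_mul' _ _ (by simpa using hr)]
        push_cast
        ring

/-! ### Hölder, singular integrals and duality -/

theorem holder_exponent_pos {p : ℝ≥0∞} (hp : 1 < p) : 0 < 1 - (p⁻¹).toReal := by
  have h := (ENNReal.toReal_lt_toReal (by simp [(zero_lt_one.trans hp).ne']) ENNReal.one_ne_top).2
    (ENNReal.inv_lt_one.2 hp)
  simp only [ENNReal.toReal_one] at h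
  linarith

/-- Writing the dual exponent as (1 - 1/p)⁻¹ treats p = ∞ uniformly with finite p, as the endpoint
p_n = ∞ requires. -/
theorem lintegral_mul_le_eLpNorm_mul {α : Type*} [MeasurableSpace α] {μ : Measure α} {p : ℝ≥0∞}
    (hp : 1 < p) {f g : α → ℝ≥0∞} (hf : AEMeasurable f μ) (hg : AEMeasurable g μ) :
    ∫⁻ x, f x * g x ∂μ ≤ eLpNorm f p μ *
      (∫⁻ x, g x ^ (1 - (p⁻¹).toReal)⁻¹ ∂μ) ^ (1 - (p⁻¹).toReal) := by
  rcases eq_or_ne p ∞ with rfl | htop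
  · simp only [ENNReal.inv_top, ENNReal.toReal_zero, sub_zero, inv_one, ENNReal.rpow_one,
      eLpNorm_exponent_top]
    rw [← lintegral_const_mul'' _ hg]
    refine lintegral_mono_ae ((enorm_ae_le_eLpNormEssSup f μ).mono fun x hx => ?_)
    gcongr
    simpa using hx
  · have hp1 : 1 < p.toReal := by
      simpa using (ENNReal.toReal_lt_toReal ENNReal.one_ne_top htop).2 hp
    have h := ENNReal.lintegral_mul_le_Lp_mul_Lq μ (Real.HolderConjugate.conjExponent hp1) hf hg
    rw [eLpNorm_eq_lintegral_rpow_enorm_toReal (zero_lt_one.trans hp).ne' htop]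
    have hc : (1 - (p⁻¹).toReal)⁻¹ = Real.conjExponent p.toReal := by
      rw [ENNReal.toReal_inv, Real.conjExponent]
      field_simp
    simp only [enorm_eq_self]
    rw [← hc] at h
    simpa using h

theorem lintegral_Ioc_rpow {R k : ℝ} (hR : 0 ≤ R) (hk : -1 < k) :
    ∫⁻ ρ in Ioc 0 R, ENNReal.ofReal (ρ ^ k) = ENNReal.ofReal (R ^ (k + 1) / (k + 1)) := by
  rw [← ofReal_integral_eq_lintegral_ofReal, ← intervalIntegral.integral_of_le hR,
    integral_rpow (Or.inl hk), Real.zero_rpow (by linarith), sub_zero]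
  · exact (intervalIntegral.intervalIntegrable_rpow' hk).1
  · filter_upwards [ae_restrict_mem measurableSet_Ioc] with y hy
    exact Real.rpow_nonneg hy.1.le _

theorem exists_lintegral_closedBall_le {N : ℕ} (hN : 0 < N) {b : ℝ} (hb : b < N) :
    ∃ C : ℝ≥0, ∀ (x : Vel N) (R : ℝ), 0 ≤ R →
      ∫⁻ v in Metric.closedBall x R, ‖v - x‖ₑ ^ (-b) ≤ C * ENNReal.ofReal (R ^ (N - b)) := by
  refine ⟨(sphereMeasure N univ).toNNReal * (1 / (N - b)).toNNReal, fun x R hR => ?_⟩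
  rw [← lintegral_indicator Metric.isClosed_closedBall.measurableSet,
    ← lintegral_add_left_eq_self _ x, lintegral_eq_lintegral_sphere hN]
  swap
  · exact (Measurable.indicator (by fun_prop) Metric.isClosed_closedBall.measurableSet).comp
      (by fun_prop)
  have h : ∀ σ : USphere N, ∫⁻ ρ in Ioi (0 : ℝ), ENNReal.ofReal (ρ ^ (N - 1)) *
      (Metric.closedBall x R).indicator (fun v => ‖v - x‖ₑ ^ (-b)) (x + ρ • (σ : Vel N)) =
      ENNReal.ofReal (1 / (N - b)) * ENNReal.ofReal (R ^ (N - b)) := by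
    intro σ
    have h1 := lintegral_Ioc_rpow hR (show -1 < (N : ℝ) - 1 - b by linarith)
    rw [show (N : ℝ) - 1 - b + 1 = N - b by ring] at h1
    rw [← ENNReal.ofReal_mul (by rw [one_div_nonneg]; linarith), one_div, mul_comm (_⁻¹),
      ← div_eq_mul_inv, ← h1, ← Iic_inter_Ioi, ← setLIntegral_indicator measurableSet_Iic]
    refine setLIntegral_congr_fun measurableSet_Ioi fun ρ hρ => ?_
    have hρ : (0 : ℝ) < ρ := hρ
    have hn : ‖ρ • (σ : Vel N)‖ = ρ := by rw [norm_smul, Real.norm_of_nonneg hρ.le]; simp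
    have hiff : x + ρ • (σ : Vel N) ∈ Metric.closedBall x R ↔ ρ ∈ Iic R := by
      rw [Metric.mem_closedBall, dist_eq_norm, add_sub_cancel_left, hn, mem_Iic]
    by_cases h2 : ρ ∈ Iic R
    · rw [indicator_of_mem (hiff.2 h2), indicator_of_mem h2, add_sub_cancel_left, ← ofReal_norm, hn,
        ENNReal.ofReal_rpow_of_pos hρ, ← ENNReal.ofReal_mul (by positivity),
        ← Real.rpow_natCast, ← Real.rpow_add hρ, Nat.cast_sub (by omega)]
      congr 2
      push_cast
      ring
    · rw [indicator_of_notMem (fun h' => h2 (hiff.1 h')), indicator_of_notMem h2, mul_zero]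
  simp_rw [h]
  rw [lintegral_const, ENNReal.coe_mul, ENNReal.coe_toNNReal (measure_ne_top _ _), mul_comm,
    mul_assoc]
  rfl

theorem exists_lintegral_slab_le {N : ℕ} (hN : 0 < N) :
    ∃ C : ℝ≥0, ∀ (v₁ c : Vel N) (r : ℝ), 0 ≤ r →
      ∫⁻ v in slab v₁ c r, ‖v - v₁‖ₑ ^ (-((N : ℝ) - 1)) ≤ C * ENNReal.ofReal r := by
  refine ⟨(sphereMeasure N univ).toNNReal * 2, fun v₁ c r hr => ?_⟩
  have h := lintegral_slab_eq hN v₁ c r 0 (φ := fun _ => 1) measurable_const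
  simp only [zero_sub, mul_one, Real.rpow_zero, ENNReal.ofReal_one] at h
  rw [h]
  calc _ ≤ ∫⁻ _ : USphere N, ENNReal.ofReal (2 * r) ∂(sphereMeasure N) := by
        refine lintegral_mono fun n => ?_
        calc _ ≤ ∫⁻ _ in Icc (inner ℝ (n : Vel N) (c - v₁) - r)
              (inner ℝ (n : Vel N) (c - v₁) + r), (1 : ℝ≥0∞) :=
              lintegral_mono fun t => indicator_le_self _ (fun _ => (1 : ℝ≥0∞)) t
          _ = ENNReal.ofReal (2 * r) := by
              rw [setLIntegral_const, one_mul, Real.volume_Icc]; congr 1; ring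
    _ = _ := by
        rw [lintegral_const, ENNReal.coe_mul, ENNReal.coe_toNNReal (measure_ne_top _ _),
          ENNReal.ofReal_mul zero_le_two]
        simp
        ring

theorem one_le_bracket {N : ℕ} (v : Vel N) : 1 ≤ bracket v := by
  rw [bracket, Real.one_le_sqrt]; nlinarith [sq_nonneg ‖v‖]

theorem bracket_pos {N : ℕ} (v : Vel N) : 0 < bracket v := zero_lt_one.trans_le (one_le_bracket v)

@[fun_prop]
theorem continuous_bracket {N : ℕ} : Continuous (bracket : Vel N → ℝ) := by
  unfold bracket; fun_prop

@[fun_prop]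
theorem measurable_bracket {N : ℕ} : Measurable (bracket : Vel N → ℝ) :=
  continuous_bracket.measurable

/-- Polar coordinates around v cancel the kernel. On each ray the bracket dominates that of its
one-dimensional projection, and a power q > 1 is integrable on the line uniformly in v. -/
theorem exists_lintegral_kernel_bracket_le {N : ℕ} (hN : 0 < N) {q : ℝ} (hq : 1 < q) :
    ∃ C : ℝ≥0, ∀ v : Vel N,
      ∫⁻ x, ‖v - x‖ₑ ^ (-((N : ℝ) - 1)) * ENNReal.ofReal (bracket x) ^ (-q) ≤ C := by
  have hint : Integrable (fun t : ℝ => (1 + ‖t‖ ^ 2) ^ (-q / 2)) :=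
    integrable_rpow_neg_one_add_norm_sq (by simpa using hq)
  have hfin : ∫⁻ t : ℝ, ENNReal.ofReal ((1 + ‖t‖ ^ 2) ^ (-q / 2)) < ∞ := by
    have := hint.lintegral_lt_top
    simpa using this
  refine ⟨(∫⁻ t : ℝ, ENNReal.ofReal ((1 + ‖t‖ ^ 2) ^ (-q / 2))).toNNReal *
    (sphereMeasure N univ).toNNReal, fun v => ?_⟩
  rw [ENNReal.coe_mul, ENNReal.coe_toNNReal hfin.ne, ENNReal.coe_toNNReal (measure_ne_top _ _),
    ← lintegral_const, ← lintegral_add_left_eq_self _ v, lintegral_eq_lintegral_sphere hN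
    (by fun_prop)]
  refine lintegral_mono fun σ => ?_
  set κ : ℝ := inner ℝ (σ : Vel N) v
  calc _ ≤ ∫⁻ t in Ioi (0 : ℝ), ENNReal.ofReal ((1 + ‖κ + t‖ ^ 2) ^ (-q / 2)) := by
        refine setLIntegral_mono' measurableSet_Ioi fun t ht => ?_
        have ht : (0 : ℝ) < t := ht
        have hn : ‖v - (v + t • (σ : Vel N))‖ = t := by
          rw [sub_add_cancel_left, norm_neg, norm_smul, Real.norm_of_nonneg ht.le]; simp
        rw [← ofReal_norm, hn, ENNReal.ofReal_rpow_of_pos ht, ENNReal.ofReal_rpow_of_pos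
          (bracket_pos _), ← ENNReal.ofReal_mul (by positivity),
          ← ENNReal.ofReal_mul (by positivity)]
        refine ENNReal.ofReal_le_ofReal ?_
        have h1 : t ^ (N - 1) * t ^ (-((N : ℝ) - 1)) = 1 := by
          rw [← Real.rpow_natCast, ← Real.rpow_add ht, Nat.cast_sub (by omega)]
          simp
        rw [← mul_assoc, h1, one_mul]
        have h2 : |κ + t| ≤ ‖v + t • (σ : Vel N)‖ := by
          have h3 := abs_real_inner_le_norm (σ : Vel N) (v + t • (σ : Vel N))
          rw [inner_add_right, inner_smul_right, real_inner_self_eq_norm_sq] at h3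
          simpa using h3
        rw [bracket, Real.sqrt_eq_rpow, ← Real.rpow_mul (by positivity),
          show (1 / 2 : ℝ) * -q = -q / 2 by ring]
        refine Real.rpow_le_rpow_of_nonpos (by positivity) ?_ (by linarith)
        rw [Real.norm_eq_abs]
        gcongr
    _ ≤ ∫⁻ t : ℝ, ENNReal.ofReal ((1 + ‖κ + t‖ ^ 2) ^ (-q / 2)) := setLIntegral_le_lintegral _ _
    _ = _ := lintegral_add_left_eq_self (fun t : ℝ => ENNReal.ofReal ((1 + ‖t‖ ^ 2) ^ (-q / 2))) κ

/-- A pointwise Riesz potential bound: Hölder with the L^p norm inside a ball around v, the L¹ norm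
outside, and the radius optimised. -/
theorem exists_lintegral_riesz_le {N : ℕ} (hN : 0 < N) {p : ℝ≥0∞} (hp : 1 < p) {A : ℝ}
    (hA : 0 ≤ A) (hAp : A < N * (1 - (p⁻¹).toReal)) :
    ∃ C : ℝ≥0, ∀ (F : Vel N → ℝ≥0∞), Measurable F → ∀ v : Vel N,
      ∫⁻ x, F x * ‖x - v‖ₑ ^ (-A) ≤ C * (∫⁻ x, F x) ^ (1 - A / (N * (1 - (p⁻¹).toReal))) *
        eLpNorm F p volume ^ (A / (N * (1 - (p⁻¹).toReal))) := by
  set κ : ℝ := 1 - (p⁻¹).toReal with hκ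
  have hκ0 : 0 < κ := holder_exponent_pos hp
  have hNr : (0 : ℝ) < N := by exact_mod_cast hN
  rcases hA.eq_or_lt with rfl | hA0
  · exact ⟨1, fun F _ v => by simp⟩
  set θ : ℝ := A / (N * κ) with hθ
  have hθ0 : 0 < θ := by positivity
  have hθ1 : θ < 1 := (div_lt_one (by positivity)).2 hAp
  have hAκ : A * κ⁻¹ < N := by rwa [← div_eq_mul_inv, div_lt_iff₀ hκ0]
  obtain ⟨C, hC⟩ := exists_lintegral_closedBall_le hN hAκ
  refine ⟨C ^ κ + 1, fun F hF v => ?_⟩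
  set I := ∫⁻ x, F x with hI
  set J := eLpNorm F p volume with hJ
  have hp0 : p ≠ 0 := (zero_lt_one.trans hp).ne'
  by_cases hzero : F =ᵐ[volume] 0
  · rw [lintegral_congr_ae (g := fun _ => 0) (hzero.mono fun x hx => by simp [hx])]
    simp
  have hI0 : I ≠ 0 := fun h => hzero ((lintegral_eq_zero_iff hF).1 h)
  have hJ0 : J ≠ 0 := fun h => hzero ((eLpNorm_eq_zero_iff hF.aestronglyMeasurable hp0).1 h)
  have hIp : I ^ (1 - θ) ≠ 0 := by simp [hI0, ENNReal.rpow_eq_zero_iff, hθ1]; intro _; linarith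
  have hJp : J ^ θ ≠ 0 := by simp [hJ0, ENNReal.rpow_eq_zero_iff]; intro _; linarith
  have hCp : ((C ^ κ + 1 : ℝ≥0) : ℝ≥0∞) ≠ 0 := by simp
  by_cases hIt : I = ∞
  · rw [hIt, ENNReal.top_rpow_of_pos (by linarith), ENNReal.mul_top hCp, ENNReal.top_mul hJp]
    exact le_top
  by_cases hJt : J = ∞
  · rw [hJt, ENNReal.top_rpow_of_pos hθ0, ENNReal.mul_top (mul_ne_zero hCp hIp)]
    exact le_top
  obtain ⟨i, hi, hIi⟩ : ∃ i : ℝ, 0 < i ∧ I = ENNReal.ofReal i :=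
    ⟨I.toReal, ENNReal.toReal_pos hI0 hIt, (ENNReal.ofReal_toReal hIt).symm⟩
  obtain ⟨j, hj, hJj⟩ : ∃ j : ℝ, 0 < j ∧ J = ENNReal.ofReal j :=
    ⟨J.toReal, ENNReal.toReal_pos hJ0 hJt, (ENNReal.ofReal_toReal hJt).symm⟩
  -- At this radius the inner and outer bounds have the same size i^(1-θ) j^θ.
  set R : ℝ := (i / j) ^ (N * κ)⁻¹ with hR
  have hR0 : 0 < R := by positivity
  set B := Metric.closedBall v R with hB
  have hBm : MeasurableSet B := Metric.isClosed_closedBall.measurableSet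
  have hin : ∫⁻ x in B, F x * ‖x - v‖ₑ ^ (-A) ≤
      J * (C * ENNReal.ofReal (R ^ (N - A * κ⁻¹))) ^ κ := by
    refine (lintegral_mul_le_eLpNorm_mul hp (μ := volume.restrict B) hF.aemeasurable
      (by fun_prop)).trans ?_
    gcongr
    · exact eLpNorm_mono_measure F Measure.restrict_le_self
    · refine le_trans (le_of_eq ?_) (hC v R hR0.le)
      refine lintegral_congr fun x => ?_
      rw [← ENNReal.rpow_mul]
      congr 1
      ring
  have hout : ∫⁻ x in Bᶜ, F x * ‖x - v‖ₑ ^ (-A) ≤ I * ENNReal.ofReal (R ^ (-A)) := by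
    calc _ ≤ ∫⁻ x in Bᶜ, F x * ENNReal.ofReal (R ^ (-A)) := by
          refine setLIntegral_mono' hBm.compl fun x hx => ?_
          have hx : R < ‖x - v‖ := by
            simpa [hB, dist_eq_norm] using hx
          rw [← ofReal_norm, ENNReal.ofReal_rpow_of_pos (hR0.trans hx)]
          exact mul_le_mul_right (ENNReal.ofReal_le_ofReal
            (Real.rpow_le_rpow_of_nonpos hR0 hx.le (by linarith))) _
      _ ≤ ∫⁻ x, F x * ENNReal.ofReal (R ^ (-A)) := setLIntegral_le_lintegral _ _
      _ = _ := lintegral_mul_const _ hF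
  rw [← lintegral_add_compl _ hBm]
  refine (add_le_add hin hout).trans (le_of_eq ?_)
  have e1 : R ^ (-A) = (i / j) ^ (-θ) := by
    rw [hR, ← Real.rpow_mul (by positivity), hθ]; congr 1; field_simp
  have e2 : (R ^ (N - A * κ⁻¹)) ^ κ = (i / j) ^ (1 - θ) := by
    rw [hR, ← Real.rpow_mul (by positivity), ← Real.rpow_mul (by positivity), hθ]
    congr 1; field_simp
  have e3 : i * (i / j) ^ (-θ) = i ^ (1 - θ) * j ^ θ := by
    rw [Real.div_rpow hi.le hj.le, Real.rpow_neg hj.le, div_inv_eq_mul, ← mul_assoc]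
    congr 1
    rw [sub_eq_add_neg, Real.rpow_add hi, Real.rpow_one]
  have e4 : j * (i / j) ^ (1 - θ) = i ^ (1 - θ) * j ^ θ := by
    rw [Real.div_rpow hi.le hj.le, mul_div_left_comm, Real.rpow_sub hj, Real.rpow_one]
    field_simp
  rw [ENNReal.mul_rpow_of_nonneg _ _ hκ0.le, ENNReal.ofReal_rpow_of_pos (by positivity), e1, e2,
    hIi, hJj, ENNReal.ofReal_rpow_of_pos hi, ENNReal.ofReal_rpow_of_pos hj, mul_left_comm,
    ← ENNReal.ofReal_mul hj.le, ← ENNReal.ofReal_mul hi.le, e3, e4, mul_assoc (_ : ℝ≥0∞),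
    ← ENNReal.ofReal_mul (by positivity)]
  rw [ENNReal.coe_add, ENNReal.coe_rpow_of_nonneg _ hκ0.le, add_mul, ENNReal.coe_one, one_mul]

open Filter Topology in
-- Converse Hölder without assuming that the norm of T is finite: for finite p the extremal test
-- function is built from truncations of T, followed by monotone convergence; for p = ∞ indicators
-- suffice.
theorem eLpNorm_le_of_forall_lintegral_mul_le {N : ℕ} {p : ℝ≥0∞} (hp : 1 < p)
    {T : Vel N → ℝ≥0∞} (hT : Measurable T) {M : ℝ≥0∞}
    (h : ∀ φ : Vel N → ℝ≥0∞, Measurable φ → ∫⁻ v, T v * φ v ≤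
      M * (∫⁻ v, φ v ^ (1 - (p⁻¹).toReal)⁻¹) ^ (1 - (p⁻¹).toReal)) :
    eLpNorm T p volume ≤ M := by
  rcases eq_or_ne p ∞ with rfl | htop
  · simp only [ENNReal.inv_top, ENNReal.toReal_zero, sub_zero, inv_one, ENNReal.rpow_one] at h
    rw [eLpNorm_exponent_top]
    refine essSup_le_of_ae_le M ?_
    simp only [enorm_eq_self]
    refine ae_le_of_forall_setLIntegral_le_of_sigmaFinite hT fun s hs _ => ?_
    have h1 := h (s.indicator 1) (measurable_one.indicator hs)
    rw [lintegral_indicator_one hs] at h1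
    rw [setLIntegral_const, ← lintegral_indicator hs]
    refine le_trans (le_of_eq (lintegral_congr fun v => ?_)) h1
    by_cases hv : v ∈ s <;> simp [hv]
  · have hp0 : p ≠ 0 := (zero_lt_one.trans hp).ne'
    set P := p.toReal with hP
    have hP1 : 1 < P := by
      simpa using (ENNReal.toReal_lt_toReal ENNReal.one_ne_top htop).2 hp
    have hP0 : 0 < P := by linarith
    rw [ENNReal.toReal_inv, ← hP] at h
    set κ := 1 - P⁻¹ with hκ
    have hκ0 : 0 < κ := by
      have : P⁻¹ < 1 := inv_lt_one_of_one_lt₀ hP1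
      linarith
    have hPκ : (P - 1) * κ⁻¹ = P := by
      have : P - 1 ≠ 0 := by linarith
      rw [hκ]
      field_simp
    let S : ℕ → Vel N → ℝ≥0∞ := fun k => (Metric.closedBall 0 (k : ℝ)).indicator
      fun v => min (T v) k
    have hSm : ∀ k, Measurable (S k) := fun k =>
      (hT.min measurable_const).indicator Metric.isClosed_closedBall.measurableSet
    have hST : ∀ k v, S k v ≤ T v := fun k v => by
      by_cases hv : v ∈ Metric.closedBall (0 : Vel N) (k : ℝ) <;> simp [S, hv]
    have hbound : ∀ k, ∫⁻ v, S k v ^ P ≤ M ^ P := by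
      intro k
      set I := ∫⁻ v, S k v ^ P with hI
      have hItop : I ≠ ∞ := by
        refine ne_top_of_le_ne_top (b := ∫⁻ v in Metric.closedBall (0 : Vel N) (k : ℝ),
          (k : ℝ≥0∞) ^ P) ?_ ?_
        · rw [setLIntegral_const]
          exact ENNReal.mul_ne_top (ENNReal.rpow_ne_top_of_nonneg hP0.le (by simp))
            measure_closedBall_lt_top.ne
        · rw [← lintegral_indicator Metric.isClosed_closedBall.measurableSet]
          refine lintegral_mono fun v => ?_
          by_cases hv : v ∈ Metric.closedBall (0 : Vel N) (k : ℝ)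
          · simp only [S, indicator_of_mem hv]
            gcongr
            exact min_le_right _ _
          · simp [S, indicator_of_notMem hv, hP0]
      -- Testing with S^(P-1). Because the truncation makes I finite, I^κ can be cancelled.
      have h1 : I ≤ M * I ^ κ := by
        have h2 := h (fun v => S k v ^ (P - 1)) ((hSm k).pow_const _)
        simp only [← ENNReal.rpow_mul, hPκ] at h2
        refine le_trans (lintegral_mono fun v => ?_) h2
        calc S k v ^ P = S k v ^ (1 : ℝ) * S k v ^ (P - 1) := by
              rw [← ENNReal.rpow_add_of_nonneg _ _ zero_le_one (by linarith)]; congr 1; ring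
          _ ≤ T v * S k v ^ (P - 1) := by rw [ENNReal.rpow_one]; gcongr; exact hST k v
      rcases eq_or_ne I 0 with h0 | h0
      · rw [h0]; exact zero_le
      · have h3 : I ^ P⁻¹ ≤ M := by
          have hk0 : I ^ κ ≠ 0 := by simp [ENNReal.rpow_eq_zero_iff, h0, hItop]
          have hkt : I ^ κ ≠ ∞ := ENNReal.rpow_ne_top_of_nonneg hκ0.le hItop
          refine (ENNReal.mul_le_mul_iff_left hk0 hkt).1 (le_trans (le_of_eq ?_) h1)
          rw [← ENNReal.rpow_add _ _ h0 hItop, hκ]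
          simp
        calc I = (I ^ P⁻¹) ^ P := by rw [← ENNReal.rpow_mul, inv_mul_cancel₀ hP0.ne']; simp
          _ ≤ M ^ P := by gcongr
    rw [eLpNorm_eq_lintegral_rpow_enorm_toReal hp0 htop, ← hP]
    simp only [enorm_eq_self]
    rw [one_div, ENNReal.rpow_inv_le_iff hP0]
    refine le_of_tendsto' (lintegral_tendsto_of_tendsto_of_monotone (f := fun k v => S k v ^ P)
      (fun k => ((hSm k).pow_const _).aemeasurable) (.of_forall fun v j k hjk => ?_)
      (.of_forall fun v => ?_)) hbound
    · simp only [S]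
      gcongr
      by_cases hv : v ∈ Metric.closedBall (0 : Vel N) (j : ℝ)
      · have hv' : v ∈ Metric.closedBall (0 : Vel N) (k : ℝ) :=
          Metric.closedBall_subset_closedBall (by exact_mod_cast hjk) hv
        rw [indicator_of_mem hv, indicator_of_mem hv']
        gcongr
      · rw [indicator_of_notMem hv]; exact zero_le
    · have h4 : Tendsto (fun k : ℕ => min (T v) (k : ℝ≥0∞) ^ P) atTop (𝓝 (T v ^ P)) := by
        have h5 : Tendsto (fun k : ℕ => min (T v) (k : ℝ≥0∞)) atTop (𝓝 (min (T v) ∞)) :=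
          tendsto_const_nhds.min ENNReal.tendsto_nat_nhds_top
        rw [min_eq_left le_top] at h5
        exact (ENNReal.continuous_rpow_const.tendsto _).comp h5
      refine h4.congr' ?_
      obtain ⟨k₀, hk₀⟩ := exists_nat_ge ‖v‖
      filter_upwards [eventually_ge_atTop k₀] with k hk
      have hv : v ∈ Metric.closedBall (0 : Vel N) (k : ℝ) := by
        rw [mem_closedBall_zero_iff]; exact hk₀.trans (by exact_mod_cast hk)
      simp only [S, indicator_of_mem hv]

/-! ### The iterated gain term as a slab operator -/

theorem velPrime_eq {N : ℕ} (w ws : Vel N) (σ : USphere N) :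
    velPrime w ws σ = (1 / 2 : ℝ) • (w + ws) + (‖w - ws‖ / 2) • (σ : Vel N) := rfl

/-- The integral of `φ` against the kernel `|v - v₁|^β` over the slab attached to `v₁` and to the
collision sphere of `w`, `w_*`. -/
noncomputable def slabIntegral {N : ℕ} (β : ℝ) (φ : Vel N → ℝ≥0∞) (v₁ w ws : Vel N) : ℝ≥0∞ :=
  ∫⁻ v in slab v₁ ((1 / 2 : ℝ) • (w + ws)) (‖w - ws‖ / 2), ‖v - v₁‖ₑ ^ β * φ v

@[fun_prop]
theorem measurable_slabIntegral {N : ℕ} {α : Type*} [MeasurableSpace α] (β : ℝ) {φ : Vel N → ℝ≥0∞}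
    (hφ : Measurable φ) {v₁ w ws : α → Vel N} (h₁ : Measurable v₁) (hw : Measurable w)
    (hws : Measurable ws) : Measurable fun a => slabIntegral β φ (v₁ a) (w a) (ws a) := by
  have hset : MeasurableSet {q : α × Vel N |
      q.2 ∈ slab (v₁ q.1) ((1 / 2 : ℝ) • (w q.1 + ws q.1)) (‖w q.1 - ws q.1‖ / 2)} := by
    simp only [slab, mem_ofPred_eq]
    exact measurableSet_le (by fun_prop) (by fun_prop)
  have hm : Measurable fun q : α × Vel N =>
      (slab (v₁ q.1) ((1 / 2 : ℝ) • (w q.1 + ws q.1)) (‖w q.1 - ws q.1‖ / 2)).indicator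
        (fun v => ‖v - v₁ q.1‖ₑ ^ β * φ v) q.2 :=
    Measurable.indicator (f := fun q : α × Vel N => ‖q.2 - v₁ q.1‖ₑ ^ β * φ q.2)
      (by fun_prop) hset
  have h := hm.lintegral_prod_right' (ν := volume)
  have heq : (fun a => slabIntegral β φ (v₁ a) (w a) (ws a)) = fun a => ∫⁻ v,
      (slab (v₁ a) ((1 / 2 : ℝ) • (w a + ws a)) (‖w a - ws a‖ / 2)).indicator
        (fun v => ‖v - v₁ a‖ₑ ^ β * φ v) v :=
    funext fun a => (lintegral_indicator (measurableSet_slab _ _ _) _).symm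
  rw [heq]
  exact h

/-- The integral of `φ` over the post-collisional velocities of `v₁`, `u`. -/
noncomputable def sphereIntegral {N : ℕ} (φ : Vel N → ℝ≥0∞) (v₁ u : Vel N) : ℝ≥0∞ :=
  ∫⁻ ω : USphere N, φ (velPrime v₁ u ω) ∂(sphereMeasure N)

@[fun_prop]
theorem measurable_sphereIntegral {N : ℕ} {α : Type*} [MeasurableSpace α] {φ : Vel N → ℝ≥0∞}
    (hφ : Measurable φ) {v₁ u : α → Vel N} (h₁ : Measurable v₁) (hu : Measurable u) :
    Measurable fun a => sphereIntegral φ (v₁ a) (u a) :=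
  Measurable.lintegral_prod_right' (f := fun q : α × USphere N =>
      φ (velPrime (v₁ q.1) (u q.1) q.2)) (by fun_prop)

theorem exists_lintegral_sphereIntegral_le {N : ℕ} (hN : 3 ≤ N) :
    ∃ C : ℝ≥0, ∀ γ a : ℝ, 0 < γ → 0 ≤ a → a ≤ N - 2 → a ≤ γ → ∀ φ : Vel N → ℝ≥0∞,
      Measurable φ → ∀ v₁ w ws : Vel N, ‖w - ws‖ₑ ^ γ * ∫⁻ σ : USphere N,
        ‖v₁ - velPrime w ws σ‖ₑ ^ γ * sphereIntegral φ v₁ (velPrime w ws σ) ∂(sphereMeasure N) ≤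
        C * ‖w - ws‖ₑ ^ (γ - 1) *
          (ENNReal.ofReal (‖v₁ - (1 / 2 : ℝ) • (w + ws)‖ + ‖w - ws‖ / 2) ^ (γ - a) *
            slabIntegral (a - (N - 1)) φ v₁ w ws) := by
  obtain ⟨C, hC⟩ := exists_lintegral_two_collisions_le hN
  refine ⟨2 * C, fun γ a hγ ha haN haγ φ hφ v₁ w ws => ?_⟩
  rcases eq_or_ne w ws with rfl | hne
  · simp [ENNReal.zero_rpow_of_pos hγ]
  have hpos : 0 < ‖w - ws‖ := norm_pos_iff.2 (sub_ne_zero.2 hne)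
  have h1 := hC γ a hγ ha haN haγ v₁ ((1 / 2 : ℝ) • (w + ws)) (‖w - ws‖ / 2) (by positivity) φ hφ
  simp only [← velPrime_eq] at h1
  have he : ‖w - ws‖ₑ ^ γ * (ENNReal.ofReal (‖w - ws‖ / 2))⁻¹ = 2 * ‖w - ws‖ₑ ^ (γ - 1) := by
    rw [← ofReal_norm, ← ENNReal.ofReal_inv_of_pos (by positivity),
      ENNReal.ofReal_rpow_of_pos hpos, ENNReal.ofReal_rpow_of_pos hpos,
      ← ENNReal.ofReal_mul (by positivity), Real.rpow_sub_one hpos.ne',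
      show ‖w - ws‖ ^ γ * (‖w - ws‖ / 2)⁻¹ = 2 * (‖w - ws‖ ^ γ / ‖w - ws‖) by field_simp,
      ENNReal.ofReal_mul zero_le_two, ENNReal.ofReal_ofNat]
  refine (mul_le_mul_right h1 _).trans (le_of_eq ?_)
  calc _ = (‖w - ws‖ₑ ^ γ * (ENNReal.ofReal (‖w - ws‖ / 2))⁻¹) * (C *
        (ENNReal.ofReal (‖v₁ - (1 / 2 : ℝ) • (w + ws)‖ + ‖w - ws‖ / 2) ^ (γ - a) *
          slabIntegral (a - (N - 1)) φ v₁ w ws)) := by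
        rw [slabIntegral]
        generalize ENNReal.ofReal (‖v₁ - (1 / 2 : ℝ) • (w + ws)‖ + ‖w - ws‖ / 2) ^ (γ - a) = x
        generalize (ENNReal.ofReal (‖w - ws‖ / 2))⁻¹ = y
        ring
    _ = _ := by
        rw [he, ENNReal.coe_mul, ENNReal.coe_ofNat]
        ring

theorem lintegral_mul_lintegral_lintegral_swap {N : ℕ} {f : Vel N → ℝ≥0∞}
    {G : Vel N × Vel N → ℝ≥0∞} {K : Vel N × Vel N × Vel N → ℝ≥0∞} (hf : Measurable f)
    (hG : Measurable G) (hK : Measurable K) :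
    ∫⁻ x, f x * ∫⁻ y, ∫⁻ z, G (y, z) * K (x, y, z) =
      ∫⁻ y, ∫⁻ z, G (y, z) * ∫⁻ x, f x * K (x, y, z) := by
  calc _ = ∫⁻ x, ∫⁻ y, ∫⁻ z, f x * (G (y, z) * K (x, y, z)) := by
        refine lintegral_congr fun x => ?_
        rw [← lintegral_const_mul _ (Measurable.lintegral_prod_right' (f := fun q : Vel N × Vel N =>
          G (q.1, q.2) * K (x, q.1, q.2)) (by fun_prop))]
        refine lintegral_congr fun y => ?_
        rw [← lintegral_const_mul _ (by fun_prop)]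
    _ = ∫⁻ y, ∫⁻ z, ∫⁻ x, f x * (G (y, z) * K (x, y, z)) := by
        rw [lintegral_lintegral_swap (Measurable.aemeasurable (Measurable.lintegral_prod_right'
          (f := fun q : (Vel N × Vel N) × Vel N => f q.1.1 * (G (q.1.2, q.2) *
            K (q.1.1, q.1.2, q.2))) (by fun_prop)))]
        refine lintegral_congr fun y => ?_
        rw [lintegral_lintegral_swap (Measurable.aemeasurable (by fun_prop))]
    _ = _ := by
        refine lintegral_congr fun y => lintegral_congr fun z => ?_
        rw [← lintegral_const_mul _ (by fun_prop)]
        exact lintegral_congr fun x => mul_left_comm _ _ _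

/-- The weak form is applied to the outer and then to the inner gain term. The v₁-integral is moved
innermost, so that only a bound for fixed (w, w_*) remains to be found. -/
theorem exists_lintegral_lgain_lgain_le {N : ℕ} (hN : 3 ≤ N) :
    ∃ C : ℝ≥0, ∀ γ a : ℝ, 0 < γ → 0 ≤ a → a ≤ N - 2 → a ≤ γ → ∀ f g h φ : Vel N → ℝ≥0∞,
      Measurable f → Measurable g → Measurable h → Measurable φ →
      ∫⁻ v, lgain γ f (lgain γ g h) v * φ v ≤ ∫⁻ w, ∫⁻ ws, g w * h ws *
        (C * ‖w - ws‖ₑ ^ (γ - 1)) * ∫⁻ v₁, f v₁ *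
          (ENNReal.ofReal (‖v₁ - (1 / 2 : ℝ) • (w + ws)‖ + ‖w - ws‖ / 2) ^ (γ - a) *
            slabIntegral (a - (N - 1)) φ v₁ w ws) := by
  obtain ⟨C, hC⟩ := exists_lintegral_sphereIntegral_le hN
  have hN0 : 0 < N := by omega
  refine ⟨C, fun γ a hγ ha haN haγ f g h φ hf hg hh hφ => ?_⟩
  have hgh := measurable_lgain γ hg hh
  calc _ = ∫⁻ v₁, f v₁ * ∫⁻ u, lgain γ g h u * (‖v₁ - u‖ₑ ^ γ * sphereIntegral φ v₁ u) := by
        rw [lintegral_lgain_mul hN0 γ hf hgh hφ]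
        refine lintegral_congr fun v₁ => ?_
        rw [← lintegral_const_mul _ (by fun_prop)]
        exact lintegral_congr fun u => by rw [mul_assoc]; rfl
    _ ≤ ∫⁻ v₁, f v₁ * ∫⁻ w, ∫⁻ ws, g w * h ws * (C * ‖w - ws‖ₑ ^ (γ - 1)) *
          (ENNReal.ofReal (‖v₁ - (1 / 2 : ℝ) • (w + ws)‖ + ‖w - ws‖ / 2) ^ (γ - a) *
            slabIntegral (a - (N - 1)) φ v₁ w ws) := by
        refine lintegral_mono fun v₁ => mul_le_mul_right ?_ _
        rw [lintegral_lgain_mul hN0 γ hg hh (by fun_prop)]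
        refine lintegral_mono fun w => lintegral_mono fun ws => ?_
        rw [mul_assoc (g w * h ws)]
        exact mul_le_mul_right (hC γ a hγ ha haN haγ φ hφ v₁ w ws) _
    _ = _ := lintegral_mul_lintegral_lintegral_swap
        (G := fun q => g q.1 * h q.2 * (C * ‖q.1 - q.2‖ₑ ^ (γ - 1)))
        (K := fun q => ENNReal.ofReal (‖q.1 - (1 / 2 : ℝ) • (q.2.1 + q.2.2)‖ +
            ‖q.2.1 - q.2.2‖ / 2) ^ (γ - a) * slabIntegral (a - (N - 1)) φ q.1 q.2.1 q.2.2)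
        hf (by fun_prop) (by fun_prop)

/-! ### Weights and powers of the relative velocity -/

/-- The weight `⟨v⟩` as an extended nonnegative number. -/
noncomputable def wt {N : ℕ} (v : Vel N) : ℝ≥0∞ := ENNReal.ofReal (bracket v)

@[fun_prop]
theorem measurable_wt {N : ℕ} : Measurable (wt : Vel N → ℝ≥0∞) := by unfold wt; fun_prop

theorem one_le_wt {N : ℕ} (v : Vel N) : 1 ≤ wt v := by
  rw [wt, ENNReal.one_le_ofReal]; exact one_le_bracket v

theorem wt_ne_zero {N : ℕ} (v : Vel N) : wt v ≠ 0 := (zero_lt_one.trans_le (one_le_wt v)).ne'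

theorem wt_ne_top {N : ℕ} (v : Vel N) : wt v ≠ ∞ := ENNReal.ofReal_ne_top

theorem norm_le_bracket {N : ℕ} (v : Vel N) : ‖v‖ ≤ bracket v :=
  Real.le_sqrt_of_sq_le (by linarith)

theorem enorm_sub_le_wt {N : ℕ} (w ws : Vel N) : ‖w - ws‖ₑ ≤ 2 * (wt w * wt ws) := by
  have h2 : ENNReal.ofReal (2 * (bracket w * bracket ws)) = 2 * (wt w * wt ws) := by
    rw [ENNReal.ofReal_mul zero_le_two, ENNReal.ofReal_mul (bracket_pos w).le,
      ENNReal.ofReal_ofNat, wt, wt]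
  rw [← ofReal_norm, ← h2]
  refine ENNReal.ofReal_le_ofReal ((norm_sub_le w ws).trans ?_)
  nlinarith [norm_le_bracket w, norm_le_bracket ws, one_le_bracket w, one_le_bracket ws]

theorem collision_radius_le_wt {N : ℕ} (v₁ w ws : Vel N) :
    ENNReal.ofReal (‖v₁ - (1 / 2 : ℝ) • (w + ws)‖ + ‖w - ws‖ / 2) ≤
      3 * (wt v₁ * (wt w * wt ws)) := by
  rw [wt, wt, wt, ← ENNReal.ofReal_mul (bracket_pos w).le,
    ← ENNReal.ofReal_mul (bracket_pos v₁).le,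
    show (3 : ℝ≥0∞) = ENNReal.ofReal 3 by simp, ← ENNReal.ofReal_mul (by norm_num)]
  refine ENNReal.ofReal_le_ofReal ?_
  have h1 : ‖v₁ - (1 / 2 : ℝ) • (w + ws)‖ ≤ ‖v₁‖ + (1 / 2) * (‖w‖ + ‖ws‖) := by
    refine (norm_sub_le _ _).trans ?_
    rw [norm_smul, Real.norm_of_nonneg (by norm_num : (0 : ℝ) ≤ 1 / 2)]
    linarith [norm_add_le w ws]
  have h2 := norm_sub_le w ws
  have a1 := one_le_bracket v₁
  have a2 := one_le_bracket w
  have a3 := one_le_bracket ws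
  have h3 : bracket w + bracket ws ≤ 2 * (bracket w * bracket ws) := by nlinarith
  have h4 : 1 ≤ bracket w * bracket ws := by nlinarith
  have h5 : bracket v₁ + bracket w * bracket ws * 2 ≤ 3 * (bracket v₁ * (bracket w * bracket ws)) := by
    nlinarith
  linarith [norm_le_bracket v₁, norm_le_bracket w, norm_le_bracket ws]

/-- The weighted norm of `L^p_k` for functions with values in `[0, ∞]`. -/
noncomputable def lNorm {N : ℕ} (p : ℝ≥0∞) (k : ℝ) (F : Vel N → ℝ≥0∞) : ℝ≥0∞ :=
  eLpNorm (fun v => wt v ^ k * F v) p volume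

theorem lNorm_one {N : ℕ} (k : ℝ) (F : Vel N → ℝ≥0∞) : lNorm 1 k F = ∫⁻ v, wt v ^ k * F v := by
  simp [lNorm, eLpNorm_one_eq_lintegral_enorm]

theorem lNorm_mono {N : ℕ} (p : ℝ≥0∞) {k l : ℝ} (hkl : k ≤ l) (F : Vel N → ℝ≥0∞) :
    lNorm p k F ≤ lNorm p l F := by
  refine eLpNorm_mono_enorm fun v => ?_
  simp only [enorm_eq_self]
  gcongr
  exact one_le_wt v

theorem eLpNorm_le_lNorm {N : ℕ} (p : ℝ≥0∞) {k : ℝ} (hk : 0 ≤ k) (F : Vel N → ℝ≥0∞) :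
    eLpNorm F p volume ≤ lNorm p k F := by
  have := lNorm_mono p hk F
  simpa [lNorm] using this

theorem lintegral_le_lNorm {N : ℕ} {k : ℝ} (hk : 0 ≤ k) (F : Vel N → ℝ≥0∞) :
    ∫⁻ v, F v ≤ lNorm 1 k F := by
  have := eLpNorm_le_lNorm 1 hk F
  simpa [eLpNorm_one_eq_lintegral_enorm] using this

theorem lintegral_lintegral_mul_mul {N : ℕ} {G H : Vel N → ℝ≥0∞} (hG : Measurable G)
    (hH : Measurable H) : ∫⁻ w, ∫⁻ ws, G w * H ws = (∫⁻ w, G w) * ∫⁻ ws, H ws := by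
  rw [← lintegral_mul_const _ hG]
  exact lintegral_congr fun w => lintegral_const_mul _ hH

theorem lintegral_enorm_sub_rpow_le {N : ℕ} {x k : ℝ} (hx : 0 ≤ x) (hxk : x ≤ k)
    {g h : Vel N → ℝ≥0∞} (hg : Measurable g) (hh : Measurable h) :
    ∫⁻ w, ∫⁻ ws, g w * h ws * ‖w - ws‖ₑ ^ x ≤ 2 ^ x * (lNorm 1 k g * lNorm 1 k h) := by
  calc _ ≤ ∫⁻ w, ∫⁻ ws, (2 ^ x * (wt w ^ k * g w)) * (wt ws ^ k * h ws) := by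
        refine lintegral_mono fun w => lintegral_mono fun ws => ?_
        calc g w * h ws * ‖w - ws‖ₑ ^ x ≤ g w * h ws * (2 ^ x * (wt w ^ k * wt ws ^ k)) := by
              gcongr
              refine (ENNReal.rpow_le_rpow (enorm_sub_le_wt w ws) hx).trans ?_
              rw [ENNReal.mul_rpow_of_nonneg _ _ hx, ENNReal.mul_rpow_of_nonneg _ _ hx]
              gcongr
              · exact one_le_wt w
              · exact one_le_wt ws
          _ = _ := by ring
    _ = _ := by
        rw [lintegral_lintegral_mul_mul (by fun_prop) (by fun_prop),
          lintegral_const_mul _ (by fun_prop), lNorm_one, lNorm_one, mul_assoc]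

theorem exists_lintegral_enorm_sub_rpow_neg_le {N : ℕ} (hN : 0 < N) {p : ℝ≥0∞} (hp : 1 < p) {A : ℝ}
    (hA : 0 ≤ A) (hAp : A < N * (1 - (p⁻¹).toReal)) :
    ∃ C : ℝ≥0, ∀ g h : Vel N → ℝ≥0∞, Measurable g → Measurable h →
      ∫⁻ w, ∫⁻ ws, g w * h ws * ‖w - ws‖ₑ ^ (-A) ≤ C * ((∫⁻ w, g w) *
        ((∫⁻ w, h w) ^ (1 - A / (N * (1 - (p⁻¹).toReal))) *
          eLpNorm h p volume ^ (A / (N * (1 - (p⁻¹).toReal))))) := by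
  obtain ⟨C, hC⟩ := exists_lintegral_riesz_le hN hp hA hAp
  refine ⟨C, fun g h hg hh => ?_⟩
  calc _ ≤ ∫⁻ w, g w * (C * (∫⁻ x, h x) ^ (1 - A / (N * (1 - (p⁻¹).toReal))) *
        eLpNorm h p volume ^ (A / (N * (1 - (p⁻¹).toReal)))) := by
        refine lintegral_mono fun w => ?_
        simp only [mul_assoc (g w)]
        rw [lintegral_const_mul _ (by fun_prop)]
        refine mul_le_mul_right ?_ _
        refine le_trans (le_of_eq (lintegral_congr fun ws => ?_)) (hC h hh w)
        rw [← enorm_neg, neg_sub]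
    _ = _ := by rw [lintegral_mul_const _ hg]; ring

/-- Only an inequality holds: at x = 0 with a < 0 the left side can be ∞ · 0 = 0. It is needed on
the diagonal w = w_* when γ < 1. -/
theorem ENNReal.rpow_mul_rpow_le_add {x : ℝ≥0∞} (hx : x ≠ ∞) (a : ℝ) {b : ℝ} (hb : 0 ≤ b) :
    x ^ a * x ^ b ≤ x ^ (a + b) := by
  rcases eq_or_ne x 0 with rfl | h0
  · rcases hb.eq_or_lt with rfl | hb
    · simp
    · simp [ENNReal.zero_rpow_of_pos hb]
  · rw [ENNReal.rpow_add _ _ h0 hx]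

/-! ### Reduction by duality, and bounds for the slab operator -/

theorem exists_eLpNorm_lgain_lgain_le {N : ℕ} (hN : 3 ≤ N) :
    ∃ C : ℝ≥0, ∀ γ a : ℝ, 0 < γ → 0 ≤ a → a ≤ N - 2 → a ≤ γ → ∀ p : ℝ≥0∞, 1 < p →
      ∀ f g h : Vel N → ℝ≥0∞, Measurable f → Measurable g → Measurable h →
      ∀ I : Vel N × Vel N → ℝ≥0∞, Measurable I →
      (∀ φ : Vel N → ℝ≥0∞, Measurable φ → ∀ w ws : Vel N, ∫⁻ v₁, f v₁ *
          (ENNReal.ofReal (‖v₁ - (1 / 2 : ℝ) • (w + ws)‖ + ‖w - ws‖ / 2) ^ (γ - a) *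
            slabIntegral (a - (N - 1)) φ v₁ w ws) ≤
          I (w, ws) * (∫⁻ v, φ v ^ (1 - (p⁻¹).toReal)⁻¹) ^ (1 - (p⁻¹).toReal)) →
      eLpNorm (lgain γ f (lgain γ g h)) p volume ≤
        C * ∫⁻ w, ∫⁻ ws, g w * h ws * (‖w - ws‖ₑ ^ (γ - 1) * I (w, ws)) := by
  obtain ⟨C, hC⟩ := exists_lintegral_lgain_lgain_le hN
  refine ⟨C, fun γ a hγ ha haN haγ p hp f g h hf hg hh I hI hle => ?_⟩
  refine eLpNorm_le_of_forall_lintegral_mul_le hp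
    (measurable_lgain γ hf (measurable_lgain γ hg hh)) fun φ hφ => ?_
  refine (hC γ a hγ ha haN haγ f g h φ hf hg hh hφ).trans ?_
  set Φ := (∫⁻ v, φ v ^ (1 - (p⁻¹).toReal)⁻¹) ^ (1 - (p⁻¹).toReal)
  calc _ ≤ ∫⁻ w, ∫⁻ ws, g w * h ws * (C * ‖w - ws‖ₑ ^ (γ - 1)) * (I (w, ws) * Φ) := by
        refine lintegral_mono fun w => lintegral_mono fun ws => ?_
        exact mul_le_mul_right (hle φ hφ w ws) _
    _ = ∫⁻ w, ∫⁻ ws, (C * (g w * h ws * (‖w - ws‖ₑ ^ (γ - 1) * I (w, ws)))) * Φ := by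
        refine lintegral_congr fun w => lintegral_congr fun ws => ?_
        ring
    _ = _ := by
        have hm : Measurable fun q : Vel N × Vel N =>
          g q.1 * h q.2 * (‖q.1 - q.2‖ₑ ^ (γ - 1) * I (q.1, q.2)) := by fun_prop
        have h1 : ∀ w, ∫⁻ ws, (C * (g w * h ws * (‖w - ws‖ₑ ^ (γ - 1) * I (w, ws)))) * Φ =
            C * (∫⁻ ws, g w * h ws * (‖w - ws‖ₑ ^ (γ - 1) * I (w, ws))) * Φ := fun w => by
          rw [lintegral_mul_const _ (by fun_prop), lintegral_const_mul _ (by fun_prop)]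
        simp_rw [h1]
        rw [lintegral_mul_const _ (hm.lintegral_prod_right'.const_mul _),
          lintegral_const_mul _ hm.lintegral_prod_right']

/-- The exponent p is the one that turns |v-v₁|^(γ-(N-1)) into |v-v₁|^(-(N-1)), whose mass on the
slab is O(|w-w_*|). -/
theorem exists_slabIntegral_le {N : ℕ} (hN : 2 ≤ N) {γ : ℝ} (hγ : γ < N - 1)
    {p : ℝ≥0∞} (hp : 1 < p) (hpγ : (p⁻¹).toReal * (N - 1) = N - 1 - γ) :
    ∃ C : ℝ≥0, ∀ φ : Vel N → ℝ≥0∞, Measurable φ → ∀ v₁ w ws : Vel N,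
      slabIntegral (γ - (N - 1)) φ v₁ w ws ≤ C * ‖w - ws‖ₑ ^ (p⁻¹).toReal *
        (∫⁻ v, φ v ^ (1 - (p⁻¹).toReal)⁻¹) ^ (1 - (p⁻¹).toReal) := by
  obtain ⟨C, hC⟩ := exists_lintegral_slab_le (N := N) (by omega)
  set π := (p⁻¹).toReal with hπ
  have hNr : (2 : ℝ) ≤ N := by exact_mod_cast hN
  have hπ0 : 0 < π := by
    by_contra hneg
    nlinarith [hπ ▸ (ENNReal.toReal_nonneg : 0 ≤ (p⁻¹).toReal)]
  have htop : p ≠ ∞ := by rintro rfl; simp at hπ; linarith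
  have hpr : p.toReal = π⁻¹ := by rw [hπ, ENNReal.toReal_inv, inv_inv]
  have hκ := holder_exponent_pos hp
  refine ⟨C ^ π, fun φ hφ v₁ w ws => ?_⟩
  rw [slabIntegral]
  refine (lintegral_mul_le_eLpNorm_mul hp (by fun_prop) hφ.aemeasurable).trans ?_
  gcongr
  · rw [eLpNorm_eq_lintegral_rpow_enorm_toReal (zero_lt_one.trans hp).ne' htop, hpr,
      one_div π⁻¹, inv_inv, ENNReal.coe_rpow_of_nonneg _ hπ0.le, ← ENNReal.mul_rpow_of_nonneg _ _ hπ0.le]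
    gcongr
    simp only [enorm_eq_self, ← ENNReal.rpow_mul]
    have hexp : (γ - (N - 1)) * π⁻¹ = -((N : ℝ) - 1) := by
      field_simp
      linarith
    rw [hexp]
    refine (hC v₁ _ _ (by positivity)).trans ?_
    gcongr
    rw [← ofReal_norm]
    exact ENNReal.ofReal_le_ofReal (by linarith [norm_nonneg (w - ws)])
  · exact Measure.restrict_le_self

/-- The pointwise factorisation behind the Young-type inequality below. The weight w enters two
factors in powers that cancel against the third. -/
theorem ENNReal.holder_three_eq {α μ κ P m q : ℝ} (hα : 0 ≤ α) (hμ : 0 ≤ μ) (hκ : 0 ≤ κ)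
    (hP : 0 ≤ P) (hm : 0 ≤ m) (h1 : P * (α + μ) = 1) (h2 : m * (α + κ) = 1) (h3 : q * κ = 1)
    (f φ k w : ℝ≥0∞) (hw0 : w ≠ 0) (hw : w ≠ ∞) :
    ((w * f) ^ P * φ ^ m) ^ α * ((w * f) ^ P * k) ^ μ * (φ ^ m * (k * w ^ (-q))) ^ κ =
      f * (k ^ (μ + κ) * φ) := by
  simp only [ENNReal.mul_rpow_of_nonneg _ _ hα, ENNReal.mul_rpow_of_nonneg _ _ hμ,
    ENNReal.mul_rpow_of_nonneg _ _ hκ]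
  simp only [← ENNReal.rpow_mul]
  calc _ = ((w * f) ^ (P * α) * (w * f) ^ (P * μ)) * (φ ^ (m * α) * φ ^ (m * κ)) *
        (k ^ μ * k ^ κ) * w ^ (-q * κ) := by ring
    _ = (w * f) * φ * k ^ (μ + κ) * w ^ (-1 : ℝ) := by
        rw [← ENNReal.rpow_add_of_nonneg _ _ (by positivity) (by positivity),
          ← ENNReal.rpow_add_of_nonneg _ _ (by positivity) (by positivity),
          ← ENNReal.rpow_add_of_nonneg _ _ hμ hκ, ← mul_add, ← mul_add, h1, h2, neg_mul, h3,
          ENNReal.rpow_one, ENNReal.rpow_one]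
    _ = (w * w ^ (-1 : ℝ)) * (f * (k ^ (μ + κ) * φ)) := by ring
    _ = _ := by rw [ENNReal.rpow_neg_one, ENNReal.mul_inv_cancel hw0 hw, one_mul]

/-- Young's inequality at the critical exponent for the kernel k = |v-v₁|^(-(N-1)) on the slab. For
fixed v₁ its v-integral is O(|w-w_*|), but for fixed v its v₁-integral need not be finite; the
negative power of ⟨v₁⟩ supplies the missing decay, at the cost of one weight on f. -/
theorem exists_lintegral_mul_slabIntegral_le {N : ℕ} (hN : 2 ≤ N) {γ : ℝ} (hγ0 : 0 < γ)
    (hγ : γ < N - 1) {P m : ℝ≥0∞} (hP : 1 < P) (hPtop : P ≠ ∞) (hm : 1 < m)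
    (hPm : (P⁻¹).toReal = γ / (N - 1) + (m⁻¹).toReal) :
    ∃ C : ℝ≥0, ∀ f φ : Vel N → ℝ≥0∞, Measurable f → Measurable φ → ∀ w ws : Vel N,
      ∫⁻ v₁, f v₁ * slabIntegral (γ - (N - 1)) φ v₁ w ws ≤
        C * lNorm P 1 f * ‖w - ws‖ₑ ^ (m⁻¹).toReal *
          (∫⁻ v, φ v ^ (1 - (m⁻¹).toReal)⁻¹) ^ (1 - (m⁻¹).toReal) := by
  obtain ⟨C₁, hC₁⟩ := exists_lintegral_slab_le (N := N) (by omega)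
  set π := (P⁻¹).toReal with hπ
  set μ := (m⁻¹).toReal with hμ
  set α := γ / ((N : ℝ) - 1) with hα
  have hNr : (2 : ℝ) ≤ N := by exact_mod_cast hN
  have hN1 : (0 : ℝ) < N - 1 := by linarith
  have hα0 : 0 < α := by positivity
  have hα1 : α < 1 := (div_lt_one hN1).2 hγ
  have hμ0 : 0 ≤ μ := ENNReal.toReal_nonneg
  have hπ0 : 0 < π := by linarith
  have hκ : 0 < 1 - π := holder_exponent_pos hP
  have hκm : 0 < 1 - μ := holder_exponent_pos hm
  have hPr : P.toReal = π⁻¹ := by rw [hπ, ENNReal.toReal_inv, inv_inv]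
  have hq : 1 < (1 - π)⁻¹ := (one_lt_inv₀ hκ).2 (by linarith)
  obtain ⟨C₂, hC₂⟩ := exists_lintegral_kernel_bracket_le (N := N) (by omega) hq
  refine ⟨C₁ ^ μ * C₂ ^ (1 - π), fun f φ hf hφ w ws => ?_⟩
  set c := (1 / 2 : ℝ) • (w + ws)
  set r := ‖w - ws‖ / 2
  let S : Set (Vel N × Vel N) := {q | q.2 ∈ slab q.1 c r}
  have hS : MeasurableSet S := by
    simp only [S, slab, mem_ofPred_eq]
    exact measurableSet_le (by fun_prop) (by fun_prop)
  let k : Vel N × Vel N → ℝ≥0∞ := S.indicator fun q => ‖q.2 - q.1‖ₑ ^ (-((N : ℝ) - 1))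
  have hk : Measurable k := Measurable.indicator (by fun_prop) hS
  let X := ∫⁻ v, (wt v * f v) ^ π⁻¹
  let Y := ∫⁻ v, φ v ^ (1 - μ)⁻¹
  -- The three factors are integrated separately: A is a product, B integrates v over the slab
  -- first, D integrates v₁ first. Their Hölder exponents α, μ, 1 - π sum to 1 by `hPm`.
  let A : Vel N × Vel N → ℝ≥0∞ := fun q => (wt q.1 * f q.1) ^ π⁻¹ * φ q.2 ^ (1 - μ)⁻¹
  let B : Vel N × Vel N → ℝ≥0∞ := fun q => (wt q.1 * f q.1) ^ π⁻¹ * k q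
  let D : Vel N × Vel N → ℝ≥0∞ := fun q => φ q.2 ^ (1 - μ)⁻¹ * (k q * wt q.1 ^ (-(1 - π)⁻¹))
  have hA : ∫⁻ q, A q ∂(volume.prod volume) = X * Y := by
    rw [lintegral_prod _ (by fun_prop)]
    exact lintegral_lintegral_mul_mul (G := fun v => (wt v * f v) ^ π⁻¹)
      (H := fun v => φ v ^ (1 - μ)⁻¹) (by fun_prop) (by fun_prop)
  have hB : ∫⁻ q, B q ∂(volume.prod volume) ≤ X * (C₁ * ‖w - ws‖ₑ) := by
    rw [lintegral_prod _ (by fun_prop), ← lintegral_mul_const _ (by fun_prop)]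
    refine lintegral_mono fun v₁ => ?_
    simp only [B]
    rw [lintegral_const_mul _ (by fun_prop)]
    gcongr
    calc ∫⁻ v, k (v₁, v) = ∫⁻ v in slab v₁ c r, ‖v - v₁‖ₑ ^ (-((N : ℝ) - 1)) := by
          rw [← lintegral_indicator (measurableSet_slab _ _ _)]; rfl
      _ ≤ C₁ * ENNReal.ofReal r := hC₁ _ _ _ (by positivity)
      _ ≤ C₁ * ‖w - ws‖ₑ := by
          rw [← ofReal_norm]
          gcongr
          simp only [r]
          linarith [norm_nonneg (w - ws)]
  have hD : ∫⁻ q, D q ∂(volume.prod volume) ≤ Y * C₂ := by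
    rw [lintegral_prod_symm _ (by fun_prop), ← lintegral_mul_const _ (by fun_prop)]
    refine lintegral_mono fun v => ?_
    simp only [D]
    rw [lintegral_const_mul _ (by fun_prop)]
    refine mul_le_mul_right (le_trans (lintegral_mono fun v₁ => ?_) (hC₂ v)) _
    -- The slab is discarded here; decay in v₁ comes from the weight alone.
    exact mul_le_mul' (indicator_le_self _ _ _) le_rfl
  have hsum : α + μ + (1 - π) = 1 := by linarith
  calc _ = ∫⁻ q, f q.1 * (k q ^ (μ + (1 - π)) * φ q.2) ∂(volume.prod volume) := by
        rw [lintegral_prod _ (by fun_prop)]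
        refine lintegral_congr fun v₁ => ?_
        change _ = ∫⁻ v, f v₁ * (k (v₁, v) ^ (μ + (1 - π)) * φ v)
        rw [lintegral_const_mul _ (by fun_prop), slabIntegral,
          ← lintegral_indicator (measurableSet_slab _ _ _)]
        congr 1
        refine lintegral_congr fun v => ?_
        by_cases hv : v ∈ slab v₁ c r
        · rw [indicator_of_mem hv]
          simp only [k]
          rw [indicator_of_mem (show (v₁, v) ∈ S from hv), ← ENNReal.rpow_mul]
          congr 2
          rw [show μ + (1 - π) = 1 - α by linarith, hα]
          field_simp
          ring
        · rw [indicator_of_notMem hv]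
          simp only [k]
          rw [indicator_of_notMem (show (v₁, v) ∉ S from hv),
            ENNReal.zero_rpow_of_pos (by linarith), zero_mul]
    _ = ∫⁻ q, A q ^ α * B q ^ μ * D q ^ (1 - π) ∂(volume.prod volume) := by
        refine lintegral_congr fun q => ?_
        refine (ENNReal.holder_three_eq hα0.le hμ0 hκ.le (by positivity) (by positivity) ?_ ?_ ?_
          _ _ _ _ (wt_ne_zero _) (wt_ne_top _)).symm
        · rw [← hPm, inv_mul_cancel₀ hπ0.ne']
        · rw [show α + (1 - π) = 1 - μ by linarith, inv_mul_cancel₀ hκm.ne']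
        · rw [inv_mul_cancel₀ hκ.ne']
    _ ≤ (∫⁻ q, A q ∂(volume.prod volume)) ^ α * (∫⁻ q, B q ∂(volume.prod volume)) ^ μ *
        (∫⁻ q, D q ∂(volume.prod volume)) ^ (1 - π) := by
        have h := ENNReal.lintegral_prod_norm_pow_le (μ := (volume : Measure (Vel N)).prod volume)
          (Finset.univ : Finset (Fin 3)) (f := ![A, B, D]) (p := ![α, μ, 1 - π])
          (fun i _ => by fin_cases i <;> simp [A, B, D] <;> fun_prop)
          (by simpa [Fin.sum_univ_three] using hsum)
          (fun i _ => by fin_cases i <;> simp <;> linarith)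
        simpa [Fin.prod_univ_three] using h
    _ ≤ (X * Y) ^ α * (X * (C₁ * ‖w - ws‖ₑ)) ^ μ * (Y * C₂) ^ (1 - π) := by
        rw [hA]
        gcongr
    _ = (X ^ α * X ^ μ) * (Y ^ α * Y ^ (1 - π)) * ((C₁ : ℝ≥0∞) ^ μ * (C₂ : ℝ≥0∞) ^ (1 - π)) *
          ‖w - ws‖ₑ ^ μ := by
        simp only [ENNReal.mul_rpow_of_nonneg _ _ hα0.le, ENNReal.mul_rpow_of_nonneg _ _ hμ0,
          ENNReal.mul_rpow_of_nonneg _ _ hκ.le]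
        ring
    _ = _ := by
        rw [← ENNReal.rpow_add_of_nonneg _ _ hα0.le hμ0,
          ← ENNReal.rpow_add_of_nonneg _ _ hα0.le hκ.le, ← hPm,
          show α + (1 - π) = 1 - μ by linarith, lNorm,
          eLpNorm_eq_lintegral_rpow_enorm_toReal (zero_lt_one.trans hP).ne' hPtop, hPr,
          one_div π⁻¹, inv_inv, ENNReal.coe_mul, ENNReal.coe_rpow_of_nonneg _ hμ0,
          ENNReal.coe_rpow_of_nonneg _ hκ.le]
        simp only [enorm_eq_self, ENNReal.rpow_one, X, Y]
        ring

/-! ### Arithmetic of the exponents -/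

theorem numSteps_mul_le {N : ℕ} {γ : ℝ} (hγ0 : 0 < γ) (hγ : γ < (N : ℝ) - 2) {n : ℕ}
    (hn : n ≤ numSteps N γ) : n * γ ≤ (N : ℝ) - 1 := by
  rw [numSteps, if_pos hγ] at hn
  have h : (n : ℝ) ≤ ((N : ℝ) - 1) / γ :=
    (Nat.cast_le.2 hn).trans (Nat.floor_le (div_nonneg (by linarith) hγ0.le))
  exact (le_div_iff₀ hγ0).1 h

theorem lt_numSteps_add_one_mul {N : ℕ} {γ : ℝ} (hγ0 : 0 < γ) (hγ : γ < (N : ℝ) - 2) :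
    (N : ℝ) - 1 < (numSteps N γ + 1) * γ := by
  rw [numSteps, if_pos hγ]
  exact (div_lt_iff₀ hγ0).1 (Nat.lt_floor_add_one _)

theorem one_le_numSteps {N : ℕ} {γ : ℝ} (hγ0 : 0 < γ) (hγ : γ < (N : ℝ) - 2) :
    1 ≤ numSteps N γ := by
  rw [numSteps, if_pos hγ, Nat.one_le_floor_iff, one_le_div hγ0]
  linarith

theorem inv_stepExponent {N : ℕ} (hN : 3 ≤ N) (γ : ℝ) (n : ℕ) :
    (stepExponent N γ n)⁻¹ = ENNReal.ofReal (((N : ℝ) - 1 - n * γ) / (N - 1)) := by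
  have hN1 : (0 : ℝ) < N - 1 := by
    have : (3 : ℝ) ≤ N := by exact_mod_cast hN
    linarith
  rw [stepExponent, ENNReal.inv_div (Or.inl ENNReal.ofReal_ne_top)
    (Or.inr (by simpa using hN1)), ENNReal.ofReal_div_of_pos hN1]

theorem toReal_inv_stepExponent {N : ℕ} (hN : 3 ≤ N) {γ : ℝ} {n : ℕ} (hn : n * γ ≤ (N : ℝ) - 1) :
    ((stepExponent N γ n)⁻¹).toReal = ((N : ℝ) - 1 - n * γ) / (N - 1) := by
  have hN3 : (3 : ℝ) ≤ N := by exact_mod_cast hN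
  rw [inv_stepExponent hN, ENNReal.toReal_ofReal]
  exact div_nonneg (by linarith) (by linarith)

theorem one_lt_stepExponent {N : ℕ} (hN : 3 ≤ N) {γ : ℝ} (hγ : 0 < γ) {n : ℕ} (hn : 1 ≤ n) :
    1 < stepExponent N γ n := by
  have hN3 : (3 : ℝ) ≤ N := by exact_mod_cast hN
  have hn' : (1 : ℝ) ≤ n := by exact_mod_cast hn
  rw [← ENNReal.inv_lt_one, inv_stepExponent hN, ENNReal.ofReal_lt_one,
    div_lt_one (by linarith)]
  nlinarith

theorem stepExponent_ne_top {N : ℕ} (hN : 3 ≤ N) {γ : ℝ} {n : ℕ} (hn : n * γ < (N : ℝ) - 1) :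
    stepExponent N γ n ≠ ∞ := by
  have hN3 : (3 : ℝ) ≤ N := by exact_mod_cast hN
  have h : (stepExponent N γ n)⁻¹ ≠ 0 := by
    rw [inv_stepExponent hN]
    have : 0 < ((N : ℝ) - 1 - n * γ) / (N - 1) := div_pos (by linarith) (by linarith)
    simpa using this
  simpa using h

/-- This exhibits α₁ as the interpolation exponent A/(N(1-1/p)) of `exists_lintegral_riesz_le` with
A = N-1-γ. -/
theorem alphaOne_eq {N : ℕ} (hN : 3 ≤ N) {γ : ℝ} (hγ0 : 0 < γ) (hγ : γ < (N : ℝ) - 2) :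
    alphaOne N γ = ((N : ℝ) - 1 - γ) /
      (N * (1 - ((stepExponent N γ (numSteps N γ))⁻¹).toReal)) := by
  have hN3 : (3 : ℝ) ≤ N := by exact_mod_cast hN
  have hM : (1 : ℝ) ≤ numSteps N γ := by exact_mod_cast one_le_numSteps hγ0 hγ
  have hN1 : (N : ℝ) - 1 ≠ 0 := by linarith
  rw [toReal_inv_stepExponent hN (numSteps_mul_le hγ0 hγ le_rfl), alphaOne]
  have : 1 - ((N : ℝ) - 1 - numSteps N γ * γ) / (N - 1) = numSteps N γ * γ / (N - 1) := by
    field_simp; ring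
  rw [this]
  field_simp

theorem alphaTwo_eq {N : ℕ} (hN : 3 ≤ N) {γ : ℝ} (hγ0 : 0 < γ) (hγ : γ < (N : ℝ) - 2) :
    alphaTwo N γ = max (1 - γ) 0 /
      (N * (1 - ((stepExponent N γ (numSteps N γ))⁻¹).toReal)) := by
  have hN3 : (3 : ℝ) ≤ N := by exact_mod_cast hN
  have hM : (1 : ℝ) ≤ numSteps N γ := by exact_mod_cast one_le_numSteps hγ0 hγ
  have hN1 : (N : ℝ) - 1 ≠ 0 := by linarith
  rw [toReal_inv_stepExponent hN (numSteps_mul_le hγ0 hγ le_rfl), alphaTwo]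
  have : 1 - ((N : ℝ) - 1 - numSteps N γ * γ) / (N - 1) = numSteps N γ * γ / (N - 1) := by
    field_simp; ring
  rw [this]
  field_simp

/-- Maximality of N_γ gives N-1-γ < N_γ γ. Hence after N_γ steps the integrability of f suffices for
a bounded Riesz potential. -/
theorem riesz_exponent_lt {N : ℕ} (hN : 3 ≤ N) {γ : ℝ} (hγ0 : 0 < γ) (hγ : γ < (N : ℝ) - 2) :
    (N : ℝ) - 1 - γ < N * (1 - ((stepExponent N γ (numSteps N γ))⁻¹).toReal) := by
  have hN3 : (3 : ℝ) ≤ N := by exact_mod_cast hN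
  have hN1 : (0 : ℝ) < N - 1 := by linarith
  rw [toReal_inv_stepExponent hN (numSteps_mul_le hγ0 hγ le_rfl)]
  have : N * (1 - ((N : ℝ) - 1 - numSteps N γ * γ) / (N - 1)) =
      N * (numSteps N γ * γ) / (N - 1) := by
    field_simp; ring
  rw [this, lt_div_iff₀ hN1]
  have := lt_numSteps_add_one_mul hγ0 hγ
  nlinarith

theorem alphaOne_mem {N : ℕ} (hN : 3 ≤ N) {γ : ℝ} (hγ0 : 0 < γ) (hγ : γ < (N : ℝ) - 2) :
    0 < alphaOne N γ ∧ alphaOne N γ < 1 := by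
  have h := riesz_exponent_lt hN hγ0 hγ
  have h0 : 0 < (N : ℝ) - 1 - γ := by linarith
  rw [alphaOne_eq hN hγ0 hγ]
  exact ⟨div_pos h0 (h0.trans h), (div_lt_one (h0.trans h)).2 h⟩

theorem max_one_sub_lt {N : ℕ} (hN : 3 ≤ N) {γ : ℝ} (hγ0 : 0 < γ) (hγ : γ < (N : ℝ) - 2) :
    max (1 - γ) 0 < N * (1 - ((stepExponent N γ (numSteps N γ))⁻¹).toReal) := by
  have hN3 : (3 : ℝ) ≤ N := by exact_mod_cast hN
  exact (max_lt (by linarith) (by linarith)).trans (riesz_exponent_lt hN hγ0 hγ)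

theorem alphaTwo_mem {N : ℕ} (hN : 3 ≤ N) {γ : ℝ} (hγ0 : 0 < γ) (hγ : γ < (N : ℝ) - 2) :
    0 ≤ alphaTwo N γ ∧ alphaTwo N γ < 1 := by
  have h := max_one_sub_lt hN hγ0 hγ
  have h0 : 0 ≤ max (1 - γ) 0 := le_max_right _ _
  rw [alphaTwo_eq hN hγ0 hγ]
  exact ⟨div_nonneg h0 (h0.trans_lt h).le, (div_lt_one (h0.trans_lt h)).2 h⟩

/-! ### Unweighted estimates for γ < N - 2 -/

theorem lintegral_lintegral_const_mul {N : ℕ} (K : ℝ≥0∞) {F : Vel N × Vel N → ℝ≥0∞}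
    (hF : Measurable F) : ∫⁻ w, ∫⁻ ws, K * F (w, ws) = K * ∫⁻ w, ∫⁻ ws, F (w, ws) := by
  rw [← lintegral_const_mul _ hF.lintegral_prod_right']
  exact lintegral_congr fun w => lintegral_const_mul _ (by fun_prop)

theorem lintegral_kernel_mul_rpow_le {N : ℕ} (K : ℝ≥0∞) (x : ℝ) {y : ℝ} (hy : 0 ≤ y)
    {g h : Vel N → ℝ≥0∞} (hg : Measurable g) (hh : Measurable h) :
    ∫⁻ w, ∫⁻ ws, g w * h ws * (‖w - ws‖ₑ ^ x * (K * ‖w - ws‖ₑ ^ y)) ≤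
      K * ∫⁻ w, ∫⁻ ws, g w * h ws * ‖w - ws‖ₑ ^ (x + y) := by
  rw [← lintegral_lintegral_const_mul K
    (F := fun q : Vel N × Vel N => g q.1 * h q.2 * ‖q.1 - q.2‖ₑ ^ (x + y)) (by fun_prop)]
  refine lintegral_mono fun w => lintegral_mono fun ws => ?_
  calc _ = K * (g w * h ws * (‖w - ws‖ₑ ^ x * ‖w - ws‖ₑ ^ y)) := by ring
    _ ≤ _ := by
      gcongr
      exact ENNReal.rpow_mul_rpow_le_add enorm_ne_top _ hy

theorem lNorm_rpow_mul {N : ℕ} (p : ℝ≥0∞) (k l : ℝ) (F : Vel N → ℝ≥0∞) :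
    lNorm p k (fun v => wt v ^ l * F v) = lNorm p (k + l) F := by
  unfold lNorm
  congr 1
  ext v
  rw [ENNReal.rpow_add _ _ (wt_ne_zero v) (wt_ne_top v), mul_assoc]

theorem lintegral_kernel_mul_wt_le {N : ℕ} (K : ℝ≥0∞) {x e : ℝ} (hx : 0 ≤ x) (he : 0 ≤ e)
    {g h : Vel N → ℝ≥0∞} (hg : Measurable g) (hh : Measurable h) :
    ∫⁻ w, ∫⁻ ws, g w * h ws * (‖w - ws‖ₑ ^ x * (K * (wt w * wt ws) ^ e)) ≤
      K * (2 ^ x * (lNorm 1 (x + e) g * lNorm 1 (x + e) h)) := by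
  have h1 := lintegral_enorm_sub_rpow_le hx le_rfl (g := fun v => wt v ^ e * g v)
    (h := fun v => wt v ^ e * h v) (by fun_prop) (by fun_prop)
  rw [lNorm_rpow_mul, lNorm_rpow_mul] at h1
  refine le_trans (le_of_eq ?_) (mul_le_mul_right h1 K)
  rw [← lintegral_lintegral_const_mul K (F := fun q : Vel N × Vel N =>
    wt q.1 ^ e * g q.1 * (wt q.2 ^ e * h q.2) * ‖q.1 - q.2‖ₑ ^ x) (by fun_prop)]
  refine lintegral_congr fun w => lintegral_congr fun ws => ?_
  rw [ENNReal.mul_rpow_of_nonneg _ _ he]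
  ring

/-- For an L^∞ target φ is measured in L¹, so the slab may be dropped: after Tonelli a uniform Riesz
potential bound for F is enough. -/
theorem lintegral_mul_slabIntegral_le_mul {N : ℕ} {A : ℝ} {K : ℝ≥0∞} {F φ : Vel N → ℝ≥0∞}
    (hF : Measurable F) (hφ : Measurable φ) (hK : ∀ v, ∫⁻ x, F x * ‖x - v‖ₑ ^ (-A) ≤ K)
    (w ws : Vel N) : ∫⁻ v₁, F v₁ * slabIntegral (-A) φ v₁ w ws ≤ K * ∫⁻ v, φ v := by
  calc _ ≤ ∫⁻ v₁, ∫⁻ v, φ v * (F v₁ * ‖v₁ - v‖ₑ ^ (-A)) := by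
        refine lintegral_mono fun v₁ => ?_
        calc _ ≤ F v₁ * ∫⁻ v, ‖v - v₁‖ₑ ^ (-A) * φ v :=
              mul_le_mul_right (lintegral_mono' Measure.restrict_le_self le_rfl) _
          _ = _ := by
            rw [← lintegral_const_mul _ (by fun_prop)]
            refine lintegral_congr fun v => ?_
            rw [← enorm_neg, neg_sub]
            ring
    _ = ∫⁻ v, φ v * ∫⁻ v₁, F v₁ * ‖v₁ - v‖ₑ ^ (-A) := by
        rw [lintegral_lintegral_swap (by fun_prop)]
        exact lintegral_congr fun v => lintegral_const_mul _ (by fun_prop)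
    _ ≤ ∫⁻ v, φ v * K := lintegral_mono fun v => mul_le_mul_right (hK v) _
    _ = _ := by rw [lintegral_mul_const _ hφ, mul_comm]

theorem exists_eLpNorm_lgain_lgain_le_of_lOne {N : ℕ} (hN : 3 ≤ N) {γ : ℝ} (hγ0 : 0 < γ)
    (hγ : γ < (N : ℝ) - 2) :
    ∃ C : ℝ≥0, ∀ f g h : Vel N → ℝ≥0∞, Measurable f → Measurable g → Measurable h →
      eLpNorm (lgain γ f (lgain γ g h)) (stepExponent N γ 1) volume ≤
        C * lNorm 1 0 f * (lNorm 1 γ g * lNorm 1 γ h) := by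
  have hN3 : (3 : ℝ) ≤ N := by exact_mod_cast hN
  have hN1 : (0 : ℝ) < N - 1 := by linarith
  obtain ⟨C, hC⟩ := exists_eLpNorm_lgain_lgain_le hN
  have hp := one_lt_stepExponent hN hγ0 le_rfl
  have hπ := toReal_inv_stepExponent hN (γ := γ) (n := 1) (by push_cast; linarith)
  rw [Nat.cast_one, one_mul] at hπ
  obtain ⟨C₁, hC₁⟩ := exists_slabIntegral_le (N := N) (γ := γ) (by omega) (by linarith) hp
    (by rw [hπ, div_mul_cancel₀ _ hN1.ne'])
  set p := stepExponent N γ 1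
  set π := (p⁻¹).toReal
  have hπ0 : 0 ≤ π := ENNReal.toReal_nonneg
  -- The kernel factor |w-w_*|^(γ-1) alone may be singular; the slab mass contributes the power π,
  -- and the sum lies in [0, γ].
  have hx0 : 0 ≤ γ - 1 + π := by
    have : γ - 1 + π = γ * (N - 2) / (N - 1) := by rw [hπ]; field_simp; ring
    rw [this]
    exact div_nonneg (mul_nonneg hγ0.le (by linarith)) hN1.le
  have hx1 : γ - 1 + π ≤ γ := by
    have : π ≤ 1 := by rw [hπ, div_le_one hN1]; linarith
    linarith
  refine ⟨C * (C₁ * 2 ^ (γ - 1 + π)), fun f g h hf hg hh => ?_⟩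
  refine (hC γ γ hγ0 hγ0.le hγ.le le_rfl p hp f g h hf hg hh
    (fun q => C₁ * (∫⁻ v, f v) * ‖q.1 - q.2‖ₑ ^ π) (by fun_prop)
    fun φ hφ w ws => ?_).trans ?_
  · rw [sub_self]
    simp only [ENNReal.rpow_zero, one_mul]
    refine (lintegral_mono fun v₁ => mul_le_mul_right (hC₁ φ hφ v₁ w ws) _).trans ?_
    rw [lintegral_mul_const _ hf]
    exact le_of_eq (by ring)
  · refine (mul_le_mul_right (lintegral_kernel_mul_rpow_le _ _ hπ0 hg hh) _).trans ?_
    refine (mul_le_mul_right (mul_le_mul_right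
      (lintegral_enorm_sub_rpow_le hx0 hx1 hg hh) _) _).trans (le_of_eq ?_)
    rw [lNorm_one 0]
    simp only [ENNReal.rpow_zero, one_mul]
    rw [ENNReal.coe_mul, ENNReal.coe_mul, ENNReal.coe_rpow_of_nonneg _ hx0, ENNReal.coe_ofNat]
    ring

theorem exists_eLpNorm_lgain_lgain_le_of_step {N : ℕ} (hN : 3 ≤ N) {γ : ℝ} (hγ0 : 0 < γ)
    (hγ : γ < (N : ℝ) - 2) {n : ℕ} (hn : 1 ≤ n) (hn1 : n + 1 ≤ numSteps N γ) :
    ∃ C : ℝ≥0, ∀ f g h : Vel N → ℝ≥0∞, Measurable f → Measurable g → Measurable h →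
      eLpNorm (lgain γ f (lgain γ g h)) (stepExponent N γ (n + 1)) volume ≤
        C * lNorm (stepExponent N γ n) 1 f * (lNorm 1 (max γ 1) g *
          (lNorm 1 (max γ 1) h ^ (1 - stepTheta N n) *
            lNorm (stepExponent N γ n) (max γ 1) h ^ stepTheta N n)) := by
  have hN3 : (3 : ℝ) ≤ N := by exact_mod_cast hN
  have hN1 : (0 : ℝ) < N - 1 := by linarith
  have hnr : (1 : ℝ) ≤ n := by exact_mod_cast hn
  have hn1γ := numSteps_mul_le hγ0 hγ hn1
  have hnγ : n * γ < (N : ℝ) - 1 := by push_cast at hn1γ; linarith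
  obtain ⟨C, hC⟩ := exists_eLpNorm_lgain_lgain_le hN
  have hP := one_lt_stepExponent hN hγ0 hn
  have hPtop := stepExponent_ne_top hN hnγ
  have hm := one_lt_stepExponent hN hγ0 (Nat.le_add_left 1 n)
  have hPπ := toReal_inv_stepExponent hN hnγ.le
  have hmπ := toReal_inv_stepExponent hN hn1γ
  set P := stepExponent N γ n
  set m := stepExponent N γ (n + 1)
  obtain ⟨C₁, hC₁⟩ := exists_lintegral_mul_slabIntegral_le (N := N) (by omega) hγ0
    (by linarith) hP hPtop hm (by rw [hPπ, hmπ]; push_cast; field_simp; ring)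
  set μ := (m⁻¹).toReal
  have hμ0 : 0 ≤ μ := ENNReal.toReal_nonneg
  have key : ∀ f g h : Vel N → ℝ≥0∞, Measurable f → Measurable g → Measurable h →
      eLpNorm (lgain γ f (lgain γ g h)) m volume ≤ C * (C₁ * lNorm P 1 f *
        ∫⁻ w, ∫⁻ ws, g w * h ws * ‖w - ws‖ₑ ^ (γ - 1 + μ)) := fun f g h hf hg hh => by
    refine (hC γ γ hγ0 hγ0.le hγ.le le_rfl m hm f g h hf hg hh
      (fun q => C₁ * lNorm P 1 f * ‖q.1 - q.2‖ₑ ^ μ) (by fun_prop)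
      fun φ hφ w ws => ?_).trans (mul_le_mul_right
        (lintegral_kernel_mul_rpow_le _ _ hμ0 hg hh) _)
    rw [sub_self]
    simp only [ENNReal.rpow_zero, one_mul]
    exact hC₁ f φ hf hφ w ws
  have hx : γ - 1 + μ = γ * ((N : ℝ) - 2 - n) / (N - 1) := by
    rw [hmπ]; push_cast; field_simp; ring
  have hk0 : 0 ≤ max γ 1 := hγ0.le.trans (le_max_left _ _)
  -- The sign of γ - 1 + μ = γ(N-2-n)/(N-1) decides: a nonnegative power is absorbed by weights, and
  -- θ_n = 0; a negative one is a Riesz potential of h, and θ_n is its interpolation exponent.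
  rcases le_or_gt (n : ℝ) (N - 2) with hnN | hnN
  · have hθ : stepTheta N n = 0 := by
      rw [stepTheta, max_eq_right, mul_zero]
      rw [sub_nonpos, one_le_div (by linarith)]
      exact hnN
    have hx0 : 0 ≤ γ - 1 + μ := by
      rw [hx]
      exact div_nonneg (mul_nonneg hγ0.le (by linarith)) hN1.le
    have hx1 : γ - 1 + μ ≤ max γ 1 := by
      refine le_trans ?_ (le_max_left _ _)
      rw [hx, div_le_iff₀ hN1]
      gcongr
      linarith
    refine ⟨C * (C₁ * 2 ^ (γ - 1 + μ)), fun f g h hf hg hh => (key f g h hf hg hh).trans ?_⟩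
    refine (mul_le_mul_right (mul_le_mul_right
      (lintegral_enorm_sub_rpow_le hx0 hx1 hg hh) _) _).trans (le_of_eq ?_)
    rw [hθ, sub_zero, ENNReal.rpow_one, ENNReal.rpow_zero, mul_one, ENNReal.coe_mul,
      ENNReal.coe_mul, ENNReal.coe_rpow_of_nonneg _ hx0, ENNReal.coe_ofNat]
    ring
  · have hA0 : 0 ≤ -(γ - 1 + μ) := by
      rw [hx, ← neg_div, ← mul_neg]
      exact div_nonneg (mul_nonneg hγ0.le (by linarith)) hN1.le
    have hden : (N : ℝ) * (1 - (P⁻¹).toReal) = N * (n * γ) / (N - 1) := by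
      rw [hPπ]; field_simp; ring
    have hden0 : 0 < (N : ℝ) * (n * γ) / (N - 1) := by positivity
    have hθ : -(γ - 1 + μ) / (N * (1 - (P⁻¹).toReal)) = stepTheta N n := by
      have hle : 0 ≤ 1 - ((N : ℝ) - 2) / n := by
        rw [sub_nonneg, div_le_one (by linarith)]
        exact hnN.le
      rw [hden, stepTheta, max_eq_left hle, hx]
      field_simp
      ring
    have hAlt : -(γ - 1 + μ) < N * (1 - (P⁻¹).toReal) := by
      rw [hden, hx, ← neg_div]
      refine div_lt_div_of_pos_right ?_ hN1
      nlinarith [mul_pos (zero_lt_one.trans_le hnr) hγ0]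
    obtain ⟨C₂, hC₂⟩ := exists_lintegral_enorm_sub_rpow_neg_le (by omega) hP hA0 hAlt
    rw [hθ, neg_neg] at hC₂
    have hθ0 : 0 ≤ stepTheta N n := by rw [← hθ]; exact div_nonneg hA0 (hden ▸ hden0.le)
    have hθ1 : stepTheta N n ≤ 1 := by rw [← hθ, div_le_one (hden ▸ hden0)]; exact hAlt.le
    refine ⟨C * (C₁ * C₂), fun f g h hf hg hh => (key f g h hf hg hh).trans ?_⟩
    refine (mul_le_mul_right (mul_le_mul_right (hC₂ g h hg hh) _) _).trans ?_
    calc _ ≤ (C : ℝ≥0∞) * (C₁ * lNorm P 1 f * (C₂ * (lNorm 1 (max γ 1) g *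
          (lNorm 1 (max γ 1) h ^ (1 - stepTheta N n) *
            lNorm P (max γ 1) h ^ stepTheta N n)))) := by
          gcongr
          · exact lintegral_le_lNorm hk0 g
          · exact lintegral_le_lNorm hk0 h
          · exact eLpNorm_le_lNorm P hk0 h
      _ = _ := by rw [ENNReal.coe_mul, ENNReal.coe_mul]; ring

theorem exists_eLpNorm_lgain_lgain_le_top {N : ℕ} (hN : 3 ≤ N) {γ : ℝ} (hγ0 : 0 < γ)
    (hγ : γ < (N : ℝ) - 2) :
    ∃ C : ℝ≥0, ∀ f g h : Vel N → ℝ≥0∞, Measurable f → Measurable g → Measurable h →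
      eLpNorm (lgain γ f (lgain γ g h)) ∞ volume ≤
        C * (lNorm 1 0 f ^ (1 - alphaOne N γ) *
          lNorm (stepExponent N γ (numSteps N γ)) 0 f ^ alphaOne N γ) *
        (lNorm 1 (max (γ - 1) 0) g * (lNorm 1 (max (γ - 1) 0) h ^ (1 - alphaTwo N γ) *
          lNorm (stepExponent N γ (numSteps N γ)) 0 h ^ alphaTwo N γ)) := by
  have hN3 : (3 : ℝ) ≤ N := by exact_mod_cast hN
  have hN0 : 0 < N := by omega
  obtain ⟨C, hC⟩ := exists_eLpNorm_lgain_lgain_le hN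
  have hP := one_lt_stepExponent hN hγ0 (one_le_numSteps hγ0 hγ)
  obtain ⟨C₁, hC₁⟩ := exists_lintegral_riesz_le hN0 hP (by linarith : 0 ≤ (N : ℝ) - 1 - γ)
    (riesz_exponent_lt hN hγ0 hγ)
  rw [← alphaOne_eq hN hγ0 hγ] at hC₁
  have hα₂ := alphaTwo_eq hN hγ0 hγ
  have hα₂m := alphaTwo_mem hN hγ0 hγ
  have hlt := max_one_sub_lt hN hγ0 hγ
  set P := stepExponent N γ (numSteps N γ)
  have hzero : ∀ (q : ℝ≥0∞) (F : Vel N → ℝ≥0∞), lNorm q 0 F = eLpNorm F q volume := fun q F => by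
    simp [lNorm]
  have hzero1 : ∀ F : Vel N → ℝ≥0∞, lNorm 1 0 F = ∫⁻ v, F v := fun F => by
    simp [lNorm_one]
  have key : ∀ f g h : Vel N → ℝ≥0∞, Measurable f → Measurable g → Measurable h →
      eLpNorm (lgain γ f (lgain γ g h)) ∞ volume ≤ C * (C₁ * (lNorm 1 0 f ^ (1 - alphaOne N γ) *
          lNorm P 0 f ^ alphaOne N γ) * ∫⁻ w, ∫⁻ ws, g w * h ws * ‖w - ws‖ₑ ^ (γ - 1)) :=
      fun f g h hf hg hh => by
    refine (hC γ γ hγ0 hγ0.le hγ.le le_rfl ∞ (by simp) f g h hf hg hh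
      (fun _ => C₁ * (lNorm 1 0 f ^ (1 - alphaOne N γ) * lNorm P 0 f ^ alphaOne N γ))
      (by fun_prop) fun φ hφ w ws => ?_).trans ?_
    · have h1 := lintegral_mul_slabIntegral_le_mul hf hφ (hC₁ f hf) w ws
      simp only [sub_self, ENNReal.rpow_zero, one_mul, ENNReal.inv_top, ENNReal.toReal_zero,
        sub_zero, inv_one, ENNReal.rpow_one, hzero1, hzero, ← mul_assoc]
      rwa [neg_sub] at h1
    · have h1 := lintegral_kernel_mul_rpow_le (C₁ * (lNorm 1 0 f ^ (1 - alphaOne N γ) *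
        lNorm P 0 f ^ alphaOne N γ)) (γ - 1) le_rfl hg hh
      simp only [ENNReal.rpow_zero, mul_one, add_zero] at h1
      exact mul_le_mul_right h1 _
  -- No slab mass compensates here, so |w-w_*|^(γ-1) is left bare and is singular exactly for γ < 1;
  -- only then does h need its L^p norm.
  rcases le_or_gt 1 γ with h1 | h1
  · rw [max_eq_right (by linarith : 1 - γ ≤ 0), zero_div] at hα₂
    have hx0 : 0 ≤ γ - 1 := by linarith
    refine ⟨C * (C₁ * 2 ^ (γ - 1)), fun f g h hf hg hh => (key f g h hf hg hh).trans ?_⟩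
    refine (mul_le_mul_right (mul_le_mul_right
      (lintegral_enorm_sub_rpow_le hx0 (le_max_left _ 0) hg hh) _) _).trans (le_of_eq ?_)
    rw [hα₂, sub_zero, ENNReal.rpow_one, ENNReal.rpow_zero, mul_one, ENNReal.coe_mul,
      ENNReal.coe_mul, ENNReal.coe_rpow_of_nonneg _ hx0, ENNReal.coe_ofNat]
    ring
  · rw [max_eq_left (by linarith : 0 ≤ 1 - γ)] at hα₂ hlt
    obtain ⟨C₂, hC₂⟩ := exists_lintegral_enorm_sub_rpow_neg_le hN0 hP
      (by linarith : 0 ≤ 1 - γ) hlt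
    rw [← hα₂, neg_sub] at hC₂
    refine ⟨C * (C₁ * C₂), fun f g h hf hg hh => (key f g h hf hg hh).trans ?_⟩
    refine (mul_le_mul_right (mul_le_mul_right (hC₂ g h hg hh) _) _).trans (le_of_eq ?_)
    rw [max_eq_right (by linarith : γ - 1 ≤ 0), hzero1 g, hzero1 h, hzero P h, ENNReal.coe_mul,
      ENNReal.coe_mul]
    ring

/-! ### Unweighted estimates for γ ≥ N - 2 -/

theorem slab_subset_closedBall {N : ℕ} (v₁ c : Vel N) {r : ℝ} :
    slab v₁ c r ⊆ Metric.closedBall v₁ (‖v₁ - c‖ + r) := by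
  intro v hv
  rw [slab, mem_ofPred_eq] at hv
  rw [Metric.mem_closedBall, dist_eq_norm]
  have h1 : inner ℝ (‖v - v₁‖⁻¹ • (v - v₁)) (c - v₁) ≤ ‖v₁ - c‖ := by
    refine (real_inner_le_norm _ _).trans ?_
    rw [norm_smul, norm_inv, norm_norm, norm_sub_rev c]
    exact mul_le_of_le_one_left (norm_nonneg _) (inv_mul_le_one (a := ‖v - v₁‖))
  linarith [(abs_le.1 hv).2]

theorem collision_radius_rpow_le {N : ℕ} {e : ℝ} (he : 0 ≤ e) (v₁ w ws : Vel N) :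
    ENNReal.ofReal (‖v₁ - (1 / 2 : ℝ) • (w + ws)‖ + ‖w - ws‖ / 2) ^ e ≤
      3 ^ e * (wt v₁ ^ e * (wt w * wt ws) ^ e) := by
  refine (ENNReal.rpow_le_rpow (collision_radius_le_wt v₁ w ws) he).trans (le_of_eq ?_)
  rw [ENNReal.mul_rpow_of_nonneg _ _ he, ENNReal.mul_rpow_of_nonneg _ _ he]

/-- The slab lies in the ball of radius R around v₁, and |v-v₁|⁻¹ has L^p norm O(R^(N/p-1)) there,
which needs p < N. -/
theorem exists_slabIntegral_neg_one_le {N : ℕ} (hN : 0 < N) {p : ℝ} (hp : 1 < p) (hpN : p < N) :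
    ∃ C : ℝ≥0, ∀ φ : Vel N → ℝ≥0∞, Measurable φ → ∀ v₁ w ws : Vel N,
      slabIntegral (-1) φ v₁ w ws ≤
        C * ENNReal.ofReal (‖v₁ - (1 / 2 : ℝ) • (w + ws)‖ + ‖w - ws‖ / 2) ^ (N / p - 1) *
          (∫⁻ v, φ v ^ (1 - ((ENNReal.ofReal p)⁻¹).toReal)⁻¹) ^
            (1 - ((ENNReal.ofReal p)⁻¹).toReal) := by
  obtain ⟨C, hC⟩ := exists_lintegral_closedBall_le hN hpN
  have hp0 : 0 < p := by linarith
  have hpE : 1 < ENNReal.ofReal p := by rwa [ENNReal.one_lt_ofReal]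
  refine ⟨C ^ p⁻¹, fun φ hφ v₁ w ws => ?_⟩
  set R := ‖v₁ - (1 / 2 : ℝ) • (w + ws)‖ + ‖w - ws‖ / 2
  have hR : 0 ≤ R := by positivity
  rw [slabIntegral]
  refine (lintegral_mul_le_eLpNorm_mul hpE (by fun_prop) hφ.aemeasurable).trans ?_
  refine mul_le_mul' ?_ ?_
  · rw [eLpNorm_eq_lintegral_rpow_enorm_toReal (zero_lt_one.trans hpE).ne' ENNReal.ofReal_ne_top,
      ENNReal.toReal_ofReal hp0.le, one_div p]
    simp only [enorm_eq_self, ← ENNReal.rpow_mul, neg_one_mul]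
    calc _ ≤ (C * ENNReal.ofReal (R ^ (N - p))) ^ p⁻¹ := by
          refine ENNReal.rpow_le_rpow ((lintegral_mono_set
            (slab_subset_closedBall _ _)).trans (hC v₁ R hR)) (by positivity)
      _ = _ := by
          rw [ENNReal.mul_rpow_of_nonneg _ _ (by positivity),
            ENNReal.coe_rpow_of_nonneg _ (by positivity),
            ← ENNReal.ofReal_rpow_of_nonneg hR (by linarith), ← ENNReal.rpow_mul]
          congr 2
          field_simp
  · exact ENNReal.rpow_le_rpow (lintegral_mono' Measure.restrict_le_self le_rfl)
      (holder_exponent_pos hpE).le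

theorem exists_eLpNorm_lgain_lgain_le_of_hard {N : ℕ} (hN : 3 ≤ N) {γ : ℝ}
    (hγ : (N : ℝ) - 2 ≤ γ) {p q : ℝ} (hp : 1 < p) (hpN : p < N) (hpq : 1 / p + 1 / q = 1) :
    ∃ C : ℝ≥0, ∀ f g h : Vel N → ℝ≥0∞, Measurable f → Measurable g → Measurable h →
      eLpNorm (lgain γ f (lgain γ g h)) (ENNReal.ofReal p) volume ≤
        C * lNorm 1 (2 * γ - N / q) f *
          (lNorm 1 (2 * γ - N / q) g * lNorm 1 (2 * γ - N / q) h) := by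
  have hN3 : (3 : ℝ) ≤ N := by exact_mod_cast hN
  have hN0 : 0 < N := by omega
  have hp0 : 0 < p := by linarith
  have hNq : (N : ℝ) / q = N - N / p := by
    have : 1 / q = 1 - 1 / p := by linarith
    rw [div_eq_mul_one_div, this]; ring
  have hNp : 0 ≤ (N : ℝ) / p - 1 := by
    rw [sub_nonneg, one_le_div hp0]; exact hpN.le
  obtain ⟨C, hC⟩ := exists_eLpNorm_lgain_lgain_le hN
  obtain ⟨C₁, hC₁⟩ := exists_slabIntegral_neg_one_le hN0 hp hpN
  have hpE : 1 < ENNReal.ofReal p := by rwa [ENNReal.one_lt_ofReal]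
  -- The total power of R: the surplus γ - a at a = N-2 plus the power from the ball. Adding γ - 1
  -- from |w-w_*| gives the weight 2γ - N/q.
  set e := γ - (N - 2) + (N / p - 1) with he
  have he0 : 0 ≤ e := by linarith
  have hx0 : 0 ≤ γ - 1 := by linarith
  refine ⟨C * (C₁ * 3 ^ e * 2 ^ (γ - 1)), fun f g h hf hg hh => ?_⟩
  refine (hC γ (N - 2) (by linarith) (by linarith) le_rfl hγ _ hpE f g h hf hg hh
    (fun q => C₁ * 3 ^ e * lNorm 1 e f * (wt q.1 * wt q.2) ^ e) (by fun_prop)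
    fun φ hφ w ws => ?_).trans ?_
  · set Φ := (∫⁻ v, φ v ^ (1 - ((ENNReal.ofReal p)⁻¹).toReal)⁻¹) ^
      (1 - ((ENNReal.ofReal p)⁻¹).toReal)
    have hβ : (N : ℝ) - 2 - (N - 1) = -1 := by ring
    calc _ ≤ ∫⁻ v₁, (wt v₁ ^ e * f v₁) * (C₁ * 3 ^ e * (wt w * wt ws) ^ e * Φ) := by
          refine lintegral_mono fun v₁ => ?_
          rw [hβ]
          set R := ENNReal.ofReal (‖v₁ - (1 / 2 : ℝ) • (w + ws)‖ + ‖w - ws‖ / 2)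
          calc _ ≤ f v₁ * (R ^ (γ - (N - 2)) * (C₁ * R ^ (N / p - 1) * Φ)) :=
                mul_le_mul_right (mul_le_mul_right (hC₁ φ hφ v₁ w ws) _) _
            _ = (R ^ (γ - (N - 2)) * R ^ (N / p - 1)) * (f v₁ * C₁ * Φ) := by ring
            _ ≤ (3 ^ e * (wt v₁ ^ e * (wt w * wt ws) ^ e)) * (f v₁ * C₁ * Φ) :=
                mul_le_mul_left ((ENNReal.rpow_mul_rpow_le_add ENNReal.ofReal_ne_top _ hNp).trans
                  (collision_radius_rpow_le he0 _ _ _)) _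
            _ = _ := by ring
      _ = _ := by
          rw [lintegral_mul_const _ (by fun_prop), ← lNorm_one]
          ring
  · refine (mul_le_mul_right (lintegral_kernel_mul_wt_le _ hx0 he0 hg hh) _).trans ?_
    have hk : γ - 1 + e = 2 * γ - N / q := by rw [hNq]; ring
    rw [hk]
    calc _ ≤ (C : ℝ≥0∞) * (C₁ * 3 ^ e * lNorm 1 (2 * γ - N / q) f * (2 ^ (γ - 1) *
          (lNorm 1 (2 * γ - N / q) g * lNorm 1 (2 * γ - N / q) h))) :=
          mul_le_mul_right (mul_le_mul_left (mul_le_mul_right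
            (lNorm_mono 1 (by linarith) f) _) _) _
      _ = _ := by
          rw [ENNReal.coe_mul, ENNReal.coe_mul, ENNReal.coe_mul, ENNReal.coe_rpow_of_nonneg _ hx0,
            ENNReal.coe_rpow_of_nonneg _ he0, ENNReal.coe_ofNat, ENNReal.coe_ofNat]
          ring

theorem exists_eLpNorm_lgain_lgain_le_top_of_hard {N : ℕ} (hN : 3 ≤ N) {γ : ℝ}
    (hγ : (N : ℝ) - 2 ≤ γ) {p q : ℝ} (hp : 1 < p) (hpq : 1 / p + 1 / q = 1)
    (hNp : (N : ℝ) / (N - 1) < p) :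
    ∃ C : ℝ≥0, ∀ f g h : Vel N → ℝ≥0∞, Measurable f → Measurable g → Measurable h →
      eLpNorm (lgain γ f (lgain γ g h)) ∞ volume ≤
        C * (lNorm 1 (γ + 2 - N) f ^ (1 - q / N) *
          lNorm (ENNReal.ofReal p) (γ + 2 - N) f ^ (q / N)) *
          (lNorm 1 (2 * γ + 1 - N) g * lNorm 1 (2 * γ + 1 - N) h) := by
  have hN3 : (3 : ℝ) ≤ N := by exact_mod_cast hN
  have hN0 : 0 < N := by omega
  have hp0 : 0 < p := by linarith
  have hpE : 1 < ENNReal.ofReal p := by rwa [ENNReal.one_lt_ofReal]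
  have hq : 1 - ((ENNReal.ofReal p)⁻¹).toReal = 1 / q := by
    rw [ENNReal.toReal_inv, ENNReal.toReal_ofReal hp0.le, ← one_div]
    linarith
  have hNq : 1 < (N : ℝ) * (1 / q) := by
    have h1 : 1 / q = 1 - 1 / p := by linarith
    rw [div_lt_iff₀ (by linarith)] at hNp
    rw [h1, show (N : ℝ) * (1 - 1 / p) = (N * (p - 1)) / p by field_simp, one_lt_div hp0]
    linarith
  have hθ : 1 / ((N : ℝ) * (1 / q)) = q / N := by field_simp
  obtain ⟨C, hC⟩ := exists_eLpNorm_lgain_lgain_le hN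
  obtain ⟨C₁, hC₁⟩ := exists_lintegral_riesz_le hN0 hpE zero_le_one (by rwa [hq])
  rw [hq, hθ] at hC₁
  set e := γ - (N - 2) with he
  have he0 : 0 ≤ e := by linarith
  have hx0 : 0 ≤ γ - 1 := by linarith
  refine ⟨C * (C₁ * 3 ^ e * 2 ^ (γ - 1)), fun f g h hf hg hh => ?_⟩
  rw [show γ + 2 - N = e by ring, show 2 * γ + 1 - N = γ - 1 + e by ring]
  set K := lNorm 1 e f ^ (1 - q / N) * lNorm (ENNReal.ofReal p) e f ^ (q / N)
  refine (hC γ (N - 2) (by linarith) (by linarith) le_rfl hγ ∞ (by simp) f g h hf hg hh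
    (fun q => C₁ * 3 ^ e * K * (wt q.1 * wt q.2) ^ e) (by fun_prop)
    fun φ hφ w ws => ?_).trans ?_
  · simp only [ENNReal.inv_top, ENNReal.toReal_zero, sub_zero, inv_one, ENNReal.rpow_one]
    have h1 := lintegral_mul_slabIntegral_le_mul (F := fun v => wt v ^ e * f v) (by fun_prop) hφ
      (hC₁ _ (by fun_prop)) w ws
    rw [← lNorm_one, mul_assoc (C₁ : ℝ≥0∞)] at h1
    calc _ ≤ ∫⁻ v₁, (3 ^ e * (wt w * wt ws) ^ e) *
          (wt v₁ ^ e * f v₁ * slabIntegral (-1) φ v₁ w ws) := by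
          refine lintegral_mono fun v₁ => ?_
          rw [show (N : ℝ) - 2 - (N - 1) = -1 by ring, ← he]
          refine (mul_le_mul_right (mul_le_mul_left
            (collision_radius_rpow_le he0 v₁ w ws) _) _).trans (le_of_eq ?_)
          ring
      _ = 3 ^ e * (wt w * wt ws) ^ e *
          ∫⁻ v₁, wt v₁ ^ e * f v₁ * slabIntegral (-1) φ v₁ w ws :=
          lintegral_const_mul _ (by fun_prop)
      _ ≤ 3 ^ e * (wt w * wt ws) ^ e * (C₁ * K * ∫⁻ v, φ v) := mul_le_mul_right h1 _
      _ = _ := by ring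
  · refine (mul_le_mul_right (lintegral_kernel_mul_wt_le _ hx0 he0 hg hh) _).trans (le_of_eq ?_)
    rw [ENNReal.coe_mul, ENNReal.coe_mul, ENNReal.coe_mul, ENNReal.coe_rpow_of_nonneg _ hx0,
      ENNReal.coe_rpow_of_nonneg _ he0, ENNReal.coe_ofNat, ENNReal.coe_ofNat]
    ring

/-! ### Reducing the real gain term with weight s to the unweighted one -/

theorem norm_sq_velPrime_add_norm_sq_velStarPrime {N : ℕ} (v vs : Vel N) (σ : USphere N) :
    ‖velPrime v vs σ‖ ^ 2 + ‖velStarPrime v vs σ‖ ^ 2 = ‖v‖ ^ 2 + ‖vs‖ ^ 2 := by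
  have h1 := parallelogram_law_with_norm ℝ ((1 / 2 : ℝ) • (v + vs)) ((‖v - vs‖ / 2) • (σ : Vel N))
  have h2 := parallelogram_law_with_norm ℝ v vs
  have hσ : ‖(σ : Vel N)‖ = 1 := by simp
  rw [norm_smul, norm_smul, hσ, Real.norm_of_nonneg (by norm_num),
    Real.norm_of_nonneg (by positivity)] at h1
  rw [velPrime, velStarPrime, h1]
  linarith

/-- By conservation of energy, (1+|v'|²)(1+|v'_*|²) ≥ 1 + |v'|² + |v'_*|² ≥ 1 + |v|². The constant 1
keeps the final bounds independent of s. -/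
theorem wt_le_velPrime_mul_velStarPrime {N : ℕ} (v vs : Vel N) (σ : USphere N) :
    wt v ≤ wt (velPrime v vs σ) * wt (velStarPrime v vs σ) := by
  have h := norm_sq_velPrime_add_norm_sq_velStarPrime v vs σ
  rw [wt, wt, wt, ← ENNReal.ofReal_mul (bracket_pos _).le, bracket, bracket, bracket,
    ← Real.sqrt_mul (by positivity)]
  refine ENNReal.ofReal_le_ofReal (Real.sqrt_le_sqrt ?_)
  nlinarith [sq_nonneg ‖vs‖, mul_nonneg (sq_nonneg ‖velPrime v vs σ‖)
    (sq_nonneg ‖velStarPrime v vs σ‖)]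

/-- The function `⟨v⟩^s |f(v)|`. -/
noncomputable def weighted {N : ℕ} (s : ℝ) (f : Vel N → ℝ) (v : Vel N) : ℝ≥0∞ := wt v ^ s * ‖f v‖ₑ

@[fun_prop]
theorem measurable_weighted {N : ℕ} (s : ℝ) {f : Vel N → ℝ} (hf : Measurable f) :
    Measurable (weighted s f) := by unfold weighted; fun_prop

theorem weighted_congr_ae {N : ℕ} (s : ℝ) {f g : Vel N → ℝ} (h : f =ᵐ[volume] g) :
    weighted s f =ᵐ[volume] weighted s g :=
  h.mono fun v hv => by simp only [weighted, hv]

theorem enorm_bracket_rpow_mul {N : ℕ} (s : ℝ) (f : Vel N → ℝ) (v : Vel N) :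
    ‖bracket v ^ s * f v‖ₑ = weighted s f v := by
  rw [enorm_mul, Real.enorm_of_nonneg (Real.rpow_nonneg (bracket_pos v).le _),
    ← ENNReal.ofReal_rpow_of_pos (bracket_pos v)]
  rfl

theorem wNorm_add {N : ℕ} (p : ℝ≥0∞) (s k : ℝ) (f : Vel N → ℝ) :
    wNorm p (s + k) f = lNorm p k (weighted s f) := by
  refine eLpNorm_congr_enorm_ae (.of_forall fun v => ?_)
  rw [enorm_bracket_rpow_mul, weighted, weighted, ← mul_assoc,
    ← ENNReal.rpow_add _ _ (wt_ne_zero v) (wt_ne_top v), add_comm k s, enorm_eq_self]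

theorem MemW.aemeasurable {N : ℕ} {p : ℝ≥0∞} {s : ℝ} {f : Vel N → ℝ} (hf : MemW p s f) :
    AEMeasurable f := by
  have h1 : AEMeasurable fun v : Vel N => bracket v ^ (-s) * (bracket v ^ s * f v) :=
    (measurable_bracket.pow_const _).aemeasurable.mul hf.1.aemeasurable
  refine h1.congr (.of_forall fun v => ?_)
  simp only
  rw [← mul_assoc, ← Real.rpow_add (bracket_pos v), neg_add_cancel, Real.rpow_zero, one_mul]

theorem MemW.lNorm_lt_top {N : ℕ} {p : ℝ≥0∞} {s k : ℝ} {f : Vel N → ℝ} (hf : MemW p (s + k) f) :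
    lNorm p k (weighted s f) < ∞ := by
  rw [← wNorm_add]; exact hf.2

theorem lgain_mono {N : ℕ} (γ : ℝ) (f : Vel N → ℝ≥0∞) {g g' : Vel N → ℝ≥0∞}
    (hg : ∀ v, g v ≤ g' v) (v : Vel N) : lgain γ f g v ≤ lgain γ f g' v :=
  lintegral_mono fun _ => lintegral_mono fun _ => mul_le_mul_right (hg _) _

theorem lgain_const_mul {N : ℕ} (γ : ℝ) (f g : Vel N → ℝ≥0∞) {c : ℝ≥0∞} (hc : c ≠ ∞) (v : Vel N) :
    lgain γ f (fun w => c * g w) v = c * lgain γ f g v := by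
  rw [lgain, lgain, ← lintegral_const_mul' _ _ hc]
  refine lintegral_congr fun vs => ?_
  rw [← lintegral_const_mul' _ _ hc]
  refine lintegral_congr fun σ => ?_
  ring

theorem inner_mem_Icc {N : ℕ} (z : Vel N) (σ : USphere N) :
    inner ℝ (‖z‖⁻¹ • z) (σ : Vel N) ∈ Icc (-1 : ℝ) 1 := by
  rw [mem_Icc, ← abs_le]
  refine (abs_real_inner_le_norm _ _).trans ?_
  rw [norm_smul, norm_inv, norm_norm, show ‖(σ : Vel N)‖ = 1 by simp, mul_one]
  exact inv_mul_le_one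

theorem enorm_collisionKernel_le {N : ℕ} {γ : ℝ} (hγ : 0 < γ) {b : ℝ → ℝ} (hb : IsBoundedAngular b)
    (z : Vel N) (σ : USphere N) :
    ‖collisionKernel γ b z σ‖ₑ ≤ ENNReal.ofReal (supNorm b) * ‖z‖ₑ ^ γ := by
  have hmem := inner_mem_Icc z σ
  rw [collisionKernel, enorm_mul, Real.enorm_rpow_of_nonneg (norm_nonneg z) hγ.le, enorm_norm,
    Real.enorm_of_nonneg (hb.2.1 _ hmem), mul_comm]
  gcongr
  exact le_csSup hb.2.2 (mem_image_of_mem _ hmem)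

theorem weight_mul_lintegral_gainIntegrand_le {N : ℕ} {γ : ℝ} (hγ : 0 < γ) {b : ℝ → ℝ}
    (hb : IsBoundedAngular b) {s : ℝ} (hs : 0 ≤ s) (f g : Vel N → ℝ) (v : Vel N) :
    wt v ^ s * ∫⁻ x, ‖gainIntegrand γ b f g v x‖ₑ ∂((volume : Measure (Vel N)).prod
      (sphereMeasure N)) ≤
      ENNReal.ofReal (supNorm b) * lgain γ (weighted s f) (weighted s g) v := by
  rw [lgain, ← lintegral_const_mul' _ _ ENNReal.ofReal_ne_top,
    ← lintegral_const_mul' _ _ (ENNReal.rpow_ne_top_of_nonneg hs (wt_ne_top v))]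
  refine (lintegral_prod_le _).trans (lintegral_mono fun vs => ?_)
  simp only
  rw [← lintegral_const_mul' _ _ ENNReal.ofReal_ne_top]
  refine lintegral_mono fun σ => ?_
  have h1 : wt v ^ s ≤ wt (velPrime v vs σ) ^ s * wt (velStarPrime v vs σ) ^ s := by
    rw [← ENNReal.mul_rpow_of_nonneg _ _ hs]
    exact ENNReal.rpow_le_rpow (wt_le_velPrime_mul_velStarPrime v vs σ) hs
  simp only [gainIntegrand, enorm_mul]
  calc _ ≤ (wt (velPrime v vs σ) ^ s * wt (velStarPrime v vs σ) ^ s) *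
        (ENNReal.ofReal (supNorm b) * ‖v - vs‖ₑ ^ γ * ‖f (velPrime v vs σ)‖ₑ *
          ‖g (velStarPrime v vs σ)‖ₑ) := by
        gcongr
        exact enorm_collisionKernel_le hγ hb _ _
    _ = _ := by simp only [weighted]; ring

theorem lintegral_gainIntegrand_le {N : ℕ} {γ : ℝ} (hγ : 0 < γ) {b : ℝ → ℝ}
    (hb : IsBoundedAngular b) {s : ℝ} (hs : 0 ≤ s) (f g : Vel N → ℝ) (v : Vel N) :
    ∫⁻ x, ‖gainIntegrand γ b f g v x‖ₑ ∂((volume : Measure (Vel N)).prod (sphereMeasure N)) ≤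
      ENNReal.ofReal (supNorm b) * lgain γ (weighted s f) (weighted s g) v :=
  (le_mul_of_one_le_left' ((ENNReal.one_rpow s).ge.trans (ENNReal.rpow_le_rpow (one_le_wt v) hs))).trans
    (weight_mul_lintegral_gainIntegrand_le hγ hb hs f g v)

theorem weighted_gain_le {N : ℕ} {γ : ℝ} (hγ : 0 < γ) {b : ℝ → ℝ}
    (hb : IsBoundedAngular b) {s : ℝ} (hs : 0 ≤ s) (f g : Vel N → ℝ) (v : Vel N) :
    weighted s (gain γ b f g) v ≤
      ENNReal.ofReal (supNorm b) * lgain γ (weighted s f) (weighted s g) v :=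
  (mul_le_mul_right (enorm_integral_le_lintegral_enorm _) _).trans
    (weight_mul_lintegral_gainIntegrand_le hγ hb hs f g v)

theorem lgain_weighted_gain_le {N : ℕ} {γ : ℝ} (hγ : 0 < γ) {b : ℝ → ℝ}
    (hb : IsBoundedAngular b) {s : ℝ} (hs : 0 ≤ s) (F : Vel N → ℝ≥0∞) (g h : Vel N → ℝ)
    (v : Vel N) : lgain γ F (weighted s (gain γ b g h)) v ≤
      ENNReal.ofReal (supNorm b) * lgain γ F (lgain γ (weighted s g) (weighted s h)) v := by
  rw [← lgain_const_mul _ _ _ ENNReal.ofReal_ne_top]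
  exact lgain_mono _ _ (weighted_gain_le hγ hb hs g h) v

/-! ### Measurability and independence of representatives -/

theorem measurable_gainIntegrand {N : ℕ} (γ : ℝ) {b : ℝ → ℝ} (hb : Measurable b)
    {f g : Vel N → ℝ} (hf : Measurable f) (hg : Measurable g) :
    Measurable fun q : Vel N × (Vel N × USphere N) => gainIntegrand γ b f g q.1 q.2 := by
  unfold gainIntegrand collisionKernel
  fun_prop

theorem measurable_gain {N : ℕ} (γ : ℝ) {b : ℝ → ℝ} (hb : Measurable b)
    {f g : Vel N → ℝ} (hf : Measurable f) (hg : Measurable g) : Measurable (gain γ b f g) :=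
  ((measurable_gainIntegrand γ hb hf hg).stronglyMeasurable.integral_prod_right').measurable

/-- Measure preservation pulls null sets back to null sets under the collision map. The gain term is
therefore defined on almost-everywhere classes, and Borel representatives may be used. -/
theorem ae_ae_velPrime {N : ℕ} (hN : 0 < N) {P : Vel N → Prop} (hP : ∀ᵐ v, P v) :
    ∀ᵐ v : Vel N, ∀ᵐ x ∂((volume : Measure (Vel N)).prod (sphereMeasure N)),
      P (velPrime v x.1 x.2) ∧ P (velStarPrime v x.1 x.2) := by
  set A := toMeasurable volume {v | ¬ P v}
  have hA : MeasurableSet A := measurableSet_toMeasurable _ _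
  have hA0 : volume A = 0 := by rw [measure_toMeasurable]; exact hP
  have hsub : ∀ v, v ∉ A → P v := fun v hv => by
    by_contra h
    exact hv (subset_toMeasurable _ _ h)
  let a : Vel N → ℝ≥0∞ := A.indicator 1
  have ha : Measurable a := measurable_one.indicator hA
  have hint : ∫⁻ v, a v = 0 := by
    rw [lintegral_indicator_one hA, hA0]
  have ha0 : ∀ᵐ v, a v = 0 := (lintegral_eq_zero_iff ha).1 hint
  have hswap := lintegral_collision_swap hN (F := fun p => a p.1 + a p.2.1) (by fun_prop)
  have hzero : ∫⁻ v : Vel N, ∫⁻ vs : Vel N, ∫⁻ _ : USphere N, (a v + a vs)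
      ∂(sphereMeasure N) = 0 := by
    rw [← lintegral_zero (μ := (volume : Measure (Vel N)))]
    refine lintegral_congr_ae (ha0.mono fun v hv => ?_)
    simp only
    rw [← lintegral_zero (μ := (volume : Measure (Vel N)))]
    refine lintegral_congr_ae (ha0.mono fun vs hvs => ?_)
    simp only [hv, hvs, add_zero, lintegral_const, zero_mul]
  rw [hzero] at hswap
  have hm : Measurable fun q : Vel N × (Vel N × USphere N) =>
    a (velPrime q.1 q.2.1 q.2.2) + a (velStarPrime q.1 q.2.1 q.2.2) := by fun_prop
  have hprod : ∫⁻ v : Vel N, ∫⁻ x, (a (velPrime v x.1 x.2) + a (velStarPrime v x.1 x.2))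
      ∂((volume : Measure (Vel N)).prod (sphereMeasure N)) = 0 := by
    rw [← hswap]
    refine lintegral_congr fun v => ?_
    exact lintegral_prod _ (Measurable.aemeasurable (by fun_prop))
  rw [lintegral_eq_zero_iff hm.lintegral_prod_right'] at hprod
  filter_upwards [hprod] with v hv
  have hv' : ∫⁻ x, (a (velPrime v x.1 x.2) + a (velStarPrime v x.1 x.2))
      ∂((volume : Measure (Vel N)).prod (sphereMeasure N)) = 0 := hv
  rw [lintegral_eq_zero_iff (by fun_prop)] at hv'
  filter_upwards [hv'] with x hx
  have hx' : a (velPrime v x.1 x.2) + a (velStarPrime v x.1 x.2) = 0 := hx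
  rw [add_eq_zero] at hx'
  refine ⟨hsub _ fun h => ?_, hsub _ fun h => ?_⟩
  · have := hx'.1
    simp only [a, indicator_of_mem h, Pi.one_apply, one_ne_zero] at this
  · have := hx'.2
    simp only [a, indicator_of_mem h, Pi.one_apply, one_ne_zero] at this

theorem gainIntegrand_congr_ae {N : ℕ} (hN : 0 < N) (γ : ℝ) (b : ℝ → ℝ) {f f' g g' : Vel N → ℝ}
    (hf : f =ᵐ[volume] f') (hg : g =ᵐ[volume] g') :
    ∀ᵐ v : Vel N, gainIntegrand γ b f g v =ᵐ[(volume : Measure (Vel N)).prod (sphereMeasure N)]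
      gainIntegrand γ b f' g' v := by
  filter_upwards [ae_ae_velPrime hN (hf.and hg)] with v hv
  filter_upwards [hv] with x hx
  simp only [gainIntegrand, hx.1.1, hx.2.2]

theorem gain_congr_ae {N : ℕ} (hN : 0 < N) (γ : ℝ) (b : ℝ → ℝ) {f f' g g' : Vel N → ℝ}
    (hf : f =ᵐ[volume] f') (hg : g =ᵐ[volume] g') :
    gain γ b f g =ᵐ[volume] gain γ b f' g' :=
  (gainIntegrand_congr_ae hN γ b hf hg).mono fun _ hv => integral_congr_ae hv

theorem GainConverges.congr {N : ℕ} (hN : 0 < N) {γ : ℝ} {b : ℝ → ℝ} {f f' g g' : Vel N → ℝ}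
    (h : GainConverges γ b f g) (hf : f =ᵐ[volume] f') (hg : g =ᵐ[volume] g') :
    GainConverges γ b f' g' := by
  filter_upwards [h, gainIntegrand_congr_ae hN γ b hf hg] with v h1 h2
  exact h1.congr h2

theorem IteratedGainEstimate.congr {N : ℕ} (hN : 0 < N) {γ : ℝ} {b : ℝ → ℝ} {p : ℝ≥0∞} {s : ℝ}
    {f f' g g' h h' : Vel N → ℝ} {R : ℝ≥0∞} (H : IteratedGainEstimate γ b p s f g h R)
    (hf : f =ᵐ[volume] f') (hg : g =ᵐ[volume] g') (hh : h =ᵐ[volume] h') :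
    IteratedGainEstimate γ b p s f' g' h' R := by
  have h1 := gain_congr_ae hN γ b hg hh
  have h2 : (fun v => bracket v ^ s * gain γ b f (gain γ b g h) v) =ᵐ[volume]
      fun v => bracket v ^ s * gain γ b f' (gain γ b g' h') v :=
    (gain_congr_ae hN γ b hf h1).mono fun v hv => by simp only [hv]
  refine ⟨H.1.congr hN hg hh, H.2.1.congr hN hf h1, H.2.2.1.ae_eq h2, ?_⟩
  have := H.2.2.2
  rwa [wNorm, eLpNorm_congr_ae h2] at this

/-! ### Absolute convergence and transfer of the estimates -/

theorem ae_lt_top_of_eLpNorm_lt_top {α : Type*} [MeasurableSpace α] {μ : Measure α} {p : ℝ≥0∞}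
    (hp : p ≠ 0) {F : α → ℝ≥0∞} (hF : Measurable F) (h : eLpNorm F p μ < ∞) :
    ∀ᵐ x ∂μ, F x < ∞ := by
  rcases eq_or_ne p ∞ with rfl | hpt
  · rw [eLpNorm_exponent_top] at h
    exact (enorm_ae_le_eLpNormEssSup F μ).mono fun x hx => hx.trans_lt h
  · have h1 := (eLpNorm_lt_top_iff_lintegral_rpow_enorm_lt_top hp hpt).1 h
    have hp0 := ENNReal.toReal_pos hp hpt
    filter_upwards [ae_lt_top (by fun_prop) h1.ne] with x hx
    simpa [hp0, ENNReal.rpow_lt_top_iff_of_pos hp0] using hx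

/-- If c is the indicator of {G = ∞}, then nc ≤ G for every n, so finiteness forces the gain of F
and c to vanish almost everywhere. Its total integral has a kernel positive off the diagonal, and F
never vanishes, so c = 0 almost everywhere. -/
theorem ae_lt_top_of_lgain_lt_top {N : ℕ} (hN : 2 ≤ N) (γ : ℝ) {F G : Vel N → ℝ≥0∞}
    (hF : Measurable F) (hG : Measurable G) (hF0 : ∀ v, F v ≠ 0)
    (h : ∀ᵐ v, lgain γ F G v < ∞) : ∀ᵐ v, G v < ∞ := by
  have hN0 : 0 < N := by omega
  have : Nonempty (Fin N) := ⟨⟨0, hN0⟩⟩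
  have : Nontrivial (Vel N) := inferInstance
  set S : Set (Vel N) := {v | G v = ∞}
  have hS : MeasurableSet S := hG (measurableSet_singleton ∞)
  let c : Vel N → ℝ≥0∞ := S.indicator 1
  have hc : Measurable c := measurable_one.indicator hS
  have hcG : ∀ (n : ℕ) v, (n : ℝ≥0∞) * c v ≤ G v := fun n v => by
    by_cases hv : v ∈ S
    · rw [show G v = ∞ from hv]; exact le_top
    · simp [c, indicator_of_notMem hv]
  have h0 : ∀ᵐ v, lgain γ F c v = 0 := by
    filter_upwards [h] with v hv
    by_contra hne
    obtain ⟨n, hn⟩ := ENNReal.exists_nat_mul_gt hne hv.ne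
    refine absurd hn (not_lt.2 ?_)
    rw [← lgain_const_mul _ _ _ (ENNReal.natCast_ne_top n)]
    exact lgain_mono _ _ (hcG n) v
  have h1 : ∫⁻ v, lgain γ F c v * 1 = 0 := by
    simp only [mul_one]
    rw [lintegral_eq_zero_iff (measurable_lgain γ hF hc)]
    exact h0
  rw [lintegral_lgain_mul hN0 γ hF hc (φ := fun _ => 1) measurable_const] at h1
  simp only [lintegral_const, one_mul] at h1
  have hm : Measurable fun q : Vel N × Vel N =>
    F q.1 * c q.2 * (‖q.1 - q.2‖ₑ ^ γ * sphereMeasure N univ) := by fun_prop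
  rw [lintegral_eq_zero_iff hm.lintegral_prod_right'] at h1
  obtain ⟨v, hv⟩ := h1.exists
  have hv' : ∫⁻ vs, F v * c vs * (‖v - vs‖ₑ ^ γ * sphereMeasure N univ) = 0 := hv
  rw [lintegral_eq_zero_iff (by fun_prop)] at hv'
  have hne : ∀ᵐ vs : Vel N, vs ≠ v := by
    simp [ae_iff]
  filter_upwards [hv', hne] with vs h2 h3
  refine lt_top_iff_ne_top.2 fun h4 => ?_
  have hpos : ‖v - vs‖ₑ ≠ 0 := by
    rw [enorm_ne_zero, sub_ne_zero]; exact h3.symm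
  have hsph : sphereMeasure N univ ≠ 0 := by
    rw [Measure.measure_univ_ne_zero]
    exact Measure.toSphere_ne_zero _
  have h2' : F v * c vs * (‖v - vs‖ₑ ^ γ * sphereMeasure N univ) = 0 := h2
  have hc1 : c vs = 1 := by simp [c, indicator_of_mem (show vs ∈ S from h4)]
  rw [hc1, mul_one, mul_eq_zero, mul_eq_zero] at h2'
  rcases h2' with h5 | h5 | h5
  · exact hF0 v h5
  · exact (ENNReal.rpow_pos (pos_iff_ne_zero.2 hpos) enorm_ne_top).ne' h5
  · exact hsph h5

theorem iteratedGainEstimate_of_measurable {N : ℕ} (hN : 2 ≤ N) {γ : ℝ} (hγ : 0 < γ) {b : ℝ → ℝ}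
    (hb : IsBoundedAngular b) {p : ℝ≥0∞} (hp : 1 < p) {s : ℝ} (hs : 0 ≤ s) {f g h : Vel N → ℝ}
    (hf : Measurable f) (hg : Measurable g) (hh : Measurable h) {R : ℝ≥0∞} (hR : R < ∞)
    (hle : eLpNorm (lgain γ (weighted s f) (lgain γ (weighted s g) (weighted s h))) p volume ≤ R)
    {F : Vel N → ℝ≥0∞} (hF : Measurable F) (hF0 : ∀ v, F v ≠ 0)
    (hFle : eLpNorm (lgain γ F (lgain γ (weighted s g) (weighted s h))) p volume < ∞) :
    IteratedGainEstimate γ b p s f g h (ENNReal.ofReal (supNorm b) ^ 2 * R) := by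
  have hp0 : p ≠ 0 := (zero_lt_one.trans hp).ne'
  have hGm : Measurable (lgain γ (weighted s g) (weighted s h)) :=
    measurable_lgain γ (by fun_prop) (by fun_prop)
  have hgh := measurable_gain γ hb.1 hg hh
  have hconv : ∀ {u w : Vel N → ℝ}, Measurable u → Measurable w →
      (∀ᵐ v, lgain γ (weighted s u) (weighted s w) v < ∞) → GainConverges γ b u w :=
    fun hu hw hlt => by
      filter_upwards [hlt] with v hv
      refine ⟨((measurable_gainIntegrand γ hb.1 hu hw).comp
        measurable_prodMk_left).aestronglyMeasurable, ?_⟩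
      exact (lintegral_gainIntegrand_le hγ hb hs _ _ v).trans_lt
        (ENNReal.mul_lt_top ENNReal.ofReal_lt_top hv)
  have hpt : ∀ v, ‖bracket v ^ s * gain γ b f (gain γ b g h) v‖ₑ ≤
      ((Real.toNNReal (supNorm b) ^ 2 : ℝ≥0) : ℝ≥0∞) *
        ‖lgain γ (weighted s f) (lgain γ (weighted s g) (weighted s h)) v‖ₑ := fun v => by
    rw [enorm_bracket_rpow_mul, enorm_eq_self, ENNReal.coe_pow, sq, mul_assoc]
    exact (weighted_gain_le hγ hb hs _ _ v).trans
      (mul_le_mul_right (lgain_weighted_gain_le hγ hb hs _ g h v) _)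
  have hnorm : wNorm p s (gain γ b f (gain γ b g h)) ≤ ENNReal.ofReal (supNorm b) ^ 2 * R := by
    refine (eLpNorm_le_nnreal_smul_eLpNorm_of_ae_le_mul' (.of_forall hpt) p).trans ?_
    rw [ENNReal.smul_def, smul_eq_mul, ENNReal.coe_pow]
    exact mul_le_mul_right hle _
  refine ⟨hconv hg hh ?_, hconv hf hgh ?_, ⟨?_, ?_⟩, hnorm⟩
  · exact ae_lt_top_of_lgain_lt_top hN γ hF hGm hF0
      (ae_lt_top_of_eLpNorm_lt_top hp0 (measurable_lgain γ hF hGm) hFle)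
  · filter_upwards [ae_lt_top_of_eLpNorm_lt_top hp0
      (measurable_lgain γ (by fun_prop) hGm) (hle.trans_lt hR)] with v hv
    exact (lgain_weighted_gain_le hγ hb hs _ g h v).trans_lt
      (ENNReal.mul_lt_top ENNReal.ofReal_lt_top hv)
  · exact ((measurable_bracket.pow_const s).mul
      (measurable_gain γ hb.1 hf hgh)).aestronglyMeasurable
  · exact hnorm.trans_lt (ENNReal.mul_lt_top (ENNReal.pow_lt_top ENNReal.ofReal_lt_top) hR)

/-- All five estimates have the shape C · X(f) · Y(g, h); separating X makes it possible to insert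
the auxiliary F for f while keeping g and h. -/
theorem iteratedGainEstimate_of_lgain {N : ℕ} (hN : 2 ≤ N) {γ : ℝ} (hγ : 0 < γ)
    {p : ℝ≥0∞} (hp : 1 < p) {C : ℝ≥0} {X : (Vel N → ℝ≥0∞) → ℝ≥0∞}
    {Y : (Vel N → ℝ≥0∞) → (Vel N → ℝ≥0∞) → ℝ≥0∞}
    (hX : ∀ f f', f =ᵐ[volume] f' → X f = X f')
    (hY : ∀ g g' h h', g =ᵐ[volume] g' → h =ᵐ[volume] h' → Y g h = Y g' h')
    (hC : ∀ f g h : Vel N → ℝ≥0∞, Measurable f → Measurable g → Measurable h →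
      eLpNorm (lgain γ f (lgain γ g h)) p volume ≤ C * X f * Y g h)
    {F : Vel N → ℝ≥0∞} (hF : Measurable F) (hF0 : ∀ v, F v ≠ 0) (hXF : X F < ∞) {b : ℝ → ℝ}
    (hb : IsBoundedAngular b) {s : ℝ} (hs : 0 ≤ s) {f g h : Vel N → ℝ}
    (hf : AEMeasurable f) (hg : AEMeasurable g) (hh : AEMeasurable h)
    (hXf : X (weighted s f) < ∞) (hYgh : Y (weighted s g) (weighted s h) < ∞) :
    IteratedGainEstimate γ b p s f g h
      (ENNReal.ofReal (supNorm b) ^ 2 * (C * X (weighted s f) * Y (weighted s g) (weighted s h))) := by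
  have hf' := hf.ae_eq_mk
  have hg' := hg.ae_eq_mk
  have hh' := hh.ae_eq_mk
  have hfm := hf.measurable_mk
  have hgm := hg.measurable_mk
  have hhm := hh.measurable_mk
  rw [hX _ _ (weighted_congr_ae s hf')] at hXf ⊢
  rw [hY _ _ _ _ (weighted_congr_ae s hg') (weighted_congr_ae s hh')] at hYgh ⊢
  refine (iteratedGainEstimate_of_measurable hN hγ hb hp hs hfm hgm hhm
    (ENNReal.mul_lt_top (ENNReal.mul_lt_top ENNReal.coe_lt_top hXf) hYgh)
    (hC _ _ _ (by fun_prop) (by fun_prop) (by fun_prop)) hF hF0 ?_).congr (by omega)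
    hf'.symm hg'.symm hh'.symm
  exact (hC _ _ _ hF (by fun_prop) (by fun_prop)).trans_lt
    (ENNReal.mul_lt_top (ENNReal.mul_lt_top ENNReal.coe_lt_top hXF) hYgh)

theorem lNorm_congr_ae {N : ℕ} (p : ℝ≥0∞) (k : ℝ) {F G : Vel N → ℝ≥0∞} (h : F =ᵐ[volume] G) :
    lNorm p k F = lNorm p k G :=
  eLpNorm_congr_ae (h.mono fun v hv => by simp only [hv])

theorem eLpNorm_lt_top_of_le_one {α : Type*} [MeasurableSpace α] {μ : Measure α} {p : ℝ≥0∞}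
    (hp : 1 ≤ p) {F : α → ℝ≥0∞} (hF : ∀ x, F x ≤ 1) (h : ∫⁻ x, F x ∂μ < ∞) :
    eLpNorm F p μ < ∞ := by
  rcases eq_or_ne p ∞ with rfl | hpt
  · rw [eLpNorm_exponent_top]
    exact (essSup_le_of_ae_le 1 (.of_forall hF)).trans_lt ENNReal.one_lt_top
  · have hp0 : p ≠ 0 := (zero_lt_one.trans_le hp).ne'
    rw [eLpNorm_lt_top_iff_lintegral_rpow_enorm_lt_top hp0 hpt]
    refine (lintegral_mono fun x => ?_).trans_lt h
    have : 1 ≤ p.toReal := by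
      rw [← ENNReal.toReal_one]; exact ENNReal.toReal_mono hpt hp
    simpa using ENNReal.rpow_le_rpow_of_exponent_ge (hF x) this

/-- The positive auxiliary function for the convergence argument. Weighted by ⟨v⟩^e it becomes
⟨v⟩^(-(N+1)), which is integrable and at most 1, so it lies in every L^p. -/
theorem lNorm_wt_rpow_lt_top {N : ℕ} {p : ℝ≥0∞} (hp : 1 ≤ p) (e : ℝ) :
    lNorm p e (fun v : Vel N => wt v ^ (-(e + N + 1))) < ∞ := by
  have heq : ∀ v : Vel N, wt v ^ e * wt v ^ (-(e + N + 1)) =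
      ENNReal.ofReal ((1 + ‖v‖ ^ 2) ^ (-((N : ℝ) + 1) / 2)) := fun v => by
    rw [← ENNReal.rpow_add _ _ (wt_ne_zero v) (wt_ne_top v), wt,
      ENNReal.ofReal_rpow_of_pos (bracket_pos v), bracket, Real.sqrt_eq_rpow,
      ← Real.rpow_mul (by positivity)]
    congr 2
    ring
  unfold lNorm
  simp only [heq]
  refine eLpNorm_lt_top_of_le_one hp (fun v => ?_) ?_
  · rw [ENNReal.ofReal_le_one]
    exact Real.rpow_le_one_of_one_le_of_nonpos (by linarith [sq_nonneg ‖v‖])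
      (by have := Nat.cast_nonneg (α := ℝ) N; linarith)
  · have hint : Integrable (fun v : Vel N => (1 + ‖v‖ ^ 2) ^ (-((N : ℝ) + 1) / 2)) :=
      integrable_rpow_neg_one_add_norm_sq (by simp)
    exact hint.lintegral_lt_top

theorem wt_rpow_ne_zero {N : ℕ} (e : ℝ) (v : Vel N) : wt v ^ e ≠ 0 :=
  (ENNReal.rpow_pos (pos_iff_ne_zero.2 (wt_ne_zero v)) (wt_ne_top v)).ne'

/-! ### The five weighted estimates -/

theorem exists_iteratedGainEstimate_lOne {N : ℕ} (hN : 3 ≤ N) {γ : ℝ} (hγ0 : 0 < γ)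
    (hγ : γ < (N : ℝ) - 2) :
    ∃ C : ℝ≥0, ∀ b : ℝ → ℝ, IsBoundedAngular b → ∀ s : ℝ, 0 ≤ s →
      ∀ f g h : Vel N → ℝ, MemW 1 s f → MemW 1 (s + γ) g → MemW 1 (s + γ) h →
        IteratedGainEstimate γ b (stepExponent N γ 1) s f g h
          (C * ENNReal.ofReal (supNorm b) ^ 2 * wNorm 1 s f *
            wNorm 1 (s + γ) g * wNorm 1 (s + γ) h) := by
  obtain ⟨C, hC⟩ := exists_eLpNorm_lgain_lgain_le_of_lOne hN hγ0 hγ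
  refine ⟨C, fun b hb s hs f g h hf hg hh => ?_⟩
  rw [← add_zero s] at hf
  have key := iteratedGainEstimate_of_lgain (by omega) hγ0 (one_lt_stepExponent hN hγ0 le_rfl)
    (X := lNorm 1 0) (Y := fun g h => lNorm 1 γ g * lNorm 1 γ h)
    (fun _ _ h => lNorm_congr_ae _ _ h)
    (fun _ _ _ _ h h' => by rw [lNorm_congr_ae _ _ h, lNorm_congr_ae _ _ h'])
    hC (measurable_wt.pow_const _) (wt_rpow_ne_zero _) (lNorm_wt_rpow_lt_top le_rfl 0) hb hs
    hf.aemeasurable hg.aemeasurable hh.aemeasurable hf.lNorm_lt_top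
    (ENNReal.mul_lt_top hg.lNorm_lt_top hh.lNorm_lt_top)
  convert key using 1
  rw [← wNorm_add, ← wNorm_add, ← wNorm_add, add_zero]
  ring

theorem stepTheta_mem {N n : ℕ} (hN : 3 ≤ N) : 0 ≤ stepTheta N n ∧ stepTheta N n ≤ 1 := by
  have hN3 : (3 : ℝ) ≤ N := by exact_mod_cast hN
  have h1 : 1 / (N : ℝ) ≤ 1 := by rw [div_le_one (by linarith)]; linarith
  have h2 : max (1 - ((N : ℝ) - 2) / n) 0 ≤ 1 :=
    max_le (by linarith [div_nonneg (by linarith : 0 ≤ (N : ℝ) - 2) (Nat.cast_nonneg n)])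
      zero_le_one
  exact ⟨by unfold stepTheta; positivity, mul_le_one₀ h1 (le_max_right _ _) h2⟩

theorem exists_iteratedGainEstimate_step {N : ℕ} (hN : 3 ≤ N) {γ : ℝ} (hγ0 : 0 < γ)
    (hγ : γ < (N : ℝ) - 2) {n : ℕ} (hn : 1 ≤ n) (hn1 : n + 1 ≤ numSteps N γ) :
    ∃ C : ℝ≥0, ∀ b : ℝ → ℝ, IsBoundedAngular b → ∀ s : ℝ, 0 ≤ s →
      ∀ f g h : Vel N → ℝ, MemW (stepExponent N γ n) (s + 1) f → MemW 1 (s + max γ 1) g →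
        MemW 1 (s + max γ 1) h → MemW (stepExponent N γ n) (s + max γ 1) h →
        IteratedGainEstimate γ b (stepExponent N γ (n + 1)) s f g h
          (C * ENNReal.ofReal (supNorm b) ^ 2 * wNorm (stepExponent N γ n) (s + 1) f *
            wNorm 1 (s + max γ 1) g * wNorm 1 (s + max γ 1) h ^ (1 - stepTheta N n) *
            wNorm (stepExponent N γ n) (s + max γ 1) h ^ stepTheta N n) := by
  obtain ⟨C, hC⟩ := exists_eLpNorm_lgain_lgain_le_of_step hN hγ0 hγ hn hn1
  have hθ := stepTheta_mem (n := n) hN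
  have hP := one_lt_stepExponent hN hγ0 hn
  refine ⟨C, fun b hb s hs f g h hf hg hh hhP => ?_⟩
  have key := iteratedGainEstimate_of_lgain (by omega) hγ0
    (one_lt_stepExponent hN hγ0 (Nat.le_add_left 1 n))
    (X := lNorm (stepExponent N γ n) 1)
    (Y := fun g h => lNorm 1 (max γ 1) g * (lNorm 1 (max γ 1) h ^ (1 - stepTheta N n) *
      lNorm (stepExponent N γ n) (max γ 1) h ^ stepTheta N n))
    (fun _ _ h => lNorm_congr_ae _ _ h)
    (fun _ _ _ _ h h' => by
      rw [lNorm_congr_ae _ _ h, lNorm_congr_ae _ _ h', lNorm_congr_ae _ _ h'])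
    hC (measurable_wt.pow_const _) (wt_rpow_ne_zero _) (lNorm_wt_rpow_lt_top hP.le 1) hb hs
    hf.aemeasurable hg.aemeasurable hh.aemeasurable hf.lNorm_lt_top
    (ENNReal.mul_lt_top hg.lNorm_lt_top (ENNReal.mul_lt_top
      (ENNReal.rpow_lt_top_of_nonneg (by linarith [hθ.2]) hh.lNorm_lt_top.ne)
      (ENNReal.rpow_lt_top_of_nonneg hθ.1 hhP.lNorm_lt_top.ne)))
  convert key using 1
  simp only [← wNorm_add]
  ring

theorem exists_iteratedGainEstimate_top {N : ℕ} (hN : 3 ≤ N) {γ : ℝ} (hγ0 : 0 < γ)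
    (hγ : γ < (N : ℝ) - 2) :
    ∃ C : ℝ≥0, ∀ b : ℝ → ℝ, IsBoundedAngular b → ∀ s : ℝ, 0 ≤ s →
      ∀ f g h : Vel N → ℝ,
        MemW 1 s f → MemW (stepExponent N γ (numSteps N γ)) s f →
        MemW 1 (s + max (γ - 1) 0) g →
        MemW 1 (s + max (γ - 1) 0) h → MemW (stepExponent N γ (numSteps N γ)) s h →
        IteratedGainEstimate γ b ∞ s f g h
          (C * ENNReal.ofReal (supNorm b) ^ 2 *
            wNorm 1 s f ^ (1 - alphaOne N γ) *
            wNorm (stepExponent N γ (numSteps N γ)) s f ^ alphaOne N γ *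
            wNorm 1 (s + max (γ - 1) 0) g *
            wNorm 1 (s + max (γ - 1) 0) h ^ (1 - alphaTwo N γ) *
            wNorm (stepExponent N γ (numSteps N γ)) s h ^ alphaTwo N γ) := by
  obtain ⟨C, hC⟩ := exists_eLpNorm_lgain_lgain_le_top hN hγ0 hγ
  have hα₁ := alphaOne_mem hN hγ0 hγ
  have hα₂ := alphaTwo_mem hN hγ0 hγ
  have hP := one_lt_stepExponent hN hγ0 (one_le_numSteps hγ0 hγ)
  set P := stepExponent N γ (numSteps N γ)
  refine ⟨C, fun b hb s hs f g h hf hfP hg hh hhP => ?_⟩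
  rw [← add_zero s] at hf hfP hhP
  have hfin : ∀ {F : Vel N → ℝ≥0∞}, lNorm 1 0 F < ∞ → lNorm P 0 F < ∞ →
      lNorm 1 0 F ^ (1 - alphaOne N γ) * lNorm P 0 F ^ alphaOne N γ < ∞ := fun h1 h2 =>
    ENNReal.mul_lt_top (ENNReal.rpow_lt_top_of_nonneg (by linarith [hα₁.2]) h1.ne)
      (ENNReal.rpow_lt_top_of_nonneg hα₁.1.le h2.ne)
  have key := iteratedGainEstimate_of_lgain (by omega) hγ0 ENNReal.one_lt_top
    (X := fun f => lNorm 1 0 f ^ (1 - alphaOne N γ) * lNorm P 0 f ^ alphaOne N γ)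
    (Y := fun g h => lNorm 1 (max (γ - 1) 0) g *
      (lNorm 1 (max (γ - 1) 0) h ^ (1 - alphaTwo N γ) * lNorm P 0 h ^ alphaTwo N γ))
    (fun _ _ h => by rw [lNorm_congr_ae _ _ h, lNorm_congr_ae _ _ h])
    (fun _ _ _ _ h h' => by
      rw [lNorm_congr_ae _ _ h, lNorm_congr_ae _ _ h', lNorm_congr_ae _ _ h'])
    hC (measurable_wt.pow_const _) (wt_rpow_ne_zero _)
    (hfin (lNorm_wt_rpow_lt_top le_rfl 0) (lNorm_wt_rpow_lt_top hP.le 0)) hb hs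
    hf.aemeasurable hg.aemeasurable hh.aemeasurable (hfin hf.lNorm_lt_top hfP.lNorm_lt_top)
    (ENNReal.mul_lt_top hg.lNorm_lt_top (ENNReal.mul_lt_top
      (ENNReal.rpow_lt_top_of_nonneg (by linarith [hα₂.2]) hh.lNorm_lt_top.ne)
      (ENNReal.rpow_lt_top_of_nonneg hα₂.1 hhP.lNorm_lt_top.ne)))
  convert key using 1
  simp only [← wNorm_add, add_zero]
  ring

theorem exists_iteratedGainEstimate_hard {N : ℕ} (hN : 3 ≤ N) {γ : ℝ}
    (hγ : (N : ℝ) - 2 ≤ γ) {p q : ℝ} (hp : 1 < p) (hpN : p < N) (hpq : 1 / p + 1 / q = 1) :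
    ∃ C : ℝ≥0, ∀ b : ℝ → ℝ, IsBoundedAngular b → ∀ s : ℝ, 0 ≤ s →
      ∀ f g h : Vel N → ℝ,
        MemW 1 (s + 2 * γ - N / q) f → MemW 1 (s + 2 * γ - N / q) g →
        MemW 1 (s + 2 * γ - N / q) h →
        IteratedGainEstimate γ b (ENNReal.ofReal p) s f g h
          (C * ENNReal.ofReal (supNorm b) ^ 2 *
            wNorm 1 (s + 2 * γ - N / q) f * wNorm 1 (s + 2 * γ - N / q) g *
            wNorm 1 (s + 2 * γ - N / q) h) := by
  have hN3 : (3 : ℝ) ≤ N := by exact_mod_cast hN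
  obtain ⟨C, hC⟩ := exists_eLpNorm_lgain_lgain_le_of_hard hN hγ hp hpN hpq
  refine ⟨C, fun b hb s hs f g h hf hg hh => ?_⟩
  rw [add_sub_assoc] at hf hg hh ⊢
  have key := iteratedGainEstimate_of_lgain (γ := γ) (by omega) (by linarith)
    (ENNReal.one_lt_ofReal.2 hp)
    (X := lNorm 1 (2 * γ - N / q))
    (Y := fun g h => lNorm 1 (2 * γ - N / q) g * lNorm 1 (2 * γ - N / q) h)
    (fun _ _ h => lNorm_congr_ae _ _ h)
    (fun _ _ _ _ h h' => by rw [lNorm_congr_ae _ _ h, lNorm_congr_ae _ _ h'])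
    hC (measurable_wt.pow_const _) (wt_rpow_ne_zero _) (lNorm_wt_rpow_lt_top le_rfl _) hb hs
    hf.aemeasurable hg.aemeasurable hh.aemeasurable hf.lNorm_lt_top
    (ENNReal.mul_lt_top hg.lNorm_lt_top hh.lNorm_lt_top)
  convert key using 1
  simp only [← wNorm_add]
  ring

theorem exists_iteratedGainEstimate_top_hard {N : ℕ} (hN : 3 ≤ N) {γ : ℝ}
    (hγ : (N : ℝ) - 2 ≤ γ) {p q : ℝ} (hp : 1 < p) (hpq : 1 / p + 1 / q = 1)
    (hNp : (N : ℝ) / (N - 1) < p) :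
    ∃ C : ℝ≥0, ∀ b : ℝ → ℝ, IsBoundedAngular b → ∀ s : ℝ, 0 ≤ s →
      ∀ f g h : Vel N → ℝ,
        MemW 1 (s + γ + 2 - N) f → MemW (ENNReal.ofReal p) (s + γ + 2 - N) f →
        MemW 1 (s + 2 * γ + 1 - N) g → MemW 1 (s + 2 * γ + 1 - N) h →
        IteratedGainEstimate γ b ∞ s f g h
          (C * ENNReal.ofReal (supNorm b) ^ 2 *
            wNorm 1 (s + γ + 2 - N) f ^ (1 - q / N) *
            wNorm (ENNReal.ofReal p) (s + γ + 2 - N) f ^ (q / N) *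
            wNorm 1 (s + 2 * γ + 1 - N) g * wNorm 1 (s + 2 * γ + 1 - N) h) := by
  have hN3 : (3 : ℝ) ≤ N := by exact_mod_cast hN
  have hp0 : 0 < p := by linarith
  have hpE := ENNReal.one_lt_ofReal.2 hp
  have h1q : 1 / q = (p - 1) / p := by field_simp at hpq ⊢; linarith
  have hq0 : 0 < q := by
    rw [← one_div_pos, h1q]; exact div_pos (by linarith) hp0
  -- The condition p > N/(N-1) says q < N, which keeps both interpolation exponents nonnegative and
  -- the right-hand side finite.
  have hqN : q / N ≤ 1 := by
    have hqe : q = p / (p - 1) := by rw [← one_div_one_div q, h1q, one_div_div]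
    rw [div_lt_iff₀ (by linarith)] at hNp
    rw [div_le_one (by linarith), hqe, div_le_iff₀ (by linarith)]
    linarith
  have hqN0 : 0 ≤ q / N := by positivity
  obtain ⟨C, hC⟩ := exists_eLpNorm_lgain_lgain_le_top_of_hard hN hγ hp hpq hNp
  refine ⟨C, fun b hb s hs f g h hf hfp hg hh => ?_⟩
  rw [show s + γ + 2 - N = s + (γ + 2 - N) by ring] at hf hfp ⊢
  rw [show s + 2 * γ + 1 - N = s + (2 * γ + 1 - N) by ring] at hg hh ⊢
  have hfin : ∀ {F : Vel N → ℝ≥0∞}, lNorm 1 (γ + 2 - N) F < ∞ →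
      lNorm (ENNReal.ofReal p) (γ + 2 - N) F < ∞ →
      lNorm 1 (γ + 2 - N) F ^ (1 - q / N) *
        lNorm (ENNReal.ofReal p) (γ + 2 - N) F ^ (q / N) < ∞ := fun h1 h2 =>
    ENNReal.mul_lt_top (ENNReal.rpow_lt_top_of_nonneg (by linarith) h1.ne)
      (ENNReal.rpow_lt_top_of_nonneg hqN0 h2.ne)
  have key := iteratedGainEstimate_of_lgain (γ := γ) (by omega) (by linarith) ENNReal.one_lt_top
    (X := fun f => lNorm 1 (γ + 2 - N) f ^ (1 - q / N) *
        lNorm (ENNReal.ofReal p) (γ + 2 - N) f ^ (q / N))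
    (Y := fun g h => lNorm 1 (2 * γ + 1 - N) g * lNorm 1 (2 * γ + 1 - N) h)
    (fun _ _ h => by rw [lNorm_congr_ae _ _ h, lNorm_congr_ae _ _ h])
    (fun _ _ _ _ h h' => by rw [lNorm_congr_ae _ _ h, lNorm_congr_ae _ _ h'])
    hC (measurable_wt.pow_const _) (wt_rpow_ne_zero _)
    (hfin (lNorm_wt_rpow_lt_top le_rfl _) (lNorm_wt_rpow_lt_top hpE.le _)) hb hs
    hf.aemeasurable hg.aemeasurable hh.aemeasurable (hfin hf.lNorm_lt_top hfp.lNorm_lt_top)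
    (ENNReal.mul_lt_top hg.lNorm_lt_top hh.lNorm_lt_top)
  convert key using 1
  simp only [← wNorm_add]
  ring

theorem theorem2p7 (N : ℕ) (hN : 3 ≤ N) (γ : ℝ) :
    -- Part (i)
    (0 < γ → γ < (N : ℝ) - 2 →
      (∀ n : ℕ, 1 ≤ n → n ≤ numSteps N γ →
        (n : ℝ) * γ ≤ (N : ℝ) - 1 ∧ 1 < stepExponent N γ n) ∧
      -- (a)
      (∃ C : ℝ≥0, ∀ b : ℝ → ℝ, IsBoundedAngular b → ∀ s : ℝ, 0 ≤ s →
        ∀ f g h : Vel N → ℝ,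
          MemW 1 s f → MemW 1 (s + γ) g → MemW 1 (s + γ) h →
          IteratedGainEstimate γ b (stepExponent N γ 1) s f g h
            (C * ENNReal.ofReal (supNorm b) ^ 2 * wNorm 1 s f *
              wNorm 1 (s + γ) g * wNorm 1 (s + γ) h)) ∧
      -- (b)
      (∀ n : ℕ, 1 ≤ n → n + 1 ≤ numSteps N γ →
        ∃ C : ℝ≥0, ∀ b : ℝ → ℝ, IsBoundedAngular b → ∀ s : ℝ, 0 ≤ s →
          ∀ f g h : Vel N → ℝ,
            MemW (stepExponent N γ n) (s + 1) f →
            MemW 1 (s + max γ 1) g →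
            MemW 1 (s + max γ 1) h → MemW (stepExponent N γ n) (s + max γ 1) h →
            IteratedGainEstimate γ b (stepExponent N γ (n + 1)) s f g h
              (C * ENNReal.ofReal (supNorm b) ^ 2 *
                wNorm (stepExponent N γ n) (s + 1) f *
                wNorm 1 (s + max γ 1) g *
                wNorm 1 (s + max γ 1) h ^ (1 - stepTheta N n) *
                wNorm (stepExponent N γ n) (s + max γ 1) h ^ stepTheta N n)) ∧
      -- (c)
      (0 < alphaOne N γ ∧ alphaOne N γ < 1 ∧ 0 ≤ alphaTwo N γ ∧ alphaTwo N γ < 1) ∧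
      (∃ C : ℝ≥0, ∀ b : ℝ → ℝ, IsBoundedAngular b → ∀ s : ℝ, 0 ≤ s →
        ∀ f g h : Vel N → ℝ,
          MemW 1 s f → MemW (stepExponent N γ (numSteps N γ)) s f →
          MemW 1 (s + max (γ - 1) 0) g →
          MemW 1 (s + max (γ - 1) 0) h → MemW (stepExponent N γ (numSteps N γ)) s h →
          IteratedGainEstimate γ b ∞ s f g h
            (C * ENNReal.ofReal (supNorm b) ^ 2 *
              wNorm 1 s f ^ (1 - alphaOne N γ) *
              wNorm (stepExponent N γ (numSteps N γ)) s f ^ alphaOne N γ *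
              wNorm 1 (s + max (γ - 1) 0) g *
              wNorm 1 (s + max (γ - 1) 0) h ^ (1 - alphaTwo N γ) *
              wNorm (stepExponent N γ (numSteps N γ)) s h ^ alphaTwo N γ))) ∧
    -- Part (ii)
    ((N : ℝ) - 2 ≤ γ → ∀ p q : ℝ, 1 < p → p < N → 1 / p + 1 / q = 1 →
      (∃ C : ℝ≥0, ∀ b : ℝ → ℝ, IsBoundedAngular b → ∀ s : ℝ, 0 ≤ s →
        ∀ f g h : Vel N → ℝ,
          MemW 1 (s + 2 * γ - N / q) f → MemW 1 (s + 2 * γ - N / q) g →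
          MemW 1 (s + 2 * γ - N / q) h →
          IteratedGainEstimate γ b (ENNReal.ofReal p) s f g h
            (C * ENNReal.ofReal (supNorm b) ^ 2 *
              wNorm 1 (s + 2 * γ - N / q) f * wNorm 1 (s + 2 * γ - N / q) g *
              wNorm 1 (s + 2 * γ - N / q) h)) ∧
      ((N : ℝ) / (N - 1) < p →
        ∃ C : ℝ≥0, ∀ b : ℝ → ℝ, IsBoundedAngular b → ∀ s : ℝ, 0 ≤ s →
          ∀ f g h : Vel N → ℝ,
            MemW 1 (s + γ + 2 - N) f → MemW (ENNReal.ofReal p) (s + γ + 2 - N) f →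
            MemW 1 (s + 2 * γ + 1 - N) g → MemW 1 (s + 2 * γ + 1 - N) h →
            IteratedGainEstimate γ b ∞ s f g h
              (C * ENNReal.ofReal (supNorm b) ^ 2 *
                wNorm 1 (s + γ + 2 - N) f ^ (1 - q / N) *
                wNorm (ENNReal.ofReal p) (s + γ + 2 - N) f ^ (q / N) *
                wNorm 1 (s + 2 * γ + 1 - N) g * wNorm 1 (s + 2 * γ + 1 - N) h))) := by
  refine ⟨fun hγ0 hγ => ⟨fun n hn hnN => ⟨numSteps_mul_le hγ0 hγ hnN, one_lt_stepExponent hN hγ0 hn⟩,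
    exists_iteratedGainEstimate_lOne hN hγ0 hγ,
    fun n hn hn1 => exists_iteratedGainEstimate_step hN hγ0 hγ hn hn1,
    ⟨(alphaOne_mem hN hγ0 hγ).1, (alphaOne_mem hN hγ0 hγ).2, alphaTwo_mem hN hγ0 hγ⟩,
    exists_iteratedGainEstimate_top hN hγ0 hγ⟩, fun hγ p q hp hpN hpq =>
    ⟨exists_iteratedGainEstimate_hard hN hγ hp hpN hpq,
      exists_iteratedGainEstimate_top_hard hN hγ hp hpq⟩⟩
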